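/- All graphs are finite, simple and undirected. For a graph $G=(V,E)$ and $S\subseteq V$ let $G\setminus S$ be the subgraph induced on $V\setminus S$. The vertex connectivity of $G$ is the least size of a set $S$ for which $G\setminus S$ is not connected ($|V|-1$ if $G$ is complete). A \emph{$k$-shredder} is a set $S$ of $k$ vertices such that $G\setminus S$ has at least three connected components. The volume $\mathrm{vol}(Q)$ of $Q\subseteq V$ is the number of edges with at least one end in $Q$. A $k$-shredder $S$ has partition $(C,\mathcal R)$ if $C$ is a component of $G\setminus S$ of largest volume (ties broken arbitrarily) and $\mathcal R$ is the set of the other components; $\mathrm{vol}(\mathcal R)$ is the volume of $\bigcup\mathcal R$. Paths are openly disjoint if any vertex common to two of them is an endpoint of both. Let $x\in V$, let $\nu\ge 1$ be an integer and let $\Pi$ be a set of simple paths of $G$. The tuple $(x,\nu,\Pi)$ \emph{captures} a $k$-shredder $S$ with partition $(C,\mathcal R)$ if $\mathrm{vol}(\mathcal R)<|E|/k$, $x\in\bigcup\mathcal R$, $\frac12\nu<\mathrm{vol}(\mathcal R)\le\nu$, and $\Pi$ consists of exactly $k$ pairwise openly disjoint paths, each starting at $x$ and ending in $C$, whose lengths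 (numbers of edges) add up to at most $k^2\nu$. \textbf{Lemma.} There is a deterministic algorithm that, for every graph $G$ with vertex connectivity $k\ge 1$ on the vertices $0,\dots,n-1$, given by $k$ and adjacency lists stored in memory, and for every tuple $(x,\nu,\Pi)$ where $x$ is a vertex of $G$, $\nu\ge1$ is an integer and $\Pi$ is a set of simple paths of $G$ (given as a list of vertex sequences stored in memory), outputs a list $\mathcal L$ of vertex sets, all of which are $k$-shredders of $G$, and one set $U$ of vertices, such that every $k$-shredder $S$ that is captured by $(x,\nu,\Pi)$ satisfies $S\in\mathcal L$ or $S=U$. The algorithm runs in $O(k^2\,\nu\log(\nu+1))$ time, with an absolute constant, on a word RAM with unit-cost arithmetic, words of $O(\log(n+\nu+|\Pi|))$ bits and working memory that is initially zero. -/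

import Mathlib

/-! ### Graphs, connectivity, shredders -/

namespace Shredder

variable {V : Type*}

/-- A set `S` of vertices is a separator if `G ∖ S` is not connected. -/
def IsSeparator (G : SimpleGraph V) (S : Finset V) : Prop :=
  ¬ (G.induce ((S : Set V)ᶜ)).Preconnected

/-- The vertex connectivity: the least size of a separator; a complete graph, which has no
separator, has connectivity `|V| - 1` by the usual convention. (If `G` is not complete, then it has
a separator with at most `|V| - 2` elements, so that the value `|V| - 1` plays no role.) -/
noncomputable def vertexConnectivity [Fintype V] (G : SimpleGraph V) : ℕ :=
  sInf ({s | ∃ S : Finset V, IsSeparator G S ∧ S.card = s} ∪ {Fintype.card V - 1})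

/-- The connected components of `G ∖ S`. -/
abbrev Component (G : SimpleGraph V) (S : Finset V) : Type _ :=
  (G.induce ((S : Set V)ᶜ)).ConnectedComponent

/-- The vertex set, as a set of vertices of `G`, of a component of `G ∖ S`. -/
def Component.verts {G : SimpleGraph V} {S : Finset V} (C : Component G S) : Set V :=
  Subtype.val '' C.supp

/-- A `k`-shredder: a set of `k` vertices whose removal leaves at least three components. -/
def IsShredder (G : SimpleGraph V) (k : ℕ) (S : Finset V) : Prop :=
  S.card = k ∧ 3 ≤ ENat.card (Component G S)

/-- The volume of `Q`: the number of edges with at least one end in `Q`. -/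
noncomputable def vol (G : SimpleGraph V) (Q : Set V) : ℕ :=
  {e | e ∈ G.edgeSet ∧ ∃ u ∈ Q, u ∈ e}.ncard

/-- `C` is a largest component of `G ∖ S` by volume. -/
def IsLargest (G : SimpleGraph V) (S : Finset V) (C : Component G S) : Prop :=
  ∀ D : Component G S, vol G D.verts ≤ vol G C.verts

/-- The union of all components of `G ∖ S` other than `C`. -/
def rest {G : SimpleGraph V} {S : Finset V} (C : Component G S) : Set V :=
  ⋃ D ∈ {D : Component G S | D ≠ C}, D.verts

/-- A simple path of `G`, traversed from `src` to `dst`. -/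
structure VPath (G : SimpleGraph V) where
  src : V
  dst : V
  walk : G.Walk src dst
  isPath : walk.IsPath

/-- The sequence of vertices of a path, starting at `src`. -/
def VPath.verts {G : SimpleGraph V} (p : VPath G) : List V := p.walk.support

/-- The number of edges of a path. -/
def VPath.length {G : SimpleGraph V} (p : VPath G) : ℕ := p.walk.length

/-- Two paths are openly disjoint if a common vertex is an endpoint of both. -/
def OpenlyDisjoint {G : SimpleGraph V} (p q : VPath G) : Prop :=
  ∀ w, w ∈ p.verts → w ∈ q.verts → (w = p.src ∨ w = p.dst) ∧ (w = q.src ∨ w = q.dst)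

/-- `(x, ν, P)` captures `S`, an unbalanced `k`-shredder with partition `(C, R)`. The volume tie
between largest components, if there is one, may be broken in any way. -/
def Captures (G : SimpleGraph V) (k : ℕ) (x : V) (ν : ℕ) (P : Finset (VPath G))
    (S : Finset V) : Prop :=
  IsShredder G k S ∧
  ∃ C : Component G S, IsLargest G S C ∧
    (vol G (rest C) : ℝ) < (G.edgeSet.ncard : ℝ) / k ∧
    x ∈ rest C ∧
    (ν : ℝ) / 2 < vol G (rest C) ∧ vol G (rest C) ≤ ν ∧
    P.card = k ∧
    (∀ p ∈ P, p.src = x ∧ p.dst ∈ C.verts) ∧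
    (∀ p ∈ P, ∀ q ∈ P, p ≠ q → OpenlyDisjoint p q) ∧
    ∑ p ∈ P, p.length ≤ k ^ 2 * ν

end Shredder

/-! ### A deterministic word RAM

Programs are structured (`while`-) programs over finitely many registers and arrays of words.
Every operation (an arithmetic operation or a comparison, an access to a register or to an array
cell, a test) has unit cost. Words are natural numbers; in a run with word bound `B` no value larger
than `B` is ever computed. -/

namespace WordRAM

/-- Operations on words: sum, truncated difference, product, quotient rounded down, and the two
comparisons, which return `0` or `1`. -/
inductive Op
  | add | sub | mul | div | lt | eq

/-- The value of an operation. -/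
def Op.eval : Op → ℕ → ℕ → ℕ
  | .add, a, b => a + b
  | .sub, a, b => a - b
  | .mul, a, b => a * b
  | .div, a, b => a / b
  | .lt, a, b => if a < b then 1 else 0
  | .eq, a, b => if a = b then 1 else 0

/-- Expressions: constants, registers, array cells, operations. -/
inductive Expr
  | const (c : ℕ)
  | reg (r : ℕ)
  | cell (a : ℕ) (i : Expr)
  | bin (o : Op) (e f : Expr)

/-- The contents of the registers and of the arrays. -/
structure State where
  reg : ℕ → ℕ
  arr : ℕ → ℕ → ℕ

/-- The value of an expression. -/
def Expr.eval (s : State) : Expr → ℕ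
  | .const c => c
  | .reg r => s.reg r
  | .cell a i => s.arr a (i.eval s)
  | .bin o e f => o.eval (e.eval s) (f.eval s)

/-- The number of unit-cost operations in the evaluation of an expression. -/
def Expr.cost : Expr → ℕ
  | .const _ => 1
  | .reg _ => 1
  | .cell _ i => i.cost + 1
  | .bin _ e f => e.cost + f.cost + 1

/-- All values that occur in the evaluation of an expression are at most `B`. -/
def Expr.Fits (B : ℕ) (s : State) : Expr → Prop
  | .const c => c ≤ B
  | .reg r => s.reg r ≤ B
  | .cell a i => i.Fits B s ∧ s.arr a (i.eval s) ≤ B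
  | .bin o e f => e.Fits B s ∧ f.Fits B s ∧ o.eval (e.eval s) (f.eval s) ≤ B

/-- Programs. -/
inductive Prog
  | skip
  | assign (r : ℕ) (e : Expr)
  | store (a : ℕ) (i e : Expr)
  | seq (p q : Prog)
  | ite (e : Expr) (p q : Prog)
  | loop (e : Expr) (p : Prog)

/-- Write a register. -/
def State.setReg (s : State) (r v : ℕ) : State :=
  { s with reg := Function.update s.reg r v }

/-- Write an array cell. -/
def State.setCell (s : State) (a i v : ℕ) : State :=
  { s with arr := Function.update s.arr a (Function.update (s.arr a) i v) }

/-- `Runs B p s t s'`: started in `s`, the program `p` halts after exactly `t` steps in `s'`, and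
all words on the way are at most `B`. Tests succeed on nonzero values. -/
inductive Runs (B : ℕ) : Prog → State → ℕ → State → Prop
  | skip (s : State) : Runs B .skip s 1 s
  | assign (s : State) (r : ℕ) (e : Expr) (he : e.Fits B s) :
      Runs B (.assign r e) s (e.cost + 1) (s.setReg r (e.eval s))
  | store (s : State) (a : ℕ) (i e : Expr) (hi : i.Fits B s) (he : e.Fits B s) :
      Runs B (.store a i e) s (i.cost + e.cost + 1) (s.setCell a (i.eval s) (e.eval s))
  | seq (s₁ s₂ s₃ : State) (p q : Prog) (t u : ℕ) (hp : Runs B p s₁ t s₂)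
      (hq : Runs B q s₂ u s₃) : Runs B (.seq p q) s₁ (t + u) s₃
  | ite_true (s s' : State) (e : Expr) (p q : Prog) (t : ℕ) (he : e.Fits B s)
      (h : e.eval s ≠ 0) (hp : Runs B p s t s') : Runs B (.ite e p q) s (e.cost + 1 + t) s'
  | ite_false (s s' : State) (e : Expr) (p q : Prog) (t : ℕ) (he : e.Fits B s)
      (h : e.eval s = 0) (hq : Runs B q s t s') : Runs B (.ite e p q) s (e.cost + 1 + t) s'
  | loop_done (s : State) (e : Expr) (p : Prog) (he : e.Fits B s) (h : e.eval s = 0) :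
      Runs B (.loop e p) s (e.cost + 1) s
  | loop_step (s₁ s₂ s₃ : State) (e : Expr) (p : Prog) (t u : ℕ) (he : e.Fits B s₁)
      (h : e.eval s₁ ≠ 0) (hp : Runs B p s₁ t s₂) (hl : Runs B (.loop e p) s₂ u s₃) :
      Runs B (.loop e p) s₁ (e.cost + 1 + t + u) s₃

/-! A list of lists of words is stored in two arrays: the concatenation of the lists, and the
offsets, so that list number `i` occupies the cells from offset `i` up to offset `i + 1`,
exclusively. All other cells are zero. -/

/-- The array of offsets of a list of lists. -/
def offsets (l : List (List ℕ)) (i : ℕ) : ℕ :=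
  if i ≤ l.length then (l.take i).flatten.length else 0

/-- The array with the concatenation of a list of lists. -/
def contents (l : List (List ℕ)) (i : ℕ) : ℕ := l.flatten.getD i 0

/-- The list of `c` lists that is stored in an array of offsets and an array of contents. -/
def readLists (c : ℕ) (off dat : ℕ → ℕ) : List (List ℕ) :=
  (List.range c).map fun i =>
    (List.range (off (i + 1) - off i)).map fun j => dat (off i + j)

end WordRAM

/-! ### Input and output of the local algorithm -/

namespace Shredder

open WordRAM

/-- `adj` is an adjacency-list representation of `G`. -/
def IsAdjList {n : ℕ} (G : SimpleGraph (Fin n)) (adj : Fin n → List (Fin n)) : Prop :=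
  ∀ v, (adj v).Nodup ∧ ∀ w, w ∈ adj v ↔ G.Adj v w

/-- The initial state. Registers `0, …, 4` hold `n`, `k`, `x`, `ν` and the number of paths; arrays
`0` and `1` hold the adjacency lists of the vertices `0, …, n - 1`; arrays `2` and `3` hold the
vertex sequences of the paths. Everything else is zero. -/
def initState {n : ℕ} {G : SimpleGraph (Fin n)} (adj : Fin n → List (Fin n)) (k : ℕ) (x : Fin n)
    (ν : ℕ) (paths : List (VPath G)) : State :=
  let as : List (List ℕ) := List.ofFn fun v => (adj v).map Fin.val
  let ps : List (List ℕ) := paths.map fun p => p.verts.map Fin.val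
  { reg := fun
      | 0 => n
      | 1 => k
      | 2 => x.val
      | 3 => ν
      | 4 => paths.length
      | _ => 0
    arr := fun
      | 0 => offsets as
      | 1 => contents as
      | 2 => offsets ps
      | 3 => contents ps
      | _ => fun _ => 0 }

/-- The final state `s` presents the list `L` of vertex sets and the vertex set `U`: register `5`
holds the length of `L`, arrays `4` and `5` hold its members; register `6` is the number of entries
of array `6` that list `U`. -/
def HasOutput {n : ℕ} (s : State) (L : List (Finset (Fin n))) (U : Finset (Fin n)) : Prop :=
  (readLists (s.reg 5) (s.arr 4) (s.arr 5)).map List.toFinset = L.map (Finset.image Fin.val) ∧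
  ((List.range (s.reg 6)).map (s.arr 6)).toFinset = U.image Fin.val

end Shredder

/-!
The program `localShredders` works in three phases. First it marks the vertices on the paths with
their positions (`markPaths`); if the paths are not `k` openly disjoint paths from `x` of small
total length, then nothing is captured and the output is empty. Then it explores the graph along
each path in turn (`explorePaths`): from the vertices of the path, in their order, a depth-first
search runs through the unmarked vertices, with a budget of `4 ν + 1` steps per path. Two things are
recorded. For each position `h` of the path, a row of the table `M` holds the farthest position on
each path that is adjacent to what was found from the vertices before `h` (`Input.RowOK`). And each
connected piece of unmarked vertices, a bridge, that is attached to exactly one position on each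
path, and to nothing else, yields these positions as a candidate (`Input.CandOK`). Finally, a
candidate is listed if its positions have been explored and their rows of `M` do not reach beyond
the candidate (`checkCands`). The set `U` consists of the vertices at which the explorations of the
paths have ended.

*Listed sets are shredders* (`isShredder_of_candOK`). Nothing that was found from the vertices
before the candidate is adjacent to anything beyond it. Hence its removal separates the bridge, the
part of the paths before the candidate, and the vertex after the candidate on the first path.

*Captured shredders are found* (`Captures.found`). Let `S` be captured, with largest component `C`,
and let `D` be the component of `x`. Each of the `k` openly disjoint paths from `D` to `C` meets the
`k`-element set `S` in exactly one vertex (`exists_cut`): it runs in `D` before and in `C` after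
that. As `vol D ≤ ν` and there are no isolated vertices, `D` has at most `4 ν` vertices and ends of
edges altogether (`sum_degree_le`), so that an exploration cannot use up its budget before it
arrives at `S` (`DfsInv.fuel_ne_zero`), and the rows up to there do not reach beyond `S`
(`fence_of_cut`). A third component is a bridge (`bridge_of_cut`); it is attached to all of `S`,
since a smaller set would otherwise separate the graph (`exists_adj_of_mem_separator`). If some
exploration goes past `S`, it has run through this bridge, and `S` has become a candidate that
passes the check. Otherwise, all explorations end in `S`, and `S = U` (`found_or_stopped`).

*Time.* Each of the `k` explorations takes at most `4 ν + 1` steps. Such a step has constant cost,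
except that moving on along a path means copying a row of length `k`. Each candidate has used up `k`
steps for its attachments, so that there are at most `4 ν + 1` candidates, each of which is checked
in `O(k ^ 2)` time. In total this is `O(k ^ 2 ν)` (`time_le`). The working memory is initially zero,
so that neither the tables nor the stamps of the visited vertices have to be cleared.

*Correctness of programs* is expressed by `Tri`, a total-correctness triple with a bound on the time
and on the words; for programs whose loops are specified separately, it is obtained from the weakest
precondition (`Tri.of_wp`). The words computed inside an expression are bounded by a power of the
bound on the stored words, whose exponent depends on the expression only (`Expr.fits`).
-/

/-! ### Verifying programs of the word RAM -/

namespace WordRAM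

/-- Every register and every array cell holds a word of size at most `N`. -/
def State.Bdd (N : ℕ) (s : State) : Prop :=
  (∀ r, s.reg r ≤ N) ∧ ∀ a i, s.arr a i ≤ N

/-- A syntactic exponent: on a state bounded by `N ≥ 2`, no value computed on the way exceeds
`N ^ e.deg`. -/
def Expr.deg : Expr → ℕ
  | .const c => c + 1
  | .reg _ => 1
  | .cell _ i => i.deg
  | .bin _ e f => e.deg + f.deg

theorem Expr.one_le_deg (e : Expr) : 1 ≤ e.deg := by
  induction e with
  | const c => simp [deg]
  | reg r => simp [deg]
  | cell a i ih => simpa [deg] using ih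
  | bin o e f he hf => simp only [deg]; omega

theorem Expr.eval_le {N : ℕ} (hN : 2 ≤ N) {s : State} (hs : s.Bdd N) (e : Expr) :
    e.eval s ≤ N ^ e.deg := by
  have self_le : ∀ d, 1 ≤ d → N ≤ N ^ d := fun d hd => by
    simpa using Nat.pow_le_pow_right (by omega : 0 < N) hd
  induction e with
  | const c =>
    simp only [eval, deg]
    calc c ≤ 2 ^ c := c.lt_two_pow_self.le
      _ ≤ N ^ c := Nat.pow_le_pow_left hN c
      _ ≤ N ^ (c + 1) := Nat.pow_le_pow_right (by omega) (by omega)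
  | reg r => simpa [eval, deg] using hs.1 r
  | cell a i ih =>
    exact (hs.2 _ _).trans (self_le _ i.one_le_deg)
  | bin o e f he hf =>
    have h1 := self_le _ e.one_le_deg
    have h2 := self_le _ f.one_le_deg
    have h3 : N ^ e.deg + N ^ f.deg ≤ N ^ e.deg * N ^ f.deg := by nlinarith
    have h4 : N ^ e.deg ≤ N ^ e.deg * N ^ f.deg := by nlinarith
    simp only [eval, deg, pow_add]
    cases o with
    | add => simp only [Op.eval]; omega
    | sub => simp only [Op.eval]; omega
    | mul => exact Nat.mul_le_mul he hf
    | div => exact (Nat.div_le_self _ _).trans (he.trans h4)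
    | lt => simp only [Op.eval]; split_ifs <;> omega
    | eq => simp only [Op.eval]; split_ifs <;> omega

theorem Expr.fits {N D : ℕ} (hN : 2 ≤ N) {s : State} (hs : s.Bdd N) (e : Expr)
    (he : e.deg ≤ D) : e.Fits (N ^ D) s := by
  have mono : ∀ d, d ≤ D → N ^ d ≤ N ^ D := fun d hd => Nat.pow_le_pow_right (by omega) hd
  induction e with
  | const c => exact (Expr.eval_le hN hs (.const c)).trans (mono _ he)
  | reg r => exact (Expr.eval_le hN hs (.reg r)).trans (mono _ he)
  | cell a i ih => exact ⟨ih he, (Expr.eval_le hN hs (.cell a i)).trans (mono _ he)⟩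
  | bin o e f ihe ihf =>
    have := e.one_le_deg
    have := f.one_le_deg
    simp only [deg] at he
    exact ⟨ihe (by omega), ihf (by omega),
      (Expr.eval_le hN hs (.bin o e f)).trans (mono _ (by simpa [deg] using he))⟩

theorem State.Bdd.setReg {N : ℕ} {s : State} (hs : s.Bdd N) {r v : ℕ} (hv : v ≤ N) :
    (s.setReg r v).Bdd N := by
  refine ⟨fun r' => ?_, hs.2⟩
  simp only [State.setReg, Function.update_apply]
  split_ifs
  exacts [hv, hs.1 r']

theorem State.Bdd.setCell {N : ℕ} {s : State} (hs : s.Bdd N) {a i v : ℕ} (hv : v ≤ N) :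
    (s.setCell a i v).Bdd N := by
  refine ⟨hs.1, fun a' i' => ?_⟩
  simp only [State.setCell, Function.update_apply]
  split_ifs
  · simp only [Function.update_apply]
    split_ifs
    exacts [hv, hs.2 a i']
  · exact hs.2 a' i'

/-- The largest degree of an expression in a program. -/
def Prog.deg : Prog → ℕ
  | .skip => 0
  | .assign _ e => e.deg
  | .store _ i e => max i.deg e.deg
  | .seq p q => max p.deg q.deg
  | .ite e p q => max e.deg (max p.deg q.deg)
  | .loop e p => max e.deg p.deg

/-- Total correctness with a time bound: from `s`, which is bounded by `N`, the program `p` halts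
within `T` steps, all words on the way being at most `N ^ D`, in a state that is bounded by `N`
and satisfies `Q`. -/
def Tri (D N : ℕ) (p : Prog) (T : ℕ) (s : State) (Q : State → Prop) : Prop :=
  ∃ t s', Runs (N ^ D) p s t s' ∧ t ≤ T ∧ s'.Bdd N ∧ Q s'

theorem Tri.mono {D N T T' : ℕ} {p : Prog} {s : State} {Q Q' : State → Prop}
    (h : Tri D N p T s Q) (hT : T ≤ T') (hQ : ∀ s', s'.Bdd N → Q s' → Q' s') :
    Tri D N p T' s Q' := by
  obtain ⟨t, s', hr, ht, hb, hq⟩ := h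
  exact ⟨t, s', hr, ht.trans hT, hb, hQ s' hb hq⟩

theorem Tri.seq {D N T U : ℕ} {p q : Prog} {s : State} {R : State → Prop} {Q : State → Prop}
    (hp : Tri D N p T s R) (hq : ∀ s', s'.Bdd N → R s' → Tri D N q U s' Q) :
    Tri D N (.seq p q) (T + U) s Q := by
  obtain ⟨t, s', hr, ht, hb, h⟩ := hp
  obtain ⟨u, s'', hr', hu, hb', h'⟩ := hq s' hb h
  exact ⟨t + u, s'', .seq _ _ _ _ _ _ _ hr hr', by omega, hb', h'⟩

/-- Loops with a bound `m` on the number of iterations still to come. -/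
theorem Tri.loop {D N T : ℕ} {e : Expr} {p : Prog} {Q : State → Prop} (hN : 2 ≤ N)
    (he : e.deg ≤ D) (I : ℕ → State → Prop)
    (hstep : ∀ m s, s.Bdd N → I m s → e.eval s ≠ 0 →
      ∃ m', m = m' + 1 ∧ Tri D N p T s (I m'))
    (hdone : ∀ m s, s.Bdd N → I m s → e.eval s = 0 → Q s) :
    ∀ m s, s.Bdd N → I m s → Tri D N (.loop e p) (m * (T + e.cost + 1) + (e.cost + 1)) s Q := by
  intro m
  induction m with
  | zero =>
    intro s hb hI
    by_cases h : e.eval s = 0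
    · exact ⟨_, s, .loop_done _ _ _ (e.fits hN hb he) h, by omega, hb, hdone _ _ hb hI h⟩
    · obtain ⟨m', hm, -⟩ := hstep _ _ hb hI h
      omega
  | succ m ih =>
    intro s hb hI
    by_cases h : e.eval s = 0
    · exact ⟨_, s, .loop_done _ _ _ (e.fits hN hb he) h, by omega, hb, hdone _ _ hb hI h⟩
    · obtain ⟨m', hm, t, s', hr, ht, hb', hI'⟩ := hstep _ _ hb hI h
      obtain rfl : m = m' := by omega
      obtain ⟨u, s'', hr', hu, hb'', hq⟩ := ih s' hb' hI'
      refine ⟨_, s'', .loop_step _ _ _ _ _ _ _ (e.fits hN hb he) h hr hr', ?_, hb'', hq⟩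
      rw [add_mul]
      omega

/-- The weakest precondition of `Q`. A loop has to finish within `τ` steps. -/
def wp (D N τ : ℕ) : Prog → (State → Prop) → State → Prop
  | .skip, Q, s => Q s
  | .assign r e, Q, s => e.eval s ≤ N ∧ Q (s.setReg r (e.eval s))
  | .store a i e, Q, s => e.eval s ≤ N ∧ Q (s.setCell a (i.eval s) (e.eval s))
  | .seq p q, Q, s => wp D N τ p (wp D N τ q Q) s
  | .ite e p q, Q, s => (e.eval s ≠ 0 → wp D N τ p Q s) ∧ (e.eval s = 0 → wp D N τ q Q s)
  | .loop e p, Q, s => s.Bdd N → Tri D N (.loop e p) τ s Q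

/-- The number of steps of a program whose loops take `τ` steps. -/
def Prog.time (τ : ℕ) : Prog → ℕ
  | .skip => 1
  | .assign _ e => e.cost + 1
  | .store _ i e => i.cost + e.cost + 1
  | .seq p q => p.time τ + q.time τ
  | .ite e p q => e.cost + 1 + max (p.time τ) (q.time τ)
  | .loop _ _ => τ

theorem Tri.of_wp {D N τ : ℕ} (hN : 2 ≤ N) {p : Prog} (hp : p.deg ≤ D) {Q : State → Prop}
    {s : State} (hs : s.Bdd N) (h : wp D N τ p Q s) : Tri D N p (p.time τ) s Q := by
  induction p generalizing s Q with
  | skip => exact ⟨1, s, .skip s, le_rfl, hs, h⟩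
  | assign r e => exact ⟨_, _, .assign s r e (e.fits hN hs hp), le_rfl, hs.setReg h.1, h.2⟩
  | store a i e =>
    simp only [Prog.deg] at hp
    exact ⟨_, _, .store s a i e (i.fits hN hs (by omega)) (e.fits hN hs (by omega)), le_rfl,
      hs.setCell h.1, h.2⟩
  | seq p q ihp ihq =>
    simp only [Prog.deg] at hp
    exact (ihp (by omega) hs h).seq fun s' hs' h' => ihq (by omega) hs' h'
  | ite e p q ihp ihq =>
    simp only [Prog.deg] at hp
    have hf := e.fits (D := D) hN hs (by omega)
    by_cases he : e.eval s = 0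
    · obtain ⟨t, s', hr, ht, hb, hq⟩ := ihq (by omega) hs (h.2 he)
      exact ⟨_, s', .ite_false _ _ _ _ _ _ hf he hr, by simp only [Prog.time]; omega, hb, hq⟩
    · obtain ⟨t, s', hr, ht, hb, hq⟩ := ihp (by omega) hs (h.1 he)
      exact ⟨_, s', .ite_true _ _ _ _ _ _ hf he hr, by simp only [Prog.time]; omega, hb, hq⟩
  | loop e p ih => exact h hs

/-- The registers that a program writes. -/
def Prog.regs : Prog → List ℕ
  | .skip => []
  | .assign r _ => [r]
  | .store _ _ _ => []
  | .seq p q => p.regs ++ q.regs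
  | .ite _ p q => p.regs ++ q.regs
  | .loop _ p => p.regs

/-- The arrays that a program writes. -/
def Prog.arrs : Prog → List ℕ
  | .skip => []
  | .assign _ _ => []
  | .store a _ _ => [a]
  | .seq p q => p.arrs ++ q.arrs
  | .ite _ p q => p.arrs ++ q.arrs
  | .loop _ p => p.arrs

theorem Runs.reg_eq {B : ℕ} {p : Prog} {s s' : State} {t : ℕ} (h : Runs B p s t s') {r : ℕ}
    (hr : r ∉ p.regs) : s'.reg r = s.reg r := by
  induction h with
  | skip => rfl
  | assign s r' e _ =>
    have : r ≠ r' := by simpa [Prog.regs] using hr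
    simp [State.setReg, this]
  | store => rfl
  | seq _ _ _ _ _ _ _ _ _ ih1 ih2 =>
    simp only [Prog.regs, List.mem_append, not_or] at hr
    rw [ih2 hr.2, ih1 hr.1]
  | ite_true _ _ _ _ _ _ _ _ _ ih | ite_false _ _ _ _ _ _ _ _ _ ih =>
    simp only [Prog.regs, List.mem_append, not_or] at hr
    first | exact ih hr.1 | exact ih hr.2
  | loop_done => rfl
  | loop_step _ _ _ _ _ _ _ _ _ _ _ ih1 ih2 => rw [ih2 hr, ih1 hr]

theorem Runs.arr_eq {B : ℕ} {p : Prog} {s s' : State} {t : ℕ} (h : Runs B p s t s') {a : ℕ}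
    (ha : a ∉ p.arrs) : s'.arr a = s.arr a := by
  induction h with
  | skip => rfl
  | assign => rfl
  | store s a' i e _ _ =>
    have : a ≠ a' := by simpa [Prog.arrs] using ha
    simp [State.setCell, this]
  | seq _ _ _ _ _ _ _ _ _ ih1 ih2 =>
    simp only [Prog.arrs, List.mem_append, not_or] at ha
    rw [ih2 ha.2, ih1 ha.1]
  | ite_true _ _ _ _ _ _ _ _ _ ih | ite_false _ _ _ _ _ _ _ _ _ ih =>
    simp only [Prog.arrs, List.mem_append, not_or] at ha
    first | exact ih ha.1 | exact ih ha.2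
  | loop_done => rfl
  | loop_step _ _ _ _ _ _ _ _ _ _ _ ih1 ih2 => rw [ih2 ha, ih1 ha]

/-- What a program does not write is unchanged. -/
theorem Tri.frame {D N T : ℕ} {p : Prog} {s : State} {Q : State → Prop} (h : Tri D N p T s Q) :
    Tri D N p T s fun s' => Q s' ∧ (∀ r, r ∉ p.regs → s'.reg r = s.reg r) ∧
      ∀ a, a ∉ p.arrs → s'.arr a = s.arr a := by
  obtain ⟨t, s', hr, ht, hb, hq⟩ := h
  exact ⟨t, s', hr, ht, hb, hq, fun _ => hr.reg_eq, fun _ => hr.arr_eq⟩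

@[simp] theorem State.reg_setReg (s : State) (r v r' : ℕ) :
    (s.setReg r v).reg r' = if r' = r then v else s.reg r' := by
  simp [State.setReg, Function.update_apply]

@[simp] theorem State.arr_setReg (s : State) (r v : ℕ) : (s.setReg r v).arr = s.arr := rfl

@[simp] theorem State.reg_setCell (s : State) (a i v : ℕ) : (s.setCell a i v).reg = s.reg := rfl

@[simp] theorem State.arr_setCell (s : State) (a i v a' : ℕ) :
    (s.setCell a i v).arr a' = if a' = a then Function.update (s.arr a) i v else s.arr a' := by
  simp [State.setCell, Function.update_apply]

end WordRAM

/-! ### Exploring the graph along a path -/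

namespace Shredder

/-- The data on which the exploration runs: the adjacency lists `adat` with their offsets `aoff`,
the concatenated paths `pdat` with their offsets `poff`, and the marks of the vertices on the
paths. A vertex `w` is marked if `mP w ≠ 0`; then it is on path number `mP w - 1`, and `mG w` is its
position in `pdat`. The budget of the exploration of one path is `F`. -/
structure Input where
  (n k F tot x : ℕ)
  (aoff adat poff pdat mP mG : ℕ → ℕ)

namespace Input

/-- `w` occurs in the adjacency list of the vertex `u`. -/
def Nb (c : Input) (u w : ℕ) : Prop :=
  u < c.n ∧ ∃ ε, c.aoff u ≤ ε ∧ ε < c.aoff (u + 1) ∧ c.adat ε = w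

/-- The degree of a vertex. -/
def deg (c : Input) (u : ℕ) : ℕ := c.aoff (u + 1) - c.aoff u

/-- The input is consistent: adjacency is symmetric, all paths start at `x`, have at least one edge,
and meet at most in `x` and in their last vertices. Marks are as described at `Input`, with two
conventions: `x` counts as position `0` of the first path, and the last vertices of the paths count
as one position `tot` of the first path, which is beyond all others. -/
structure Marked (c : Input) : Prop where
  k_pos : 1 ≤ c.k
  x_lt : c.x < c.n
  aoff_le : ∀ u < c.n, c.aoff u ≤ c.aoff (u + 1)
  nb_symm : ∀ u w, c.Nb u w → c.Nb w u
  poff_zero : c.poff 0 = 0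
  poff_last : c.poff c.k = c.tot
  poff_lt : ∀ i < c.k, c.poff i + 1 < c.poff (i + 1)
  pdat_lt : ∀ g < c.tot, c.pdat g < c.n
  pdat_start : ∀ i < c.k, c.pdat (c.poff i) = c.x
  mark_x : c.mP c.x = 1 ∧ c.mG c.x = 0
  mark_mid : ∀ i < c.k, ∀ g, c.poff i < g → g + 1 < c.poff (i + 1) →
    c.mP (c.pdat g) = i + 1 ∧ c.mG (c.pdat g) = g
  mark_end : ∀ i < c.k, c.mP (c.pdat (c.poff (i + 1) - 1)) = 1 ∧
    c.mG (c.pdat (c.poff (i + 1) - 1)) = c.tot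
  mark_cases : ∀ v, c.mP v = 0 ∨ v = c.x ∨
    (∃ i < c.k, ∃ g, c.poff i < g ∧ g + 1 < c.poff (i + 1) ∧ v = c.pdat g) ∨
    ∃ i < c.k, v = c.pdat (c.poff (i + 1) - 1)

/-- Row `h` of the table `M` bounds what is reached from the vertices before position `h` of path
`i`: these vertices, together with a set `Z` of unmarked vertices, have no unmarked neighbours
outside `Z`, and none of their marked neighbours is beyond the positions in the row. -/
def RowOK (c : Input) (M : ℕ → ℕ) (i h : ℕ) : Prop :=
  ∃ Z : Set ℕ, (∀ u ∈ Z, u < c.n ∧ c.mP u = 0) ∧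
    ∀ u, (u ∈ Z ∨ ∃ g, c.poff i ≤ g ∧ g < h ∧ u = c.pdat g) → ∀ w, c.Nb u w →
      (c.mP w = 0 → w ∈ Z) ∧ (c.mP w ≠ 0 → c.mG w ≤ M (h * c.k + (c.mP w - 1)))

/-- The positions `a`, one on each path, are all the marked neighbours of some nonempty set of
unmarked vertices that has no further unmarked neighbours. -/
def CandOK (c : Input) (a : ℕ → ℕ) : Prop :=
  ∃ Q : Set ℕ, Q.Nonempty ∧
    (∀ u ∈ Q, u < c.n ∧ c.mP u = 0 ∧ ∀ w, c.Nb u w →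
      (c.mP w = 0 → w ∈ Q) ∧ (c.mP w ≠ 0 → c.mG w ≠ 0 ∧ a (c.mP w - 1) = c.mG w)) ∧
    ∀ j < c.k, a j ≠ 0 ∧ ∃ w, c.mP w = j + 1 ∧ c.mG w = a j

/-- A set `A` that contains the vertices before the positions `σ` on all paths, whose neighbours on
the paths are not beyond `σ`, which has no other neighbours, and which is too small to use up the
budget. The component of `x` is such a set for a captured shredder at positions `σ`. -/
structure Fence (c : Input) (A : Finset ℕ) (σ : ℕ → ℕ) : Prop where
  mid : ∀ i < c.k, c.poff i < σ i ∧ σ i + 1 < c.poff (i + 1)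
  lt : ∀ u ∈ A, u < c.n
  path : ∀ i < c.k, ∀ g, c.poff i ≤ g → g < σ i → c.pdat g ∈ A
  nb : ∀ u ∈ A, ∀ w, c.Nb u w →
    (c.mP w = 0 → w ∈ A) ∧ (c.mP w ≠ 0 → c.mG w ≤ σ (c.mP w - 1))
  sum : ∑ u ∈ A, (c.deg u + 1) < c.F

/-- A connected component `Q` of the subgraph of unmarked vertices which is attached to the
positions `σ`, one on each path, and to nothing else. -/
structure Bridge (c : Input) (Q : Set ℕ) (σ : ℕ → ℕ) : Prop where
  unmarked : ∀ u ∈ Q, c.mP u = 0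
  nb : ∀ u ∈ Q, ∀ w, c.Nb u w →
    (c.mP w = 0 → w ∈ Q) ∧ (c.mP w ≠ 0 → c.mG w ≠ 0 ∧ σ (c.mP w - 1) = c.mG w)
  conn : ∀ Y : Set ℕ, (∀ u ∈ Y, ∀ w, c.Nb u w → c.mP w = 0 → w ∈ Y) → ∀ u ∈ Q, u ∈ Y → Q ⊆ Y
  all : ∀ j < c.k, ∃ u ∈ Q, ∃ w, c.Nb u w ∧ c.mP w = j + 1

namespace Marked

variable {c : Input} (hc : c.Marked)
include hc

theorem poff_mono {i j : ℕ} (h : i ≤ j) (hj : j ≤ c.k) : c.poff i ≤ c.poff j := by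
  induction j, h using Nat.le_induction with
  | base => rfl
  | succ j hij ih =>
    have := hc.poff_lt j (by omega)
    have := ih (by omega)
    omega

theorem poff_succ_le {i : ℕ} (hi : i < c.k) : c.poff (i + 1) ≤ c.tot :=
  hc.poff_last ▸ hc.poff_mono hi le_rfl

theorem mP_le (v : ℕ) : c.mP v ≤ c.k := by
  have := hc.k_pos
  rcases hc.mark_cases v with h | rfl | ⟨i, hi, g, h1, h2, rfl⟩ | ⟨i, hi, rfl⟩
  · omega
  · rw [hc.mark_x.1]; omega
  · rw [(hc.mark_mid i hi g h1 h2).1]; omega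
  · rw [(hc.mark_end i hi).1]; omega

theorem mP_sub_lt (v : ℕ) : c.mP v - 1 < c.k := by
  have := hc.k_pos
  have := hc.mP_le v
  omega

/-- Where the mark of a path vertex comes from. -/
theorem mark_pdat {i g : ℕ} (hi : i < c.k) (h1 : c.poff i ≤ g) (h2 : g < c.poff (i + 1)) :
    (g = c.poff i ∧ c.mP (c.pdat g) = 1 ∧ c.mG (c.pdat g) = 0) ∨
    (c.poff i < g ∧ g + 1 < c.poff (i + 1) ∧ c.mP (c.pdat g) = i + 1 ∧ c.mG (c.pdat g) = g) ∨
    (g + 1 = c.poff (i + 1) ∧ c.mP (c.pdat g) = 1 ∧ c.mG (c.pdat g) = c.tot) := by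
  rcases h1.eq_or_lt with rfl | h1
  · exact .inl ⟨rfl, hc.pdat_start i hi ▸ hc.mark_x⟩
  · by_cases h : g + 1 < c.poff (i + 1)
    · exact .inr (.inl ⟨h1, h, hc.mark_mid i hi g h1 h⟩)
    · have : g = c.poff (i + 1) - 1 := by omega
      refine .inr (.inr ⟨by omega, ?_⟩)
      rw [this]
      exact hc.mark_end i hi

theorem mP_pdat {i g : ℕ} (hi : i < c.k) (h1 : c.poff i ≤ g) (h2 : g < c.poff (i + 1)) :
    c.mP (c.pdat g) ≠ 0 := by
  rcases hc.mark_pdat hi h1 h2 with ⟨-, h, -⟩ | ⟨-, -, h, -⟩ | ⟨-, h, -⟩ <;> omega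

theorem pdat_inj {i g g' : ℕ} (hi : i < c.k) (h1 : c.poff i ≤ g) (h2 : g < c.poff (i + 1))
    (h1' : c.poff i ≤ g') (h2' : g' < c.poff (i + 1)) (h : c.pdat g = c.pdat g') : g = g' := by
  have ht := hc.poff_succ_le hi
  have hG : c.mG (c.pdat g) = c.mG (c.pdat g') := by rw [h]
  rcases hc.mark_pdat hi h1 h2 with ⟨h3, h4⟩ | ⟨h3, h4, h5, h6⟩ | ⟨h3, h4, h5⟩ <;>
  rcases hc.mark_pdat hi h1' h2' with ⟨h3', h4'⟩ | ⟨h3', h4', h5', h6'⟩ | ⟨h3', h4', h5'⟩ <;>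
  omega

end Marked

end Input

/-- The state of the depth-first search in the exploration of a path. The bottom `stack 0` of the
stack is the vertex at position `g` of the path; the other entries, up to `stack top`, are unmarked
vertices of the bridge number `bid`, which is being explored. A vertex found in bridge number `b`
has the stamp `b`; the stamps from `base` on belong to the current path. The pointer of a vertex is
at the next entry of its adjacency list. -/
structure Dfs where
  (g top bid base fuel : ℕ)
  (stack ptr stamp : ℕ → ℕ)

/-- The records of the exploration: for the current bridge, the positions `att` to which it is
attached, their number `cnt`, and whether it is unsuitable (`bad ≠ 0`); the list `cand` of the
suitable bridges found so far. -/
structure Rec where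
  (cnt bad ncand : ℕ)
  (att cand : ℕ → ℕ)

/-- The adjacency-list entry `w` of `u` has been processed in the exploration of path `i`. -/
def Scanned (c : Input) (i : ℕ) (d : Dfs) (u w : ℕ) : Prop :=
  ((d.base ≤ d.stamp u ∨ u = c.pdat d.g) ∧
    ∃ ε, c.aoff u ≤ ε ∧ ε < d.ptr u ∧ c.adat ε = w) ∨
  ∃ g', c.poff i ≤ g' ∧ g' < d.g ∧ u = c.pdat g' ∧ c.Nb u w

/-- The entries processed, plus one, summed over the vertices with a stamp that is at least
`base`. -/
def Input.spent (c : Input) (base : ℕ) (stamp ptr : ℕ → ℕ) : ℕ :=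
  ∑ u ∈ Finset.range c.n, if base ≤ stamp u then ptr u - c.aoff u + 1 else 0

/-- The invariant of the depth-first search. The equation `used` accounts for the budget: each step
either advances a pointer, or pops a vertex, or moves on along the path. -/
structure DfsInv (c : Input) (i : ℕ) (d : Dfs) : Prop where
  g_ge : c.poff i ≤ d.g
  g_lt : d.g < c.poff (i + 1)
  base_pos : 1 ≤ d.base
  base_le : d.base ≤ d.bid
  stamp_le : ∀ w, d.stamp w ≤ d.bid
  stamp_unmarked : ∀ w, d.stamp w ≠ 0 → w < c.n ∧ c.mP w = 0
  stack_zero : d.stack 0 = c.pdat d.g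
  stack_stamp : ∀ t, t ≠ 0 → t ≤ d.top → d.stamp (d.stack t) = d.bid
  stack_inj : ∀ t t', t ≠ 0 → t ≤ d.top → t' ≠ 0 → t' ≤ d.top → d.stack t = d.stack t' → t = t'
  ptr_mem : ∀ u, d.base ≤ d.stamp u ∨ u = c.pdat d.g →
    c.aoff u ≤ d.ptr u ∧ d.ptr u ≤ c.aoff (u + 1)
  done : ∀ u, d.base ≤ d.stamp u → (∀ t, t ≠ 0 → t ≤ d.top → d.stack t ≠ u) →
    d.ptr u = c.aoff (u + 1)
  seen : ∀ u w, Scanned c i d u w → c.mP w = 0 → d.base ≤ d.stamp w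
  same : ∀ u w, d.base ≤ d.stamp u → Scanned c i d u w → c.mP w = 0 → d.stamp w = d.stamp u
  used : c.spent d.base d.stamp d.ptr +
    ∑ g' ∈ Finset.Ico (c.poff i) d.g, (c.deg (c.pdat g') + 1) +
    (d.ptr (c.pdat d.g) - c.aoff (c.pdat d.g)) + d.fuel = c.F + d.top
  top_le : d.top + d.fuel ≤ c.F
  bid_le : d.bid + d.fuel ≤ (i + 1) * (c.F + 1)

/-- The invariant of the table `M`. Row `d.g + 1` is under construction; the rows of earlier paths
are as in `M₀`. -/
structure RowInv (c : Input) (i : ℕ) (M₀ : ℕ → ℕ) (d : Dfs) (M : ℕ → ℕ) : Prop where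
  old : ∀ h ≤ c.poff i, ∀ j < c.k, M (h * c.k + j) = M₀ (h * c.k + j)
  row : ∀ u w, Scanned c i d u w → c.mP w ≠ 0 → c.mG w ≤ M ((d.g + 1) * c.k + (c.mP w - 1))
  fresh : ∀ h, d.g + 1 < h → ∀ j < c.k, M (h * c.k + j) = 0
  rows : ∀ h, c.poff i < h → h ≤ d.g → c.RowOK M i h
  fence : ∀ A σ, c.Fence A σ →
    (∀ h, c.poff i < h → h ≤ d.g + 1 → h ≤ σ i → ∀ j < c.k, M (h * c.k + j) ≤ σ j) ∧
    (d.g < σ i → ∀ u, d.base ≤ d.stamp u → u ∈ A)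

/-- The positions `σ` have been recorded as those of a suitable bridge. -/
def Emitted (c : Input) (r : Rec) (σ : ℕ → ℕ) : Prop :=
  ∃ t < r.ncand, ∀ j < c.k, r.att (r.cand t * c.k + j) = σ j

/-- The invariant of the records. The property `E` holds of positions that have been recorded in
the exploration of earlier paths. -/
structure AttInv (c : Input) (i : ℕ) (E : (ℕ → ℕ) → Prop) (d : Dfs) (r : Rec) : Prop where
  old : ∀ σ, E σ → Emitted c r σ
  past : ∀ g', c.poff i ≤ g' → g' < d.g → ∀ w, c.Nb (c.pdat g') w → c.mP w = 0 →
    d.stamp w < d.bid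
  idle : d.top = 0 → r.cnt = 0 ∧ r.bad = 0 ∧ ∀ w, d.stamp w ≠ d.bid
  att_eq : r.bad = 0 → ∀ u w, d.stamp u = d.bid → Scanned c i d u w → c.mP w ≠ 0 →
    c.mG w ≠ 0 ∧ r.att (d.bid * c.k + (c.mP w - 1)) = c.mG w
  att_src : ∀ j < c.k, r.att (d.bid * c.k + j) ≠ 0 →
    ∃ w, c.mP w = j + 1 ∧ c.mG w = r.att (d.bid * c.k + j)
  att_card : r.cnt = {j ∈ Finset.range c.k | r.att (d.bid * c.k + j) ≠ 0}.card
  fresh : ∀ b, d.bid < b → ∀ j < c.k, r.att (b * c.k + j) = 0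
  cand_lt : ∀ t < r.ncand, r.cand t < d.bid
  cand_ok : ∀ t < r.ncand, c.CandOK fun j => r.att (r.cand t * c.k + j)
  bridge : ∀ Q σ, c.Bridge Q σ → (∃ u ∈ Q, d.stamp u = d.bid) →
    (∀ u, d.stamp u = d.bid → u ∈ Q) ∧ r.bad = 0 ∧
      ∀ j < c.k, r.att (d.bid * c.k + j) = 0 ∨ r.att (d.bid * c.k + j) = σ j
  found : ∀ Q σ, c.Bridge Q σ → (∃ u ∈ Q, d.base ≤ d.stamp u ∧ d.stamp u < d.bid) →
    Emitted c r σ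
  cand_le : c.k * r.ncand + r.cnt + d.fuel ≤ (i + 1) * c.F

theorem row_index_inj {k h h' j j' : ℕ} (hj : j < k) (hj' : j' < k) :
    h * k + j = h' * k + j' ↔ h = h' ∧ j = j' := by
  refine ⟨fun e => ?_, by rintro ⟨rfl, rfl⟩; rfl⟩
  have h1 : (h * k + j) / k = h := by
    rw [mul_comm, Nat.mul_add_div (by omega), Nat.div_eq_of_lt hj, add_zero]
  have h2 : (h' * k + j') / k = h' := by
    rw [mul_comm, Nat.mul_add_div (by omega), Nat.div_eq_of_lt hj', add_zero]
  have : h = h' := by rw [← h1, ← h2, e]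
  subst this
  exact ⟨rfl, by omega⟩

theorem update_row {f : ℕ → ℕ} {k h h' j j' v : ℕ} (hj : j < k) (hj' : j' < k) :
    Function.update f (h * k + j) v (h' * k + j') =
      if h' = h ∧ j' = j then v else f (h' * k + j') := by
  simp only [Function.update_apply, row_index_inj hj' hj]

end Shredder

/-! ### The depth-first search along a path -/

namespace Shredder

open Finset

section

variable {c : Input} {i : ℕ} {d : Dfs}

/-- The search after one more entry of the adjacency list of the top of the stack. -/
def Dfs.next (d : Dfs) : Dfs :=
  { d with
    fuel := d.fuel - 1
    ptr := Function.update d.ptr (d.stack d.top) (d.ptr (d.stack d.top) + 1) }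

/-- The search after the discovery of `w`. -/
def Dfs.push (c : Input) (d : Dfs) (w : ℕ) : Dfs :=
  { d with
    top := d.top + 1
    stack := Function.update d.stack (d.top + 1) w
    ptr := Function.update d.ptr w (c.aoff w)
    stamp := Function.update d.stamp w d.bid }

/-- The search after the removal of the top of the stack; the end of a bridge starts a new one. -/
def Dfs.pop (d : Dfs) : Dfs :=
  { d with
    fuel := d.fuel - 1
    top := d.top - 1
    bid := if d.top = 1 then d.bid + 1 else d.bid }

/-- The search after moving on along the path. -/
def Dfs.advance (c : Input) (d : Dfs) : Dfs :=
  { d with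
    fuel := d.fuel - 1
    g := d.g + 1
    stack := Function.update d.stack 0 (c.pdat (d.g + 1))
    ptr := Function.update d.ptr (c.pdat (d.g + 1)) (c.aoff (c.pdat (d.g + 1))) }

section

variable (c : Input) (d : Dfs) (w : ℕ)

@[simp] theorem Dfs.next_g : d.next.g = d.g := rfl
@[simp] theorem Dfs.next_top : d.next.top = d.top := rfl
@[simp] theorem Dfs.next_bid : d.next.bid = d.bid := rfl
@[simp] theorem Dfs.next_base : d.next.base = d.base := rfl
@[simp] theorem Dfs.next_fuel : d.next.fuel = d.fuel - 1 := rfl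
@[simp] theorem Dfs.next_stamp : d.next.stamp = d.stamp := rfl
@[simp] theorem Dfs.push_g : (d.push c w).g = d.g := rfl
@[simp] theorem Dfs.push_top : (d.push c w).top = d.top + 1 := rfl
@[simp] theorem Dfs.push_bid : (d.push c w).bid = d.bid := rfl
@[simp] theorem Dfs.push_base : (d.push c w).base = d.base := rfl
@[simp] theorem Dfs.push_fuel : (d.push c w).fuel = d.fuel := rfl
@[simp] theorem Dfs.pop_g : d.pop.g = d.g := rfl
@[simp] theorem Dfs.pop_top : d.pop.top = d.top - 1 := rfl
@[simp] theorem Dfs.pop_base : d.pop.base = d.base := rfl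
@[simp] theorem Dfs.pop_fuel : d.pop.fuel = d.fuel - 1 := rfl
@[simp] theorem Dfs.pop_stamp : d.pop.stamp = d.stamp := rfl
@[simp] theorem Dfs.pop_ptr : d.pop.ptr = d.ptr := rfl
@[simp] theorem Dfs.advance_g : (d.advance c).g = d.g + 1 := rfl
@[simp] theorem Dfs.advance_top : (d.advance c).top = d.top := rfl
@[simp] theorem Dfs.advance_base : (d.advance c).base = d.base := rfl
@[simp] theorem Dfs.advance_fuel : (d.advance c).fuel = d.fuel - 1 := rfl
@[simp] theorem Dfs.advance_stamp : (d.advance c).stamp = d.stamp := rfl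

end

namespace DfsInv

theorem root_marked (hc : c.Marked) (hi : i < c.k) (h : DfsInv c i d) : c.mP (c.pdat d.g) ≠ 0 :=
  hc.mP_pdat hi h.g_ge h.g_lt

theorem stamp_root (hc : c.Marked) (hi : i < c.k) (h : DfsInv c i d) :
    d.stamp (c.pdat d.g) = 0 := by
  by_contra h0
  exact h.root_marked hc hi (h.stamp_unmarked _ h0).2

theorem root_lt (hc : c.Marked) (hi : i < c.k) (h : DfsInv c i d) : c.pdat d.g < c.n :=
  hc.pdat_lt _ (h.g_lt.trans_le (hc.poff_succ_le hi))

/-- The top of the stack is either the path vertex or belongs to the current bridge. -/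
theorem top_cases (hc : c.Marked) (hi : i < c.k) (h : DfsInv c i d) :
    (d.top = 0 ∧ d.stack d.top = c.pdat d.g ∧ d.stamp (d.stack d.top) = 0) ∨
    (d.top ≠ 0 ∧ d.stamp (d.stack d.top) = d.bid ∧ c.mP (d.stack d.top) = 0) := by
  by_cases h0 : d.top = 0
  · refine .inl ⟨h0, ?_⟩
    rw [h0, h.stack_zero]
    exact ⟨rfl, h.stamp_root hc hi⟩
  · have := h.stack_stamp d.top h0 le_rfl
    have hb := h.base_pos
    have hb' := h.base_le
    exact .inr ⟨h0, this, (h.stamp_unmarked _ (by omega)).2⟩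

theorem top_lt (hc : c.Marked) (hi : i < c.k) (h : DfsInv c i d) : d.stack d.top < c.n := by
  rcases h.top_cases hc hi with ⟨-, h1, -⟩ | ⟨-, h1, -⟩
  · exact h1 ▸ h.root_lt hc hi
  · have hb := h.base_pos
    have hb' := h.base_le
    exact (h.stamp_unmarked _ (by omega)).1

theorem top_active (hc : c.Marked) (hi : i < c.k) (h : DfsInv c i d) :
    d.base ≤ d.stamp (d.stack d.top) ∨ d.stack d.top = c.pdat d.g := by
  rcases h.top_cases hc hi with ⟨-, h1, -⟩ | ⟨-, h1, -⟩
  · exact .inr h1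
  · exact .inl (h1 ▸ h.base_le)

theorem nb_next (hc : c.Marked) (hi : i < c.k) (h : DfsInv c i d)
    (hp : d.ptr (d.stack d.top) < c.aoff (d.stack d.top + 1)) :
    c.Nb (d.stack d.top) (c.adat (d.ptr (d.stack d.top))) :=
  ⟨h.top_lt hc hi, _, (h.ptr_mem _ (h.top_active hc hi)).1, hp, rfl⟩

theorem scanned_next (hc : c.Marked) (hi : i < c.k) (h : DfsInv c i d) {u w : ℕ} :
    Scanned c i d.next u w ↔
      Scanned c i d u w ∨ (u = d.stack d.top ∧ w = c.adat (d.ptr (d.stack d.top))) := by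
  have ha := h.top_active hc hi
  have hm := (h.ptr_mem _ ha).1
  simp only [Scanned, Dfs.next]
  by_cases hu : u = d.stack d.top
  · subst hu
    simp only [Function.update_self, true_and]
    constructor
    · rintro (⟨-, ε, h1, h2, rfl⟩ | h1)
      · rcases (Nat.lt_succ_iff.mp h2).eq_or_lt with rfl | h3
        · exact .inr rfl
        · exact .inl (.inl ⟨ha, ε, h1, h3, rfl⟩)
      · exact .inl (.inr h1)
    · rintro ((⟨-, ε, h1, h2, rfl⟩ | h1) | rfl)
      · exact .inl ⟨ha, ε, h1, by omega, rfl⟩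
      · exact .inr h1
      · exact .inl ⟨ha, _, hm, by omega, rfl⟩
  · simp [hu]

/-- If a stamped vertex that is not on the stack is adjacent to an unmarked vertex, then the latter
has the same stamp. -/
theorem same_of_nb (h : DfsInv c i d) {u w : ℕ}
    (hw : d.base ≤ d.stamp w) (hs : ∀ t, t ≠ 0 → t ≤ d.top → d.stack t ≠ w) (hn : c.Nb w u)
    (hu : c.mP u = 0) : d.stamp u = d.stamp w := by
  obtain ⟨-, ε, h1, h2, rfl⟩ := hn
  exact h.same w _ hw (.inl ⟨.inl hw, ε, h1, by rwa [h.done w hw hs], rfl⟩) hu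

/-- Advancing the pointer of the top of the stack is paid for by one unit of the budget. -/
theorem used_next (hc : c.Marked) (hi : i < c.k) (h : DfsInv c i d) (hf : d.fuel ≠ 0) :
    c.spent d.base d.stamp d.next.ptr +
    ∑ g' ∈ Ico (c.poff i) d.g, (c.deg (c.pdat g') + 1) +
    (d.next.ptr (c.pdat d.g) - c.aoff (c.pdat d.g)) + (d.fuel - 1) = c.F + d.top := by
  have hu := h.used
  have hm := (h.ptr_mem _ (h.top_active hc hi)).1
  rcases h.top_cases hc hi with ⟨h0, h1, h2⟩ | ⟨h0, h1, h2⟩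
  · have e : ∀ u, (if d.base ≤ d.stamp u then d.next.ptr u - c.aoff u + 1 else 0) =
        if d.base ≤ d.stamp u then d.ptr u - c.aoff u + 1 else 0 := by
      intro u
      split_ifs with hb
      · have : u ≠ d.stack d.top := by
          rintro rfl
          have := h.base_pos
          omega
        simp [Dfs.next, Function.update_of_ne this]
      · rfl
    simp only [Input.spent, e] at hu ⊢
    have : d.next.ptr (c.pdat d.g) = d.ptr (c.pdat d.g) + 1 := by simp [Dfs.next, h1]
    rw [h1] at hm
    omega
  · have hne : c.pdat d.g ≠ d.stack d.top := by
      intro he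
      exact h.root_marked hc hi (he ▸ h2)
    have e : d.next.ptr (c.pdat d.g) = d.ptr (c.pdat d.g) := by
      simp [Dfs.next, Function.update_of_ne hne]
    have hmem : d.stack d.top ∈ range c.n := mem_range.mpr (h.top_lt hc hi)
    rw [e]
    rw [Input.spent, ← add_sum_erase _ _ hmem] at hu ⊢
    have hb := h.base_le
    have e2 : ∑ u ∈ (range c.n).erase (d.stack d.top),
        (if d.base ≤ d.stamp u then d.next.ptr u - c.aoff u + 1 else 0) =
        ∑ u ∈ (range c.n).erase (d.stack d.top),
        (if d.base ≤ d.stamp u then d.ptr u - c.aoff u + 1 else 0) := by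
      refine sum_congr rfl fun u hu => ?_
      simp [Dfs.next, Function.update_of_ne (ne_of_mem_erase hu)]
    rw [e2]
    have e3 : d.next.ptr (d.stack d.top) = d.ptr (d.stack d.top) + 1 := by simp [Dfs.next]
    rw [if_pos (by omega)] at hu ⊢
    omega

theorem ptr_mem_next (h : DfsInv c i d)
    (hp : d.ptr (d.stack d.top) < c.aoff (d.stack d.top + 1)) (u : ℕ)
    (hu : d.base ≤ d.stamp u ∨ u = c.pdat d.g) :
    c.aoff u ≤ d.next.ptr u ∧ d.next.ptr u ≤ c.aoff (u + 1) := by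
  have hm := h.ptr_mem u hu
  simp only [Dfs.next, Function.update_apply]
  split_ifs with h0
  · subst h0
    omega
  · exact hm

theorem done_next (h : DfsInv c i d) (hc : c.Marked) (hi : i < c.k) (u : ℕ)
    (hu : d.base ≤ d.stamp u) (hs : ∀ t, t ≠ 0 → t ≤ d.top → d.stack t ≠ u) :
    d.next.ptr u = c.aoff (u + 1) := by
  rw [← h.done u hu hs]
  have : u ≠ d.stack d.top := by
    rintro rfl
    rcases h.top_cases hc hi with ⟨-, -, h2⟩ | ⟨h0, -, -⟩
    · have := h.base_pos
      omega
    · exact hs d.top h0 le_rfl rfl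
  simp [Dfs.next, Function.update_of_ne this]

/-- Processing an entry that is marked or has been found before. -/
theorem next (hc : c.Marked) (hi : i < c.k) (h : DfsInv c i d) (hf : d.fuel ≠ 0)
    (hp : d.ptr (d.stack d.top) < c.aoff (d.stack d.top + 1))
    (hw : c.mP (c.adat (d.ptr (d.stack d.top))) = 0 →
      d.base ≤ d.stamp (c.adat (d.ptr (d.stack d.top)))) : DfsInv c i d.next where
  g_ge := h.g_ge
  g_lt := h.g_lt
  base_pos := h.base_pos
  base_le := h.base_le
  stamp_le := h.stamp_le
  stamp_unmarked := h.stamp_unmarked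
  stack_zero := h.stack_zero
  stack_stamp := h.stack_stamp
  stack_inj := h.stack_inj
  ptr_mem := h.ptr_mem_next hp
  done := h.done_next hc hi
  seen u w hs hw0 := by
    rcases (h.scanned_next hc hi).mp hs with hs | ⟨rfl, rfl⟩
    · exact h.seen u w hs hw0
    · exact hw hw0
  same u w hu hs hw0 := by
    rcases (h.scanned_next hc hi).mp hs with hs | ⟨rfl, rfl⟩
    · exact h.same u w hu hs hw0
    · change d.base ≤ d.stamp _ at hu
      change d.stamp _ = d.stamp _
      rcases h.top_cases hc hi with ⟨-, -, h2⟩ | ⟨h0, h1, h2⟩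
      · have := h.base_pos
        omega
      · by_cases hst : ∀ t, t ≠ 0 → t ≤ d.top → d.stack t ≠ c.adat (d.ptr (d.stack d.top))
        · exact (h.same_of_nb (hw hw0) hst (hc.nb_symm _ _ (h.nb_next hc hi hp)) h2).symm
        · push Not at hst
          obtain ⟨t, ht0, ht, e⟩ := hst
          rw [← e, h.stack_stamp t ht0 ht, h1]
  used := by
    simp only [Dfs.next_base, Dfs.next_stamp, Dfs.next_g, Dfs.next_fuel, Dfs.next_top]
    exact h.used_next hc hi hf
  top_le := by
    have := h.top_le
    simp only [Dfs.next]
    omega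
  bid_le := by
    have := h.bid_le
    simp only [Dfs.next]
    omega

theorem scanned_push (h : DfsInv c i d) (hc : c.Marked) (hi : i < c.k) {v : ℕ} (hv0 : c.mP v = 0)
    (hvs : d.stamp v < d.base) {u w : ℕ} :
    Scanned c i (d.next.push c v) u w ↔
      Scanned c i d u w ∨ (u = d.stack d.top ∧ w = c.adat (d.ptr (d.stack d.top))) := by
  rw [← h.scanned_next hc hi]
  have hb := h.base_le
  have hroot : c.pdat d.g ≠ v := fun e => h.root_marked hc hi (e ▸ hv0)
  simp only [Scanned, Dfs.push, Dfs.next]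
  by_cases hu : u = v
  · subst hu
    simp only [Function.update_self, hroot.symm, or_false, not_le.mpr hvs]
    constructor
    · rintro (⟨-, ε, h1, h2, -⟩ | h1)
      · omega
      · exact .inr h1
    · rintro (⟨h1, -⟩ | h1)
      · exact h1.elim
      · exact .inr h1
  · simp only [Function.update_of_ne hu]

/-- Discovering a vertex. -/
theorem push (hc : c.Marked) (hi : i < c.k) (h : DfsInv c i d) (hf : d.fuel ≠ 0)
    (hp : d.ptr (d.stack d.top) < c.aoff (d.stack d.top + 1)) {v : ℕ}
    (hv : v = c.adat (d.ptr (d.stack d.top))) (hv0 : c.mP v = 0) (hvs : d.stamp v < d.base) :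
    DfsInv c i (d.next.push c v) := by
  have hb := h.base_le
  have hb1 := h.base_pos
  have hn : c.Nb (d.stack d.top) v := hv ▸ h.nb_next hc hi hp
  have hvn : v < c.n := (hc.nb_symm _ _ hn).1
  have hroot : c.pdat d.g ≠ v := fun e => h.root_marked hc hi (e ▸ hv0)
  have hst : ∀ t, t ≤ d.top → d.stack t ≠ v := by
    rintro t ht rfl
    by_cases ht0 : t = 0
    · subst ht0
      exact hroot h.stack_zero.symm
    · have := h.stack_stamp t ht0 ht
      omega
  have stamp_eq : ∀ w, (d.next.push c v).stamp w = if w = v then d.bid else d.stamp w := fun w => by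
    simp [Dfs.push, Dfs.next, Function.update_apply]
  have stack_eq : ∀ t, (d.next.push c v).stack t = if t = d.top + 1 then v else d.stack t :=
    fun t => by simp [Dfs.push, Dfs.next, Function.update_apply]
  have ptr_eq : ∀ u, (d.next.push c v).ptr u = if u = v then c.aoff v else d.next.ptr u :=
    fun u => by simp [Dfs.push, Function.update_apply]
  refine ⟨h.g_ge, h.g_lt, hb1, hb, fun w => ?_, fun w hw => ?_, ?_, fun t ht0 ht => ?_,
    fun t t' ht0 ht ht0' ht' e => ?_, fun u hu => ?_, fun u hu hs => ?_, fun u w hs hw => ?_,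
    fun u w hu hs hw => ?_, ?_, ?_, ?_⟩
  · rw [stamp_eq]
    split_ifs
    exacts [le_rfl, h.stamp_le w]
  · rw [stamp_eq] at hw
    split_ifs at hw with e
    · subst e
      exact ⟨hvn, hv0⟩
    · exact h.stamp_unmarked w hw
  · rw [stack_eq, if_neg (by omega)]
    exact h.stack_zero
  · change t ≤ d.top + 1 at ht
    rw [stamp_eq, stack_eq]
    split_ifs with h1 h2 h2
    · rfl
    · exact absurd rfl h2
    · rfl
    · exact h.stack_stamp t ht0 (by omega)
  · change t ≤ d.top + 1 at ht
    change t' ≤ d.top + 1 at ht'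
    rw [stack_eq, stack_eq] at e
    split_ifs at e with h1 h2 h2
    · omega
    · exact absurd e.symm (hst t' (by omega))
    · exact absurd e (hst t (by omega))
    · exact h.stack_inj t t' ht0 (by omega) ht0' (by omega) e
  · rw [ptr_eq]
    split_ifs with e
    · subst e
      exact ⟨le_rfl, hc.aoff_le _ hvn⟩
    · refine h.ptr_mem_next hp u ?_
      rwa [stamp_eq, if_neg e] at hu
  · have e : u ≠ v := by
      rintro rfl
      refine hs (d.top + 1) (by omega) le_rfl ?_
      rw [stack_eq, if_pos rfl]
    rw [ptr_eq, if_neg e]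
    rw [stamp_eq, if_neg e] at hu
    refine h.done_next hc hi u hu fun t ht0 ht => ?_
    have := hs t ht0 (show t ≤ d.top + 1 by omega)
    rwa [stack_eq, if_neg (by omega)] at this
  · rw [h.scanned_push hc hi hv0 hvs] at hs
    rw [stamp_eq]
    split_ifs with e
    · exact hb
    · rcases hs with hs | ⟨rfl, rfl⟩
      · exact h.seen u w hs hw
      · exact absurd hv.symm e
  · change d.base ≤ _ at hu
    rw [h.scanned_push hc hi hv0 hvs] at hs
    rw [stamp_eq, stamp_eq]
    rcases hs with hs | ⟨rfl, rfl⟩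
    · have hwv : w ≠ v := by
        rintro rfl
        have := h.seen u w hs hw
        omega
      rw [if_neg hwv]
      split_ifs with e
      · subst e
        rcases hs with ⟨h1, -⟩ | ⟨g', h1, h2, rfl, h4⟩
        · rcases h1 with h1 | h1
          · omega
          · exact absurd h1.symm hroot
        · exact absurd hv0 (hc.mP_pdat hi h1 (h2.trans h.g_lt))
      · rw [stamp_eq, if_neg e] at hu
        exact h.same u w hu hs hw
    · rw [if_pos hv.symm]
      split_ifs with e
      · rfl
      · rw [stamp_eq, if_neg e] at hu
        rcases h.top_cases hc hi with ⟨-, -, h2⟩ | ⟨-, h1, -⟩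
        · omega
        · exact h1.symm
  · have hu := h.used_next hc hi hf
    have hmem : v ∈ range c.n := mem_range.mpr hvn
    have e1 : (d.next.push c v).ptr (c.pdat d.g) = d.next.ptr (c.pdat d.g) := by
      rw [ptr_eq, if_neg hroot]
    simp only [Dfs.next_base, Dfs.next_g, Dfs.next_fuel, Dfs.next_top, Dfs.push_base, Dfs.push_g,
      Dfs.push_fuel, Dfs.push_top]
    rw [e1]
    rw [Input.spent, ← add_sum_erase _ _ hmem, if_neg (by omega)] at hu
    rw [Input.spent, ← add_sum_erase _ _ hmem]
    have e2 : ∑ u ∈ (range c.n).erase v, (if d.base ≤ (d.next.push c v).stamp u then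
        (d.next.push c v).ptr u - c.aoff u + 1 else 0) = ∑ u ∈ (range c.n).erase v,
        (if d.base ≤ d.stamp u then d.next.ptr u - c.aoff u + 1 else 0) := by
      refine sum_congr rfl fun u hu => ?_
      rw [stamp_eq, ptr_eq, if_neg (ne_of_mem_erase hu), if_neg (ne_of_mem_erase hu)]
    rw [e2, stamp_eq, ptr_eq, if_pos rfl, if_pos rfl, if_pos hb]
    omega
  · have := h.top_le
    simp only [Dfs.push, Dfs.next]
    omega
  · have := h.bid_le
    simp only [Dfs.push, Dfs.next]
    omega

/-- Removing a vertex whose adjacency list has been processed. -/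
theorem pop (h : DfsInv c i d) (hf : d.fuel ≠ 0)
    (hp : ¬ d.ptr (d.stack d.top) < c.aoff (d.stack d.top + 1)) (ht : d.top ≠ 0) :
    DfsInv c i d.pop := by
  have hb := h.base_le
  have hbid : d.bid ≤ d.pop.bid ∧ d.pop.bid ≤ d.bid + 1 ∧ (d.top ≠ 1 → d.pop.bid = d.bid) := by
    simp only [Dfs.pop]
    split_ifs <;> omega
  refine ⟨h.g_ge, h.g_lt, h.base_pos, hb.trans hbid.1, fun w => (h.stamp_le w).trans hbid.1,
    h.stamp_unmarked, h.stack_zero, fun t ht0 ht => ?_, fun t t' ht0 ht ht0' ht' => ?_,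
    h.ptr_mem, fun u hu hs => ?_, h.seen, h.same, ?_, ?_, ?_⟩
  · change t ≤ d.top - 1 at ht
    rw [hbid.2.2 (by omega)]
    exact h.stack_stamp t ht0 (by omega)
  · change t ≤ d.top - 1 at ht
    change t' ≤ d.top - 1 at ht'
    exact h.stack_inj t t' ht0 (by omega) ht0' (by omega)
  · by_cases hu' : d.stack d.top = u
    · subst hu'
      exact le_antisymm (h.ptr_mem _ (.inl hu)).2 (not_lt.mp hp)
    · refine h.done u hu fun t ht0 ht => ?_
      by_cases e : t = d.top
      · exact e ▸ hu'
      · exact hs t ht0 (show t ≤ d.top - 1 by omega)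
  · have := h.used
    simp only [Dfs.pop_base, Dfs.pop_stamp, Dfs.pop_ptr, Dfs.pop_g, Dfs.pop_fuel, Dfs.pop_top]
    omega
  · have := h.top_le
    simp only [Dfs.pop]
    omega
  · have := h.bid_le
    change d.pop.bid + (d.fuel - 1) ≤ _
    omega

theorem scanned_advance (hc : c.Marked) (hi : i < c.k) (h : DfsInv c i d)
    (hp : ¬ d.ptr (d.stack d.top) < c.aoff (d.stack d.top + 1)) (ht : d.top = 0)
    (hg : d.g + 1 < c.poff (i + 1)) {u w : ℕ} :
    Scanned c i (d.advance c) u w ↔ Scanned c i d u w := by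
  have hptr : d.ptr (c.pdat d.g) = c.aoff (c.pdat d.g + 1) := by
    rw [ht, h.stack_zero] at hp
    exact le_antisymm (h.ptr_mem _ (.inr rfl)).2 (not_lt.mp hp)
  have hmark := hc.mP_pdat hi (by have := h.g_ge; omega) hg
  have hb := h.base_pos
  have hne : ∀ u, d.base ≤ d.stamp u → u ≠ c.pdat (d.g + 1) := by
    rintro u hu rfl
    exact hmark (h.stamp_unmarked _ (by omega)).2
  have hne' : c.pdat d.g ≠ c.pdat (d.g + 1) := fun e => by
    have := hc.pdat_inj hi h.g_ge h.g_lt (by have := h.g_ge; omega) hg e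
    omega
  simp only [Scanned, Dfs.advance]
  constructor
  · rintro (⟨hu | rfl, ε, h1, h2, h3⟩ | ⟨g', h1, h2, rfl, h3⟩)
    · rw [Function.update_of_ne (hne u hu)] at h2
      exact .inl ⟨.inl hu, ε, h1, h2, h3⟩
    · rw [Function.update_self] at h2
      omega
    · rcases (Nat.lt_succ_iff.mp h2).eq_or_lt with rfl | h4
      · obtain ⟨-, ε, h5, h6, h7⟩ := h3
        exact .inl ⟨.inr rfl, ε, h5, by omega, h7⟩
      · exact .inr ⟨g', h1, h4, rfl, h3⟩
  · rintro (⟨hu | rfl, ε, h1, h2, h3⟩ | ⟨g', h1, h2, rfl, h3⟩)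
    · refine .inl ⟨.inl hu, ε, h1, ?_, h3⟩
      rwa [Function.update_of_ne (hne u hu)]
    · exact .inr ⟨d.g, h.g_ge, by omega, rfl, h.root_lt hc hi, ε, h1, by omega, h3⟩
    · exact .inr ⟨g', h1, by omega, rfl, h3⟩

/-- Moving on along the path. -/
theorem advance (hc : c.Marked) (hi : i < c.k) (h : DfsInv c i d) (hf : d.fuel ≠ 0)
    (hp : ¬ d.ptr (d.stack d.top) < c.aoff (d.stack d.top + 1)) (ht : d.top = 0)
    (hg : d.g + 1 < c.poff (i + 1)) : DfsInv c i (d.advance c) := by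
  have hsc := fun u w => h.scanned_advance hc hi hp ht hg (u := u) (w := w)
  have hptr : d.ptr (c.pdat d.g) = c.aoff (c.pdat d.g + 1) := by
    rw [ht, h.stack_zero] at hp
    exact le_antisymm (h.ptr_mem _ (.inr rfl)).2 (not_lt.mp hp)
  have hmark := hc.mP_pdat hi (by have := h.g_ge; omega) hg
  have hb := h.base_pos
  have hne : ∀ u, d.base ≤ d.stamp u → u ≠ c.pdat (d.g + 1) := by
    rintro u hu rfl
    exact hmark (h.stamp_unmarked _ (by omega)).2
  have hstack : ∀ t, t ≠ 0 → (d.advance c).stack t = d.stack t := fun t ht0 => by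
    simp [Dfs.advance, Function.update_of_ne ht0]
  have hn : c.pdat (d.g + 1) < c.n := hc.pdat_lt _ (hg.trans_le (hc.poff_succ_le hi))
  refine ⟨h.g_ge.trans (Nat.le_succ _), hg, hb, h.base_le, h.stamp_le, h.stamp_unmarked, ?_,
    fun t ht0 ht' => ?_, fun t t' ht0 ht' => ?_, fun u hu => ?_, fun u hu hs => ?_,
    fun u w hs => h.seen u w ((hsc u w).mp hs), fun u w hu hs => h.same u w hu ((hsc u w).mp hs),
    ?_, ?_, ?_⟩
  · simp [Dfs.advance]
  · change t ≤ d.top at ht'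
    omega
  · change t ≤ d.top at ht'
    omega
  · by_cases e : u = c.pdat (d.g + 1)
    · subst e
      simp only [Dfs.advance, Function.update_self]
      exact ⟨le_rfl, hc.aoff_le _ hn⟩
    · simp only [Dfs.advance, Function.update_of_ne e]
      rcases hu with hu | hu
      · exact h.ptr_mem u (.inl hu)
      · exact absurd hu e
  · simp only [Dfs.advance, Function.update_of_ne (hne u hu)]
    refine h.done u hu fun t ht0 ht' => ?_
    omega
  · have hu := h.used
    have e1 : c.spent d.base d.stamp (d.advance c).ptr = c.spent d.base d.stamp d.ptr := by
      refine sum_congr rfl fun u _ => ?_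
      split_ifs with hu
      · simp [Dfs.advance, Function.update_of_ne (hne u hu)]
      · rfl
    have e2 : (d.advance c).ptr (c.pdat (d.g + 1)) = c.aoff (c.pdat (d.g + 1)) := by
      simp [Dfs.advance]
    simp only [Dfs.advance_base, Dfs.advance_stamp, Dfs.advance_g, Dfs.advance_fuel,
      Dfs.advance_top]
    rw [e1, e2, sum_Ico_succ_top h.g_ge]
    have : c.deg (c.pdat d.g) = c.aoff (c.pdat d.g + 1) - c.aoff (c.pdat d.g) := rfl
    omega
  · have := h.top_le
    simp only [Dfs.advance]
    omega
  · have := h.bid_le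
    simp only [Dfs.advance]
    omega

/-- As long as the search stays within a fence, the budget is not used up: the vertices visited,
with their degrees, are those of a part of the fence, and `Input.Fence.sum` bounds these. -/
theorem fuel_ne_zero (hc : c.Marked) (hi : i < c.k) (h : DfsInv c i d) {A : Finset ℕ}
    {σ : ℕ → ℕ} (hA : c.Fence A σ) (hg : d.g < σ i) (hs : ∀ u, d.base ≤ d.stamp u → u ∈ A) :
    d.fuel ≠ 0 := by
  intro hf
  have hu := h.used
  have hsum := hA.sum
  have h1 : c.spent d.base d.stamp d.ptr ≤
      ∑ u ∈ range c.n with d.base ≤ d.stamp u, (c.deg u + 1) := by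
    rw [Input.spent, ← sum_filter]
    refine sum_le_sum fun u hu => ?_
    have := h.ptr_mem u (.inl (mem_filter.mp hu).2)
    simp only [Input.deg]
    omega
  have h2 := (h.ptr_mem _ (.inr rfl))
  have h3 : ∑ g' ∈ Ico (c.poff i) (d.g + 1), (c.deg (c.pdat g') + 1) =
      ∑ u ∈ (Ico (c.poff i) (d.g + 1)).image c.pdat, (c.deg u + 1) := by
    rw [sum_image]
    intro a ha b hb e
    have hl := h.g_lt
    simp only [coe_Ico, Set.mem_Ico] at ha hb
    exact hc.pdat_inj hi ha.1 (by omega) hb.1 (by omega) e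
  have h4 : Disjoint ({u ∈ range c.n | d.base ≤ d.stamp u})
      ((Ico (c.poff i) (d.g + 1)).image c.pdat) := by
    rw [disjoint_left]
    intro u hu hu'
    obtain ⟨g', hg', rfl⟩ := mem_image.mp hu'
    have hl := h.g_lt
    have hb := h.base_pos
    rw [mem_Ico] at hg'
    have := (mem_filter.mp hu).2
    exact hc.mP_pdat hi hg'.1 (by omega) (h.stamp_unmarked _ (by omega)).2
  have h5 : ({u ∈ range c.n | d.base ≤ d.stamp u}) ∪
      (Ico (c.poff i) (d.g + 1)).image c.pdat ⊆ A := by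
    refine union_subset (fun u hu => hs u (mem_filter.mp hu).2) fun u hu => ?_
    obtain ⟨g', hg', rfl⟩ := mem_image.mp hu
    rw [mem_Ico] at hg'
    exact hA.path i hi g' hg'.1 (by omega)
  have h6 := sum_le_sum_of_subset (f := fun u => c.deg u + 1) h5
  rw [sum_union h4, ← h3, sum_Ico_succ_top h.g_ge] at h6
  have : c.deg (c.pdat d.g) = c.aoff (c.pdat d.g + 1) - c.aoff (c.pdat d.g) := rfl
  omega

end DfsInv

end

end Shredder

/-! ### Rows of farthest attachments and the recording of bridges -/

namespace Shredder

open Finset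

section

variable {c : Input} {i : ℕ} {d : Dfs} {M₀ M M' : ℕ → ℕ} {r : Rec}
  {E : (ℕ → ℕ) → Prop}

theorem Input.RowOK.congr {h : ℕ} (hM : ∀ j < c.k, M' (h * c.k + j) = M (h * c.k + j))
    (hc : c.Marked) (hr : c.RowOK M i h) : c.RowOK M' i h := by
  obtain ⟨Z, h1, h2⟩ := hr
  refine ⟨Z, h1, fun u hu w hw => ⟨(h2 u hu w hw).1, fun hm => ?_⟩⟩
  rw [hM _ (hc.mP_sub_lt w)]
  exact (h2 u hu w hw).2 hm

namespace RowInv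

theorem next_unmarked (hc : c.Marked) (hi : i < c.k) (hd : DfsInv c i d) (h : RowInv c i M₀ d M)
    (hw : c.mP (c.adat (d.ptr (d.stack d.top))) = 0) : RowInv c i M₀ d.next M where
  old := h.old
  row u w hs hm := by
    rcases (hd.scanned_next hc hi).mp hs with hs | ⟨-, rfl⟩
    · exact h.row u w hs hm
    · exact absurd hw hm
  fresh := h.fresh
  rows := h.rows
  fence := h.fence

theorem push (hc : c.Marked) (hi : i < c.k) (hd : DfsInv c i d) (h : RowInv c i M₀ d M)
    (hp : d.ptr (d.stack d.top) < c.aoff (d.stack d.top + 1)) {v : ℕ}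
    (hv : v = c.adat (d.ptr (d.stack d.top))) (hv0 : c.mP v = 0) (hvs : d.stamp v < d.base) :
    RowInv c i M₀ (d.next.push c v) M where
  old := h.old
  row u w hs hm := by
    rcases (hd.scanned_push hc hi hv0 hvs).mp hs with hs | ⟨-, rfl⟩
    · exact h.row u w hs hm
    · exact absurd (hv ▸ hv0) hm
  fresh := h.fresh
  rows := h.rows
  fence A σ hA := by
    refine ⟨(h.fence A σ hA).1, fun hg u hu => ?_⟩
    by_cases e : u = v
    · have hn := hd.nb_next hc hi hp
      rw [← hv] at hn
      have ht : d.stack d.top ∈ A := by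
        rcases hd.top_active hc hi with h1 | h1
        · exact (h.fence A σ hA).2 hg _ h1
        · exact h1 ▸ hA.path i hi d.g hd.g_ge hg
      exact e ▸ (hA.nb _ ht v hn).1 hv0
    · refine (h.fence A σ hA).2 hg u ?_
      simpa [Dfs.push, Function.update_of_ne e] using hu

/-- Processing a marked neighbour `w`: its entry in the row under construction becomes the maximum
of the old value and the position of `w`. -/
theorem next_marked (hc : c.Marked) (hi : i < c.k) (hd : DfsInv c i d) (h : RowInv c i M₀ d M)
    (hp : d.ptr (d.stack d.top) < c.aoff (d.stack d.top + 1)) {w : ℕ}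
    (hw : w = c.adat (d.ptr (d.stack d.top))) (hm : c.mP w ≠ 0)
    {z : ℕ} (hz : z = (d.g + 1) * c.k + (c.mP w - 1)) :
    RowInv c i M₀ d.next (Function.update M z (M z + (c.mG w - M z))) := by
  subst hz
  have hk := hc.mP_sub_lt
  have hupd : ∀ h, ∀ j < c.k, Function.update M ((d.g + 1) * c.k + (c.mP w - 1))
      (M ((d.g + 1) * c.k + (c.mP w - 1)) +
        (c.mG w - M ((d.g + 1) * c.k + (c.mP w - 1)))) (h * c.k + j) =
      if h = d.g + 1 ∧ j = c.mP w - 1 then M ((d.g + 1) * c.k + (c.mP w - 1)) +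
        (c.mG w - M ((d.g + 1) * c.k + (c.mP w - 1))) else M (h * c.k + j) :=
    fun h j hj => update_row (hk w) hj
  refine ⟨fun h' hh j hj => ?_, fun u w' hs hm' => ?_, fun h' hh j hj => ?_, fun h' h1 h2 => ?_,
    fun A σ hA => ?_⟩
  · have := hd.g_ge
    rw [hupd _ _ hj, if_neg (by omega)]
    exact h.old h' hh j hj
  · simp only [Dfs.next_g]
    rw [hupd _ _ (hk w')]
    have key : c.mG w' ≤ M ((d.g + 1) * c.k + (c.mP w' - 1)) ∨ w' = w := by
      rcases (hd.scanned_next hc hi).mp hs with hs | ⟨-, rfl⟩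
      · exact .inl (h.row u w' hs hm')
      · exact .inr hw.symm
    split_ifs with e
    · rcases key with key | rfl
      · rw [e.2] at key
        omega
      · omega
    · rcases key with key | rfl
      · exact key
      · exact absurd ⟨rfl, rfl⟩ e
  · simp only [Dfs.next_g] at hh
    rw [hupd _ _ hj, if_neg (by omega)]
    exact h.fresh h' hh j hj
  · simp only [Dfs.next_g] at h2
    refine (h.rows h' h1 h2).congr (fun j hj => ?_) hc
    rw [hupd _ _ hj, if_neg (by omega)]
  · refine ⟨fun h' h1 h2 h3 j hj => ?_, (h.fence A σ hA).2⟩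
    simp only [Dfs.next_g] at h2
    have hold := (h.fence A σ hA).1 h' h1 h2 h3 j hj
    rw [hupd _ _ hj]
    split_ifs with e
    · obtain ⟨rfl, rfl⟩ := e
      have hn := hd.nb_next hc hi hp
      rw [← hw] at hn
      have ht : d.stack d.top ∈ A := by
        rcases hd.top_active hc hi with h1 | h1
        · exact (h.fence A σ hA).2 h3 _ h1
        · exact h1 ▸ hA.path i hi d.g hd.g_ge h3
      have := (hA.nb _ ht w hn).2 hm
      omega
    · exact hold

theorem pop (h : RowInv c i M₀ d M) : RowInv c i M₀ d.pop M :=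
  ⟨h.old, h.row, h.fresh, h.rows, h.fence⟩

/-- Moving on along the path: the row just completed is copied to the next one. -/
theorem advance (hc : c.Marked) (hi : i < c.k) (hd : DfsInv c i d) (h : RowInv c i M₀ d M)
    (hp : ¬ d.ptr (d.stack d.top) < c.aoff (d.stack d.top + 1)) (ht : d.top = 0)
    (hg : d.g + 1 < c.poff (i + 1))
    (hM : ∀ j < c.k, M' ((d.g + 2) * c.k + j) = M ((d.g + 1) * c.k + j))
    (hM' : ∀ h, h ≠ d.g + 2 → ∀ j < c.k, M' (h * c.k + j) = M (h * c.k + j)) :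
    RowInv c i M₀ (d.advance c) M' := by
  have hsc := fun u w => hd.scanned_advance hc hi hp ht hg (u := u) (w := w)
  refine ⟨fun h' hh j hj => ?_, fun u w hs hm => ?_, fun h' hh j hj => ?_, fun h' h1 h2 => ?_,
    fun A σ hA => ?_⟩
  · have := hd.g_ge
    rw [hM' h' (by omega) j hj]
    exact h.old h' hh j hj
  · rw [Dfs.advance_g, hM _ (hc.mP_sub_lt w)]
    exact h.row u w ((hsc u w).mp hs) hm
  · rw [Dfs.advance_g] at hh
    rw [hM' h' (by omega) j hj]
    exact h.fresh h' (by omega) j hj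
  · rw [Dfs.advance_g] at h2
    rcases h2.eq_or_lt with rfl | h2
    · -- the stack is empty, so everything found so far is closed and witnesses the completed row
      have hb := hd.base_pos
      have hdone : ∀ u, d.base ≤ d.stamp u → d.ptr u = c.aoff (u + 1) := fun u hu =>
        hd.done u hu fun t ht0 ht' => by omega
      have hroot : d.ptr (c.pdat d.g) = c.aoff (c.pdat d.g + 1) := by
        rw [ht, hd.stack_zero] at hp
        exact le_antisymm (hd.ptr_mem _ (.inr rfl)).2 (not_lt.mp hp)
      refine ⟨{u | d.base ≤ d.stamp u}, fun u hu => hd.stamp_unmarked u ?_, fun u hu w hw => ?_⟩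
      · have : d.base ≤ d.stamp u := hu
        omega
      · have hs : Scanned c i d u w := by
          rcases hu with hu | ⟨g', h3, h4, rfl⟩
          · obtain ⟨-, ε, h5, h6, h7⟩ := hw
            exact .inl ⟨.inl hu, ε, h5, by rwa [hdone u hu], h7⟩
          · rcases (Nat.lt_succ_iff.mp h4).eq_or_lt with rfl | h4
            · obtain ⟨-, ε, h5, h6, h7⟩ := hw
              exact .inl ⟨.inr rfl, ε, h5, by rwa [hroot], h7⟩
            · exact .inr ⟨g', h3, h4, rfl, hw⟩
        refine ⟨hd.seen u w hs, fun hm => ?_⟩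
        rw [hM' _ (by omega) _ (hc.mP_sub_lt w)]
        exact h.row u w hs hm
    · exact (h.rows h' h1 (by omega)).congr (fun j hj => hM' h' (by omega) j hj) hc
  · obtain ⟨h1, h2⟩ := h.fence A σ hA
    refine ⟨fun h' h3 h4 h5 j hj => ?_, fun h3 => h2 (by rw [Dfs.advance_g] at h3; omega)⟩
    rw [Dfs.advance_g] at h4
    by_cases e : h' = d.g + 2
    · subst e
      rw [hM j hj]
      exact h1 _ (by have := hd.g_ge; omega) le_rfl (by omega) j hj
    · rw [hM' h' e j hj]
      exact h1 h' h3 (by omega) h5 j hj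

end RowInv

theorem DfsInv.bid_ne_zero (hd : DfsInv c i d) : d.bid ≠ 0 := by
  have := hd.base_pos
  have := hd.base_le
  omega

namespace AttInv

/-- Processing an entry that is not an attachment of the current bridge. -/
theorem next (hc : c.Marked) (hi : i < c.k) (hd : DfsInv c i d) (h : AttInv c i E d r)
    (hw : c.mP (c.adat (d.ptr (d.stack d.top))) = 0 ∨ d.top = 0) : AttInv c i E d.next r := by
  refine ⟨h.old, h.past, h.idle, fun hb u w hu hs hm => ?_, h.att_src, h.att_card, h.fresh,
    h.cand_lt, h.cand_ok, h.bridge, h.found, ?_⟩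
  · rcases (hd.scanned_next hc hi).mp hs with hs | ⟨rfl, rfl⟩
    · exact h.att_eq hb u w hu hs hm
    · rcases hw with hw | hw
      · exact absurd hw hm
      · have := hd.bid_ne_zero
        rcases hd.top_cases hc hi with ⟨-, -, h2⟩ | ⟨h0, -, -⟩
        · simp only [Dfs.next_stamp, Dfs.next_bid] at hu
          omega
        · exact absurd hw h0
  · have := h.cand_le
    rw [Dfs.next_fuel]
    omega

theorem att_eq_zero (h : AttInv c i E d r) (hcnt : r.cnt = 0) :
    ∀ j < c.k, r.att (d.bid * c.k + j) = 0 := by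
  intro j hj
  have := h.att_card
  rw [hcnt] at this
  by_contra h0
  exact notMem_empty j (card_eq_zero.mp this.symm ▸ mem_filter.mpr ⟨mem_range.mpr hj, h0⟩)

theorem push (hc : c.Marked) (hi : i < c.k) (hd : DfsInv c i d) (h : AttInv c i E d r)
    (hp : d.ptr (d.stack d.top) < c.aoff (d.stack d.top + 1)) {v : ℕ}
    (hv : v = c.adat (d.ptr (d.stack d.top))) (hv0 : c.mP v = 0) (hvs : d.stamp v < d.base) :
    AttInv c i E (d.next.push c v) r := by
  have hb := hd.base_le
  have stamp_eq : ∀ w, (d.next.push c v).stamp w = if w = v then d.bid else d.stamp w := fun w => by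
    simp [Dfs.push, Dfs.next, Function.update_apply]
  have hn := hd.nb_next hc hi hp
  rw [← hv] at hn
  refine ⟨h.old, fun g' h1 h2 w hw hm => ?_, fun ht => ?_, fun hb' u w hu hs hm => ?_, h.att_src,
    h.att_card, h.fresh, h.cand_lt, h.cand_ok, fun Q σ hQ hex => ?_, fun Q σ hQ hex => ?_, ?_⟩
  · have hwv : w ≠ v := by
      rintro rfl
      have := hd.seen _ w (.inr ⟨g', h1, h2, rfl, hw⟩) hm
      omega
    rw [stamp_eq, if_neg hwv]
    exact h.past g' h1 h2 w hw hm
  · simp at ht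
  · rcases (hd.scanned_push hc hi hv0 hvs).mp hs with hs' | ⟨-, rfl⟩
    · rw [stamp_eq] at hu
      split_ifs at hu with e
      · subst e
        rcases hs' with ⟨h1 | h1, -⟩ | ⟨g', h1, h2, rfl, -⟩
        · exact absurd h1 (not_le.mpr hvs)
        · exact absurd (h1 ▸ hv0) (hd.root_marked hc hi)
        · exact absurd hv0 (hc.mP_pdat hi h1 (h2.trans hd.g_lt))
      · exact h.att_eq hb' u w hu hs' hm
    · exact absurd (hv ▸ hv0) hm
  · simp only [stamp_eq, Dfs.push_bid, Dfs.next_bid] at hex ⊢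
    rcases hd.top_cases hc hi with ⟨h0, -, -⟩ | ⟨h0, h1, h2⟩
    · obtain ⟨h3, h4, h5⟩ := h.idle h0
      refine ⟨fun u hu => ?_, h4, fun j hj => .inl (h.att_eq_zero h3 j hj)⟩
      split_ifs at hu with e
      · obtain ⟨u', hu', hs⟩ := hex
        split_ifs at hs with e'
        · exact e.trans e'.symm ▸ hu'
        · exact absurd hs (h5 u')
      · exact absurd hu (h5 u)
    · have hold : ∃ u ∈ Q, d.stamp u = d.bid := by
        obtain ⟨u', hu', hs⟩ := hex
        split_ifs at hs with e'
        · subst e'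
          exact ⟨_, (hQ.nb u' hu' _ (hc.nb_symm _ _ hn)).1 h2, h1⟩
        · exact ⟨u', hu', hs⟩
      obtain ⟨h3, h4, h5⟩ := h.bridge Q σ hQ hold
      refine ⟨fun u hu => ?_, h4, h5⟩
      split_ifs at hu with e
      · exact e ▸ (hQ.nb _ (h3 _ h1) v hn).1 hv0
      · exact h3 u hu
  · simp only [stamp_eq, Dfs.push_bid, Dfs.next_bid, Dfs.push_base, Dfs.next_base] at hex
    obtain ⟨u, hu, hs⟩ := hex
    split_ifs at hs with e
    · omega
    · exact h.found Q σ hQ ⟨u, hu, hs⟩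
  · have := h.cand_le
    rw [Dfs.push_fuel, Dfs.next_fuel]
    omega

section attach

variable (hc : c.Marked) (hi : i < c.k) (hd : DfsInv c i d) (h : AttInv c i E d r)
  (hp : d.ptr (d.stack d.top) < c.aoff (d.stack d.top + 1)) (ht : d.top ≠ 0) {w : ℕ}
  (hw : w = c.adat (d.ptr (d.stack d.top))) (hm : c.mP w ≠ 0)
  {z : ℕ} (hz : z = d.bid * c.k + (c.mP w - 1))
include hc hi hd h hp ht hw hm hz

/-- The new attachment `w` of the current bridge is compatible with the attachments of a bridge
that meets the current one. -/
theorem attach_bridge {Q : Set ℕ} {σ : ℕ → ℕ} (hQ : c.Bridge Q σ)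
    (hex : ∃ u ∈ Q, d.stamp u = d.bid) :
    c.mG w ≠ 0 ∧ σ (c.mP w - 1) = c.mG w ∧ (r.att z = 0 ∨ r.att z = c.mG w) := by
  have hn := hd.nb_next hc hi hp
  rw [← hw] at hn
  obtain ⟨h3, h4, h5⟩ := h.bridge Q σ hQ hex
  rcases hd.top_cases hc hi with ⟨h0, -, -⟩ | ⟨-, h1, -⟩
  · exact absurd h0 ht
  · obtain ⟨h6, h7⟩ := (hQ.nb _ (h3 _ h1) w hn).2 hm
    refine ⟨h6, h7, ?_⟩
    rw [hz, ← h7]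
    exact h5 _ (hc.mP_sub_lt w)

/-- The current bridge turns out to be unsuitable. -/
theorem attach_bad (hbad : c.mG w = 0 ∨ (r.att z ≠ 0 ∧ r.att z ≠ c.mG w)) :
    AttInv c i E d.next { r with bad := 1 } := by
  refine ⟨h.old, h.past, fun h0 => absurd h0 ht, fun hb => absurd hb one_ne_zero, h.att_src,
    h.att_card, h.fresh, h.cand_lt, h.cand_ok, fun Q σ hQ hex => ?_, h.found, ?_⟩
  · obtain ⟨h1, -, h2⟩ := attach_bridge hc hi hd h hp ht hw hm hz hQ hex
    tauto
  · have := h.cand_le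
    rw [Dfs.next_fuel]
    change c.k * r.ncand + r.cnt + _ ≤ _
    omega

omit hp hm in
/-- The attachment is known. -/
theorem attach_old (hw0 : c.mG w ≠ 0) (hz0 : r.att z = c.mG w) : AttInv c i E d.next r := by
  refine ⟨h.old, h.past, fun h0 => absurd h0 ht, fun hb u w' hu hs hm' => ?_, h.att_src,
    h.att_card, h.fresh, h.cand_lt, h.cand_ok, h.bridge, h.found, ?_⟩
  · rcases (hd.scanned_next hc hi).mp hs with hs | ⟨rfl, rfl⟩
    · exact h.att_eq hb u w' hu hs hm'
    · rw [← hw]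
      exact ⟨hw0, hz ▸ hz0⟩
  · have := h.cand_le
    rw [Dfs.next_fuel]
    omega

/-- A first attachment to a path. -/
theorem attach_new (hf : d.fuel ≠ 0) (hw0 : c.mG w ≠ 0) (hz0 : r.att z = 0) :
    AttInv c i E d.next { r with att := Function.update r.att z (c.mG w), cnt := r.cnt + 1 } := by
  subst hz
  have hk := hc.mP_sub_lt
  have hupd : ∀ b, ∀ j < c.k, Function.update r.att (d.bid * c.k + (c.mP w - 1)) (c.mG w)
      (b * c.k + j) = if b = d.bid ∧ j = c.mP w - 1 then c.mG w else r.att (b * c.k + j) :=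
    fun b j hj => update_row (hk w) hj
  have hold : ∀ b, b < d.bid → ∀ j < c.k,
      Function.update r.att (d.bid * c.k + (c.mP w - 1)) (c.mG w) (b * c.k + j) =
        r.att (b * c.k + j) := fun b hb j hj => by
    rw [hupd b j hj, if_neg (by omega)]
  have hkeep : ∀ σ, Emitted c r σ → Emitted c { r with
      att := Function.update r.att (d.bid * c.k + (c.mP w - 1)) (c.mG w), cnt := r.cnt + 1 } σ := by
    rintro σ ⟨t, ht', h1⟩
    refine ⟨t, ht', fun j hj => ?_⟩
    simp only
    rw [hold _ (h.cand_lt t ht') _ hj]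
    exact h1 j hj
  refine ⟨fun σ hσ => hkeep σ (h.old σ hσ), h.past, fun h0 => absurd h0 ht,
    fun hb u w' hu hs hm' => ?_, fun j hj hj0 => ?_, ?_, fun b hb j hj => ?_, h.cand_lt,
    fun t ht' => ?_, fun Q σ hQ hex => ?_, fun Q σ hQ hex => hkeep σ (h.found Q σ hQ hex), ?_⟩
  · simp only [Dfs.next_bid]
    rw [hupd _ _ (hk w')]
    rcases (hd.scanned_next hc hi).mp hs with hs | ⟨rfl, rfl⟩
    · obtain ⟨h1, h2⟩ := h.att_eq hb u w' hu hs hm'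
      refine ⟨h1, ?_⟩
      rw [if_neg]
      · exact h2
      · rintro ⟨-, e⟩
        rw [e] at h2
        exact h1 (h2.symm.trans hz0)
    · rw [← hw, if_pos ⟨rfl, rfl⟩]
      exact ⟨hw0, rfl⟩
  · simp only [Dfs.next_bid] at hj0 ⊢
    rw [hupd _ _ hj] at hj0 ⊢
    split_ifs at hj0 ⊢ with e
    · exact ⟨w, by omega, rfl⟩
    · exact h.att_src j hj hj0
  · suffices r.cnt + 1 = {j ∈ range c.k | Function.update r.att
        (d.bid * c.k + (c.mP w - 1)) (c.mG w) (d.bid * c.k + j) ≠ 0}.card from this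
    have hnot : c.mP w - 1 ∉ {j ∈ range c.k | r.att (d.bid * c.k + j) ≠ 0} := fun hmem =>
      (mem_filter.mp hmem).2 hz0
    rw [h.att_card, ← card_insert_of_notMem hnot]
    refine congrArg card (ext fun j => ?_)
    simp only [mem_insert, mem_filter, mem_range]
    constructor
    · rintro (rfl | ⟨h1, h2⟩)
      · exact ⟨hk w, by rw [hupd _ _ (hk w), if_pos ⟨rfl, rfl⟩]; exact hw0⟩
      · refine ⟨h1, ?_⟩
        rw [hupd _ _ h1]
        split_ifs
        exacts [hw0, h2]
    · rintro ⟨h1, h2⟩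
      rw [hupd _ _ h1] at h2
      split_ifs at h2 with e
      · exact .inl e.2
      · exact .inr ⟨h1, h2⟩
  · simp only [Dfs.next_bid] at hb
    refine (hupd _ _ hj).trans ?_
    rw [if_neg (by omega)]
    exact h.fresh b hb j hj
  · obtain ⟨Q, h1, h2, h3⟩ := h.cand_ok t ht'
    have hlt := h.cand_lt t ht'
    refine ⟨Q, h1, fun u hu => ⟨(h2 u hu).1, (h2 u hu).2.1, fun w' hw' => ?_⟩, fun j hj => ?_⟩
    · simp only
      rw [hold _ hlt _ (hk w')]
      exact (h2 u hu).2.2 w' hw'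
    · simp only
      rw [hold _ hlt _ hj]
      exact h3 j hj
  · obtain ⟨h1, h2, h3⟩ := attach_bridge hc hi hd h hp ht hw hm rfl hQ hex
    obtain ⟨h4, h5, h6⟩ := h.bridge Q σ hQ hex
    refine ⟨h4, h5, fun j hj => ?_⟩
    simp only [Dfs.next_bid]
    rw [hupd _ _ hj]
    split_ifs with e
    · rw [e.2, h2]
      exact .inr rfl
    · exact h6 j hj
  · have := h.cand_le
    rw [Dfs.next_fuel]
    change c.k * r.ncand + (r.cnt + 1) + _ ≤ _
    omega

end attach

theorem pop (h : AttInv c i E d r) (ht : d.top ≠ 0) (ht' : d.top ≠ 1) : AttInv c i E d.pop r := by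
  have hbid : d.pop.bid = d.bid := by simp [Dfs.pop, ht']
  refine ⟨h.old, ?_, fun h0 => ?_, ?_, ?_, ?_, ?_, ?_, h.cand_ok, ?_, ?_, ?_⟩
  · rw [hbid]; exact h.past
  · rw [Dfs.pop_top] at h0
    omega
  · rw [hbid]; exact h.att_eq
  · rw [hbid]; exact h.att_src
  · rw [hbid]; exact h.att_card
  · rw [hbid]; exact h.fresh
  · rw [hbid]; exact h.cand_lt
  · rw [hbid]; exact h.bridge
  · rw [hbid]; exact h.found
  · have := h.cand_le
    rw [Dfs.pop_fuel]
    omega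

theorem advance (hc : c.Marked) (hi : i < c.k) (hd : DfsInv c i d) (h : AttInv c i E d r)
    (hp : ¬ d.ptr (d.stack d.top) < c.aoff (d.stack d.top + 1)) (ht : d.top = 0)
    (hg : d.g + 1 < c.poff (i + 1)) : AttInv c i E (d.advance c) r := by
  have hsc := fun u w => hd.scanned_advance hc hi hp ht hg (u := u) (w := w)
  refine ⟨h.old, fun g' _ _ w _ _ => ?_, h.idle,
    fun hb u w hu hs => h.att_eq hb u w hu ((hsc u w).mp hs), h.att_src, h.att_card, h.fresh,
    h.cand_lt, h.cand_ok, h.bridge, h.found, ?_⟩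
  · exact lt_of_le_of_ne (hd.stamp_le w) ((h.idle ht).2.2 w)
  have := h.cand_le
  rw [Dfs.advance_fuel]
  omega

section finish

variable (hd : DfsInv c i d) (h : AttInv c i E d r)
  (hp : ¬ d.ptr (d.stack d.top) < c.aoff (d.stack d.top + 1)) (ht : d.top = 1)
include hd h hp ht

omit h in
/-- At its end, all vertices of the current bridge have been processed. -/
theorem scanned_of_nb {u w : ℕ} (hu : d.stamp u = d.bid) (hn : c.Nb u w) : Scanned c i d u w := by
  have hb : d.base ≤ d.stamp u := hu ▸ hd.base_le
  have hptr : d.ptr u = c.aoff (u + 1) := by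
    by_cases e : d.stack d.top = u
    · subst e
      exact le_antisymm (hd.ptr_mem _ (.inl hb)).2 (not_lt.mp hp)
    · refine hd.done u hb fun t ht0 ht' => ?_
      obtain rfl : t = d.top := by omega
      exact e
  obtain ⟨-, ε, h1, h2, h3⟩ := hn
  exact .inl ⟨.inl hb, ε, h1, by rwa [hptr], h3⟩

/-- At its end, a bridge as in `Input.Bridge` has been recognized as suitable, and the recorded
attachments are correct. -/
theorem finish_bridge {Q : Set ℕ} {σ : ℕ → ℕ} (hQ : c.Bridge Q σ)
    (hex : ∃ u ∈ Q, d.stamp u = d.bid) :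
    r.cnt = c.k ∧ r.bad = 0 ∧ ∀ j < c.k, r.att (d.bid * c.k + j) = σ j := by
  obtain ⟨h1, h2, h3⟩ := h.bridge Q σ hQ hex
  obtain ⟨u₀, hu₀, hs₀⟩ := hex
  have hsub : Q ⊆ {u | d.stamp u = d.bid} := by
    refine hQ.conn _ (fun u hu w hw hm => ?_) u₀ hu₀ hs₀
    have hu' : d.stamp u = d.bid := hu
    exact (hd.same u w (hu' ▸ hd.base_le) (scanned_of_nb hd hp ht hu hw) hm).trans hu
  have hne : ∀ j < c.k, r.att (d.bid * c.k + j) ≠ 0 := by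
    intro j hj
    obtain ⟨u, hu, w, hw, hm⟩ := hQ.all j hj
    obtain ⟨h4, h5⟩ := h.att_eq h2 u w (hsub hu) (scanned_of_nb hd hp ht (hsub hu) hw) (by omega)
    rw [hm, Nat.add_sub_cancel] at h5
    rwa [h5]
  refine ⟨?_, h2, fun j hj => (h3 j hj).resolve_left (hne j hj)⟩
  rw [h.att_card, filter_true_of_mem fun j hj => hne j (mem_range.mp hj), card_range]

/-- The end of a bridge; it is recorded if it is suitable. -/
theorem finish {n' : ℕ} {cand' : ℕ → ℕ}
    (hr : (r.cnt = c.k ∧ r.bad = 0 ∧ n' = r.ncand + 1 ∧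
      cand' = Function.update r.cand r.ncand d.bid) ∨
      (¬ (r.cnt = c.k ∧ r.bad = 0) ∧ n' = r.ncand ∧ cand' = r.cand)) :
    AttInv c i E d.pop { r with cnt := 0, bad := 0, ncand := n', cand := cand' } := by
  have hbid : d.pop.bid = d.bid + 1 := by simp [Dfs.pop, ht]
  have hcand : ∀ t < r.ncand, t < n' ∧ cand' t = r.cand t := by
    intro t ht'
    rcases hr with ⟨-, -, rfl, rfl⟩ | ⟨-, rfl, rfl⟩
    · exact ⟨by omega, Function.update_of_ne (by omega) _ _⟩
    · exact ⟨ht', rfl⟩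
  have hcases : ∀ t < n', (t < r.ncand ∧ cand' t = r.cand t) ∨
      (cand' t = d.bid ∧ r.cnt = c.k ∧ r.bad = 0) := by
    intro t ht'
    by_cases h0 : t < r.ncand
    · exact .inl ⟨h0, (hcand t h0).2⟩
    · rcases hr with ⟨h1, h2, rfl, rfl⟩ | ⟨-, rfl, rfl⟩
      · obtain rfl : t = r.ncand := by omega
        exact .inr ⟨Function.update_self .., h1, h2⟩
      · exact absurd ht' h0
  have hfresh : ∀ j < c.k, r.att ((d.bid + 1) * c.k + j) = 0 := h.fresh _ (Nat.lt_succ_self _)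
  have hstamp := hd.stamp_le
  have hkeep : ∀ σ, Emitted c r σ →
      Emitted c { r with cnt := 0, bad := 0, ncand := n', cand := cand' } σ := by
    rintro σ ⟨t, ht', h1⟩
    refine ⟨t, (hcand t ht').1, fun j hj => ?_⟩
    simp only [(hcand t ht').2]
    exact h1 j hj
  refine ⟨fun σ hσ => hkeep σ (h.old σ hσ), fun g' h1 h2 w hw hm => ?_,
    fun _ => ⟨rfl, rfl, fun w => ?_⟩, fun _ u w hu => ?_, fun j hj hj0 => ?_, ?_,
    fun b hb => h.fresh b ?_, fun t ht' => ?_, fun t ht' => ?_, fun Q σ hQ hex => ?_,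
    fun Q σ hQ hex => ?_, ?_⟩
  · rw [hbid]
    exact Nat.lt_succ_of_lt (h.past g' h1 h2 w hw hm)
  · have := hstamp w
    rw [hbid, Dfs.pop_stamp]
    omega
  · have := hstamp u
    rw [hbid, Dfs.pop_stamp] at hu
    omega
  · rw [hbid] at hj0
    exact absurd (hfresh j hj) hj0
  · rw [hbid]
    refine (card_eq_zero.mpr (filter_eq_empty_iff.mpr fun j hj => ?_)).symm
    exact not_not.mpr (hfresh j (mem_range.mp hj))
  · rw [hbid] at hb
    omega
  · rw [hbid]
    rcases hcases t ht' with ⟨h0, h1⟩ | ⟨h1, -⟩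
    · have := h.cand_lt t h0
      simp only [h1]
      omega
    · simp [h1]
  · rcases hcases t ht' with ⟨h0, h1⟩ | ⟨h1, h2, h3⟩
    · simp only [h1]
      exact h.cand_ok t h0
    · simp only [h1]
      refine ⟨{u | d.stamp u = d.bid}, ⟨d.stack 1, hd.stack_stamp 1 one_ne_zero ht.ge⟩,
        fun u hu => ?_, fun j hj => ?_⟩
      · have hu' : d.stamp u = d.bid := hu
        have h4 := hd.stamp_unmarked u (hu'.trans_ne hd.bid_ne_zero)
        refine ⟨h4.1, h4.2, fun w hw => ⟨fun hm => ?_, fun hm => ?_⟩⟩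
        · exact (hd.same u w (hu' ▸ hd.base_le) (scanned_of_nb hd hp ht hu hw) hm).trans hu
        · exact h.att_eq h3 u w hu (scanned_of_nb hd hp ht hu hw) hm
      · have h5 : r.att (d.bid * c.k + j) ≠ 0 := by
          have h6 := h.att_card
          rw [h2] at h6
          have h7 : {j ∈ range c.k | r.att (d.bid * c.k + j) ≠ 0} = range c.k :=
            eq_of_subset_of_card_le (filter_subset _ _) (by rw [card_range, ← h6])
          exact (mem_filter.mp (h7.ge (mem_range.mpr hj))).2
        exact ⟨h5, h.att_src j hj h5⟩
  · obtain ⟨u, -, hu⟩ := hex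
    have := hstamp u
    rw [hbid, Dfs.pop_stamp] at hu
    omega
  · obtain ⟨u, huQ, hu1, hu2⟩ := hex
    rw [hbid, Dfs.pop_stamp] at hu2
    rw [Dfs.pop_base, Dfs.pop_stamp] at hu1
    rcases (Nat.lt_succ_iff.mp hu2).eq_or_lt with h0 | h0
    · obtain ⟨h1, h2, h3⟩ := finish_bridge hd h hp ht hQ ⟨u, huQ, h0⟩
      rcases hr with ⟨-, -, rfl, rfl⟩ | ⟨h4, -⟩
      · refine ⟨r.ncand, Nat.lt_succ_self _, fun j hj => ?_⟩
        simp only [Function.update_self]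
        exact h3 j hj
      · exact absurd ⟨h1, h2⟩ h4
    · exact hkeep σ (h.found Q σ hQ ⟨u, huQ, hu1, h0⟩)
  · have := h.cand_le
    rw [Dfs.pop_fuel]
    rcases hr with ⟨h1, -, rfl, -⟩ | ⟨-, rfl, -⟩
    · simp only [mul_add, mul_one]
      omega
    · simp only
      omega

end finish

end AttInv

end

end Shredder

/-! ### The exploration as a program -/

/-!
The use of memory, apart from the input in the registers `0` to `4` and the arrays `0` to `3`, and
from the output in the registers `5` and `6` and the arrays `4` to `6`:

* register `7` is set if the paths are found unsuitable, `8` holds the number of the current path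
  (or candidate), `9` a position on it, `10` the number of all positions on the paths, `13` the
  first stamp of the current path, `14` the height of the stack, `16` the number of the current
  bridge, `17` the number of its attachments, `18` whether it is unsuitable, `19` what is left of
  the budget, `20` the number of candidates; `11`, `12`, `15`, `21`, `22` are temporary;
* the arrays `7` and `8` hold the marks `mP` and `mG`, `9` the stamps, `10` the stack, `11` the
  table of farthest attachments, `12` the attachments of the bridges, `13` the candidates, `14` the
  positions where the explorations end, `15` the pointers into the adjacency lists.

The check of the candidates uses registers `11` to `16` anew. -/

namespace WordRAM

namespace Expr

abbrev add (e f : Expr) : Expr := .bin .add e f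
abbrev sub (e f : Expr) : Expr := .bin .sub e f
abbrev mul (e f : Expr) : Expr := .bin .mul e f
abbrev lt (e f : Expr) : Expr := .bin .lt e f
abbrev eq (e f : Expr) : Expr := .bin .eq e f

end Expr

infixr:67 " ;; " => Prog.seq

end WordRAM

namespace Shredder

open WordRAM Expr Prog

/-- Copy row `reg 9` of the table in array `11` to the next row. -/
def copyLoop : Prog :=
  loop ((reg 22).lt (reg 1))
    (store 11 ((((reg 9).add (const 1)).mul (reg 1)).add (reg 22))
        (cell 11 (((reg 9).mul (reg 1)).add (reg 22))) ;;
      assign 22 ((reg 22).add (const 1)))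

/-- Enter the position of the marked vertex `reg 15` in the row under construction, whose entry
`a` becomes the maximum `a + (b - a)` of `a` and the position `b`. -/
def reachProg : Prog :=
  assign 21 ((((reg 9).add (const 1)).mul (reg 1)).add ((cell 7 (reg 15)).sub (const 1))) ;;
  store 11 (reg 21) ((cell 11 (reg 21)).add ((cell 8 (reg 15)).sub (cell 11 (reg 21))))

/-- Record the marked vertex `reg 15` as an attachment of the current bridge, which is unsuitable if
it is attached to `x`, at position `0`, or to two positions of one path. -/
def attachProg : Prog :=
  assign 21 (((reg 16).mul (reg 1)).add ((cell 7 (reg 15)).sub (const 1))) ;;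
  ite (cell 8 (reg 15))
    (ite (cell 12 (reg 21))
      (ite ((cell 12 (reg 21)).eq (cell 8 (reg 15))) skip (assign 18 (const 1)))
      (store 12 (reg 21) (cell 8 (reg 15)) ;; assign 17 ((reg 17).add (const 1))))
    (assign 18 (const 1))

/-- Put the vertex `reg 15` on the stack. -/
def pushProg : Prog :=
  assign 14 ((reg 14).add (const 1)) ;;
  store 10 (reg 14) (reg 15) ;;
  store 15 (reg 15) (cell 0 (reg 15)) ;;
  store 9 (reg 15) (reg 16)

/-- Finish the current bridge and record it if it is suitable, that is, attached to one position of
each path. -/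
def finishProg : Prog :=
  ite ((reg 17).eq (reg 1))
    (ite (reg 18) skip (store 13 (reg 20) (reg 16) ;; assign 20 ((reg 20).add (const 1)))) skip ;;
  assign 16 ((reg 16).add (const 1)) ;;
  assign 17 (const 0) ;;
  assign 18 (const 0)

/-- Remove the top of the stack. -/
def popProg : Prog :=
  assign 14 ((reg 14).sub (const 1)) ;; ite (reg 14) skip finishProg

/-- Move on along the path. -/
def advanceProg : Prog :=
  assign 9 ((reg 9).add (const 1)) ;;
  store 10 (const 0) (cell 3 (reg 9)) ;;
  store 15 (cell 3 (reg 9)) (cell 0 (cell 3 (reg 9))) ;;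
  assign 22 (const 0) ;;
  copyLoop

/-- Process the next adjacency-list entry of the top of the stack or, if there is none, remove the
top of the stack or move on along the path. -/
def exploreStep : Prog :=
  assign 19 ((reg 19).sub (const 1)) ;;
  assign 11 (cell 10 (reg 14)) ;;
  assign 12 (cell 15 (reg 11)) ;;
  ite ((reg 12).lt (cell 0 ((reg 11).add (const 1))))
    (assign 15 (cell 1 (reg 12)) ;;
      store 15 (reg 11) ((reg 12).add (const 1)) ;;
      ite (cell 7 (reg 15))
        (reachProg ;; ite (reg 14) attachProg skip)
        (ite ((cell 9 (reg 15)).lt (reg 13)) pushProg skip))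
    (ite (reg 14) popProg advanceProg)

/-- The search state held by registers and arrays. -/
def dfsOf (s : State) : Dfs where
  g := s.reg 9
  top := s.reg 14
  bid := s.reg 16
  base := s.reg 13
  fuel := s.reg 19
  stack := s.arr 10
  ptr := s.arr 15
  stamp := s.arr 9

/-- The records held by registers and arrays. -/
def recOf (s : State) : Rec where
  cnt := s.reg 17
  bad := s.reg 18
  ncand := s.reg 20
  att := s.arr 12
  cand := s.arr 13

/-- The state `s` holds the data `c`. -/
structure Holds (c : Input) (s : State) : Prop where
  k_eq : s.reg 1 = c.k
  F_eq : 4 * s.reg 3 + 1 = c.F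
  aoff : s.arr 0 = c.aoff
  adat : s.arr 1 = c.adat
  poff : s.arr 2 = c.poff
  pdat : s.arr 3 = c.pdat
  mP : s.arr 7 = c.mP
  mG : s.arr 8 = c.mG

/-- The invariant of the exploration of path `i`. -/
structure ExploreInv (c : Input) (i : ℕ) (M₀ : ℕ → ℕ) (E : (ℕ → ℕ) → Prop) (s : State) : Prop where
  holds : Holds c s
  path : s.reg 8 = i
  dfs : DfsInv c i (dfsOf s)
  row : RowInv c i M₀ (dfsOf s) (s.arr 11)
  att : AttInv c i E (dfsOf s) (recOf s)

/-- All counters and table indices are at most `N`. -/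
structure Input.Small (c : Input) (N : ℕ) : Prop where
  two_le : 2 ≤ N
  bridge : (c.k * (c.F + 1) + 1) * c.k ≤ N
  row : (c.tot + 1) * c.k ≤ N

theorem Holds.of_eq {c : Input} {s s' : State} (h : Holds c s)
    (hr : ∀ r ∈ [1, 3], s'.reg r = s.reg r) (ha : ∀ a ∈ [0, 1, 2, 3, 7, 8], s'.arr a = s.arr a) :
    Holds c s' where
  k_eq := (hr 1 (by decide)).trans h.k_eq
  F_eq := hr 3 (by decide) ▸ h.F_eq
  aoff := (ha 0 (by decide)).trans h.aoff
  adat := (ha 1 (by decide)).trans h.adat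
  poff := (ha 2 (by decide)).trans h.poff
  pdat := (ha 3 (by decide)).trans h.pdat
  mP := (ha 7 (by decide)).trans h.mP
  mG := (ha 8 (by decide)).trans h.mG

theorem copyLoop_spec {N k g : ℕ} {s : State} (hN : 2 ≤ N) (hs : s.Bdd N) (hk : s.reg 1 = k)
    (hg : s.reg 9 = g) (hj : s.reg 22 = 0) :
    Tri 10 N copyLoop (k * 22 + 4) s fun s' =>
      (∀ j < k, s'.arr 11 ((g + 1) * k + j) = s.arr 11 (g * k + j)) ∧
      (∀ h, h ≠ g + 1 → ∀ j < k, s'.arr 11 (h * k + j) = s.arr 11 (h * k + j)) ∧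
      (∀ r, r ∉ [22] → s'.reg r = s.reg r) ∧ ∀ a, a ∉ [11] → s'.arr a = s.arr a := by
  have key : Tri 10 N copyLoop (k * (18 + 3 + 1) + (3 + 1)) s fun s' =>
      (∀ j < k, s'.arr 11 ((g + 1) * k + j) = s.arr 11 (g * k + j)) ∧
      (∀ h, h ≠ g + 1 → ∀ j < k, s'.arr 11 (h * k + j) = s.arr 11 (h * k + j)) := by
    refine Tri.loop (D := 10) (N := N) (T := 18) (e := (reg 22).lt (reg 1)) hN (by decide)
      (fun m s' => s'.reg 1 = k ∧ s'.reg 9 = g ∧ s'.reg 22 + m = k ∧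
        (∀ j < k, s'.arr 11 ((g + 1) * k + j) =
          if j < s'.reg 22 then s.arr 11 (g * k + j) else s.arr 11 ((g + 1) * k + j)) ∧
        ∀ h, h ≠ g + 1 → ∀ j < k, s'.arr 11 (h * k + j) = s.arr 11 (h * k + j))
      (fun m s' hb h he => ?_) (fun m s' hb h he => ?_) k s hs ⟨hk, hg, by omega, ?_, ?_⟩
    · obtain ⟨h1, h2, h3, h4, h5⟩ := h
      have hlt : s'.reg 22 < k := by simpa [Expr.eval, Op.eval, h1] using he
      have hkN : k ≤ N := h1 ▸ hb.1 1
      obtain ⟨m, rfl⟩ : ∃ m', m = m' + 1 := ⟨m - 1, by omega⟩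
      refine ⟨m, rfl, (Tri.of_wp hN (τ := 0) (by decide) hb ?_).mono (by decide)
        fun _ _ h => h⟩
      refine ⟨hb.2 _ _, ?_, ?_⟩
      · simp only [Expr.eval, Op.eval, State.reg_setCell]
        omega
      · simp only [Expr.eval, Op.eval, h1, h2, State.reg_setReg, State.arr_setReg,
          State.reg_setCell, State.arr_setCell, if_true]
        refine ⟨rfl, rfl, by omega, fun j hj => ?_, fun h hh j hj => ?_⟩
        · rw [update_row hlt hj, h5 g (by omega) _ hlt, h4 j hj]
          simp only [true_and]
          split_ifs <;> first | rfl | omega | (congr 2; omega)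
        · rw [update_row hlt hj, if_neg (by omega)]
          exact h5 h hh j hj
    · obtain ⟨h1, h2, h3, h4, h5⟩ := h
      have hlt : ¬ s'.reg 22 < k := by simpa [Expr.eval, Op.eval, h1] using he
      refine ⟨fun j hj => ?_, h5⟩
      rw [h4 j hj, if_pos (by omega)]
    · intro j hj'
      rw [hj, if_neg (by omega)]
    · exact fun h _ j _ => rfl
  refine key.frame.mono (by omega) fun s' _ h => ⟨h.1.1, h.1.2, h.2.1, h.2.2⟩

section

variable {c : Input} {i : ℕ} {M₀ : ℕ → ℕ} {E : (ℕ → ℕ) → Prop}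

theorem ExploreInv.of_eq {s s' : State} {d : Dfs} {r : Rec} {M : ℕ → ℕ}
    (hh : Holds c s) (hpath : s.reg 8 = i) (hreg : ∀ r ∈ [1, 3, 8], s'.reg r = s.reg r)
    (harr : ∀ a ∈ [0, 1, 2, 3, 7, 8], s'.arr a = s.arr a) (ed : dfsOf s' = d)
    (er : recOf s' = r) (eM : s'.arr 11 = M) (hd : DfsInv c i d) (hr : RowInv c i M₀ d M)
    (ha : AttInv c i E d r) : ExploreInv c i M₀ E s' := by
  refine ⟨hh.of_eq (fun r hr => hreg r ?_) harr, (hreg 8 (by decide)).trans hpath, ed ▸ hd, ?_, ?_⟩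
  · simp only [List.mem_cons, List.not_mem_nil, or_false] at hr ⊢
    omega
  · rw [ed, eM]; exact hr
  · rw [ed, er]; exact ha

/-- In the exploration, all values that are stored are small. -/
theorem ExploreInv.bounds {N : ℕ} (hc : c.Marked) (hi : i < c.k) (hN : c.Small N)
    {s : State} (h : ExploreInv c i M₀ E s) :
    s.reg 14 + 1 ≤ N ∧ s.reg 16 + 1 ≤ N ∧ s.reg 17 + 1 ≤ N ∧ s.reg 20 + 1 ≤ N ∧ s.reg 9 + 1 ≤ N ∧
      (∀ j < c.k, (s.reg 9 + 1) * c.k + j ≤ N) ∧ ∀ j < c.k, s.reg 16 * c.k + j ≤ N := by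
  obtain ⟨-, -, hd, -, ha⟩ := h
  have hk := hc.k_pos
  have h1 : s.reg 14 + s.reg 19 ≤ c.F := hd.top_le
  have h2 : s.reg 16 + s.reg 19 ≤ (i + 1) * (c.F + 1) := hd.bid_le
  have h3 : c.k * s.reg 20 + s.reg 17 + s.reg 19 ≤ (i + 1) * c.F := ha.cand_le
  have h4 : s.reg 9 < c.tot := hd.g_lt.trans_le (hc.poff_succ_le hi)
  have h5 : (i + 1) * (c.F + 1) ≤ c.k * (c.F + 1) := Nat.mul_le_mul_right _ hi
  have h6 : (i + 1) * c.F ≤ (i + 1) * (c.F + 1) := Nat.mul_le_mul_left _ (Nat.le_succ _)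
  have h7 : c.k * (c.F + 1) + 1 ≤ (c.k * (c.F + 1) + 1) * c.k := Nat.le_mul_of_pos_right _ hk
  have h8 : c.F + 1 ≤ c.k * (c.F + 1) := Nat.le_mul_of_pos_left _ hk
  have h9 : s.reg 20 ≤ c.k * s.reg 20 := Nat.le_mul_of_pos_left _ hk
  have h10 : c.tot + 1 ≤ (c.tot + 1) * c.k := Nat.le_mul_of_pos_right _ hk
  have h11 := hN.bridge
  have h12 := hN.row
  refine ⟨by omega, by omega, by omega, by omega, by omega, fun j hj => ?_, fun j hj => ?_⟩
  · have : (s.reg 9 + 1 + 1) * c.k ≤ (c.tot + 1) * c.k := Nat.mul_le_mul_right _ (by omega)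
    rw [add_mul _ 1] at this
    omega
  · have : (s.reg 16 + 1) * c.k ≤ (c.k * (c.F + 1) + 1) * c.k := Nat.mul_le_mul_right _ (by omega)
    rw [add_mul _ 1] at this
    omega

theorem exploreStep_spec {N : ℕ} (hc : c.Marked) (hi : i < c.k) (hN : c.Small N)
    {s : State} (hs : s.Bdd N) (h : ExploreInv c i M₀ E s) (hf : s.reg 19 ≠ 0)
    (hg : s.reg 9 + 1 < c.poff (i + 1)) :
    Tri 10 N exploreStep (exploreStep.time (c.k * 22 + 4)) s
      fun s' => ExploreInv c i M₀ E s' ∧ s'.reg 19 = s.reg 19 - 1 := by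
  refine Tri.of_wp hN.two_le (by decide) hs ?_
  obtain ⟨b1, b2, b3, b4, b5, b6, b7⟩ := h.bounds hc hi hN
  obtain ⟨hh, hpath, hd, hr, ha⟩ := h
  have hfuel : s.reg 19 ≤ N + 1 := (hs.1 19).trans (Nat.le_succ _)
  have hone : 1 ≤ N := by have := hN.two_le; omega
  have haoff : ∀ u, c.aoff u ≤ N := fun u => hh.aoff ▸ hs.2 0 u
  have hadat : ∀ u, c.adat u ≤ N := fun u => hh.adat ▸ hs.2 1 u
  have hpdat : ∀ u, c.pdat u ≤ N := fun u => hh.pdat ▸ hs.2 3 u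
  have hmG : ∀ u, c.mG u ≤ N := fun u => hh.mG ▸ hs.2 8 u
  by_cases hp : s.arr 15 (s.arr 10 (s.reg 14)) < c.aoff (s.arr 10 (s.reg 14) + 1)
  · have hlt : s.arr 15 (s.arr 10 (s.reg 14)) < N := hp.trans_le (haoff _)
    -- the maximum of an entry `a` and `b`, which the program computes as `a + (b - a)`
    have hmax : ∀ w, s.arr 11 ((s.reg 9 + 1) * c.k + (c.mP w - 1)) +
        (c.mG w - s.arr 11 ((s.reg 9 + 1) * c.k + (c.mP w - 1))) ≤ N := fun w => by
      have := hmG w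
      have := hs.2 11 ((s.reg 9 + 1) * c.k + (c.mP w - 1))
      omega
    have hz := fun w => b6 _ (hc.mP_sub_lt w)
    have hz' := fun w => b7 _ (hc.mP_sub_lt w)
    by_cases hm : c.mP (c.adat (s.arr 15 (s.arr 10 (s.reg 14)))) = 0
    · by_cases hst : s.arr 9 (c.adat (s.arr 15 (s.arr 10 (s.reg 14)))) < s.reg 13
      · simp [exploreStep, pushProg, wp, Expr.eval, Op.eval, hh.aoff, hh.adat, hh.mP, hp, hm, hst]
        refine ⟨hfuel, hs.2 _ _, hs.2 _ _, hadat _, hlt, b1, hadat _, haoff _, hs.1 _, ?_⟩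
        exact .of_eq hh hpath (by simp) (by simp)
          (d := (dfsOf s).next.push c (c.adat (s.arr 15 (s.arr 10 (s.reg 14)))))
          (by simp [dfsOf, Dfs.next, Dfs.push]) (r := recOf s) (by simp [recOf])
          (by simp) (hd.push hc hi hf hp rfl hm hst) (hr.push hc hi hd hp rfl hm hst)
          (ha.push hc hi hd hp rfl hm hst)
      · simp [exploreStep, wp, Expr.eval, Op.eval, hh.aoff, hh.adat, hh.mP, hp, hm, hst]
        refine ⟨hfuel, hs.2 _ _, hs.2 _ _, hadat _, hlt, ?_⟩
        exact .of_eq hh hpath (by simp) (by simp) (d := (dfsOf s).next)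
          (by simp [dfsOf, Dfs.next]) (r := recOf s) (by simp [recOf])
          (by simp) (hd.next hc hi hf hp fun _ => not_lt.mp hst) (hr.next_unmarked hc hi hd hm)
          (ha.next hc hi hd (.inl hm))
    · have hd' := hd.next hc hi hf hp fun h0 => absurd h0 hm
      have hr' := hr.next_marked hc hi hd hp rfl hm rfl
      by_cases ht : s.reg 14 = 0
      · have ha' := ha.next hc hi hd (.inr ht)
        have hp0 := ht ▸ hp
        have hm0 := ht ▸ hm
        have hlt0 := ht ▸ hlt
        simp [exploreStep, wp, reachProg, Expr.eval, Op.eval, hh.k_eq, hh.aoff, hh.adat, hh.mP,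
          hh.mG, hp0, hm0, ht]
        refine ⟨hfuel, hs.2 _ _, hs.2 _ _, hadat _, hlt0, hz _, hmax _, ?_⟩
        exact .of_eq hh hpath (by simp) (by simp) (d := (dfsOf s).next)
          (by simp [dfsOf, Dfs.next, ht]) (r := recOf s) (by simp [recOf])
          (by simp [dfsOf, ht]) hd' hr' ha'
      · by_cases hw0 : c.mG (c.adat (s.arr 15 (s.arr 10 (s.reg 14)))) = 0
        · simp [exploreStep, wp, reachProg, attachProg, Expr.eval, Op.eval, hh.k_eq, hh.aoff,
            hh.adat, hh.mP, hh.mG, hp, hm, ht, hw0]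
          refine ⟨hfuel, hs.2 _ _, hs.2 _ _, hadat _, hlt, hz _, hs.2 _ _, hz' _, hone, ?_⟩
          exact .of_eq hh hpath (by simp) (by simp) (d := (dfsOf s).next)
            (by simp [dfsOf, Dfs.next]) (r := { recOf s with bad := 1 }) (by simp [recOf])
            (by simp [dfsOf, hw0]) hd' hr'
            (ha.attach_bad hc hi hd hp ht rfl hm rfl (.inl hw0))
        · obtain ⟨a, hatt⟩ : ∃ a, s.arr 12 (s.reg 16 * c.k +
            (c.mP (c.adat (s.arr 15 (s.arr 10 (s.reg 14)))) - 1)) = a := ⟨_, rfl⟩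
          by_cases ha0 : a = 0
          · subst ha0
            simp [exploreStep, wp, reachProg, attachProg, Expr.eval, Op.eval, hh.k_eq, hh.aoff,
              hh.adat, hh.mP, hh.mG, hp, hm, ht, hw0, hatt]
            refine ⟨hfuel, hs.2 _ _, hs.2 _ _, hadat _, hlt, hz _, hmax _, hz' _, hmG _, b3, ?_⟩
            exact .of_eq hh hpath (by simp) (by simp) (d := (dfsOf s).next)
              (by simp [dfsOf, Dfs.next]) (r := { recOf s with
                att := Function.update (recOf s).att (s.reg 16 * c.k +
                  (c.mP (c.adat (s.arr 15 (s.arr 10 (s.reg 14)))) - 1))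
                  (c.mG (c.adat (s.arr 15 (s.arr 10 (s.reg 14)))))
                cnt := (recOf s).cnt + 1 }) (by simp [recOf])
              (by simp [dfsOf]) hd' hr'
              (ha.attach_new hc hi hd hp ht rfl hm rfl hf hw0 hatt)
          · by_cases haw : a = c.mG (c.adat (s.arr 15 (s.arr 10 (s.reg 14))))
            · simp [exploreStep, wp, reachProg, attachProg, Expr.eval, Op.eval, hh.k_eq, hh.aoff,
                hh.adat, hh.mP, hh.mG, hp, hm, ht, hw0, hatt, haw]
              refine ⟨hfuel, hs.2 _ _, hs.2 _ _, hadat _, hlt, hz _, hmax _, hz' _, ?_⟩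
              exact .of_eq hh hpath (by simp) (by simp) (d := (dfsOf s).next)
                (by simp [dfsOf, Dfs.next]) (r := recOf s) (by simp [recOf])
                (by simp [dfsOf]) hd' hr'
                (ha.attach_old hc hi hd ht rfl rfl hw0 (hatt.trans haw))
            · simp [exploreStep, wp, reachProg, attachProg, Expr.eval, Op.eval, hh.k_eq, hh.aoff,
                hh.adat, hh.mP, hh.mG, hp, hm, ht, hw0, hatt, ha0, haw]
              refine ⟨hfuel, hs.2 _ _, hs.2 _ _, hadat _, hlt, hz _, hmax _, hz' _, hone, ?_⟩
              exact .of_eq hh hpath (by simp) (by simp) (d := (dfsOf s).next)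
                (by simp [dfsOf, Dfs.next]) (r := { recOf s with bad := 1 }) (by simp [recOf])
                (by simp [dfsOf]) hd' hr'
                (ha.attach_bad hc hi hd hp ht rfl hm rfl
                  (.inr ⟨fun h => ha0 (hatt.symm.trans h), fun h => haw (hatt.symm.trans h)⟩))
  · have hp' : c.aoff (s.arr 10 (s.reg 14) + 1) ≤ s.arr 15 (s.arr 10 (s.reg 14)) := not_lt.mp hp
    by_cases ht : s.reg 14 = 0
    · simp [exploreStep, wp, advanceProg, copyLoop, Expr.eval, Op.eval, hh.aoff,
        hh.pdat, ht ▸ hp, ht]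
      refine ⟨hfuel, hs.2 _ _, hs.2 _ _, b5, hpdat _, haoff _, fun hs' => ?_⟩
      refine (copyLoop_spec (k := c.k) (g := s.reg 9 + 1) hN.two_le hs' (by simp [hh.k_eq])
        (by simp) (by simp)).mono le_rfl fun s' _ ⟨h1, h2, h3, h4⟩ => ?_
      simp at h1 h2
      have e1 : ∀ r, r ≠ 22 → s'.reg r = _ := fun r hr => h3 r (by simpa using hr)
      have e2 : ∀ a, a ≠ 11 → s'.arr a = _ := fun a ha => h4 a (by simpa using ha)
      refine ⟨.of_eq hh hpath (by simp [e1]) (by simp [e2])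
        (d := (dfsOf s).advance c)
        (by simp [dfsOf, Dfs.advance, e1, e2, ht]) (r := recOf s) (by simp [recOf, e1, e2]) rfl
        (hd.advance hc hi hf hp ht hg)
        (hr.advance hc hi hd hp ht hg h1 h2)
        (ha.advance hc hi hd hp ht hg), by simp [e1]⟩
    · have hd' := hd.pop hf hp ht
      have hr' := hr.pop
      have htN : s.reg 14 ≤ N + 1 := (hs.1 14).trans (Nat.le_succ _)
      by_cases ht1 : s.reg 14 = 1
      · by_cases hcnt : s.reg 17 = c.k
        · by_cases hbad : s.reg 18 = 0
          · simp [exploreStep, wp, popProg, finishProg, Expr.eval, Op.eval, hh.k_eq, hh.aoff, ht1,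
              ht1 ▸ hp, hcnt, hbad]
            refine ⟨hfuel, hs.2 _ _, hs.2 _ _, hs.1 _, b4, b2, ?_⟩
            exact .of_eq hh hpath (by simp) (by simp) (d := (dfsOf s).pop)
              (by simp [dfsOf, Dfs.pop, ht1]) (r := { recOf s with
                cnt := 0, bad := 0, ncand := s.reg 20 + 1
                cand := Function.update (recOf s).cand (s.reg 20) (s.reg 16) })
              (by simp [recOf]) (by simp) hd' hr'
              (ha.finish hd hp ht1 (.inl ⟨hcnt, hbad, rfl, rfl⟩))
          · simp [exploreStep, wp, popProg, finishProg, Expr.eval, Op.eval, hh.k_eq, hh.aoff, ht1,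
              ht1 ▸ hp, hcnt, hbad]
            refine ⟨hfuel, hs.2 _ _, hs.2 _ _, b2, ?_⟩
            exact .of_eq hh hpath (by simp) (by simp) (d := (dfsOf s).pop)
              (by simp [dfsOf, Dfs.pop, ht1]) (r := { recOf s with cnt := 0, bad := 0 })
              (by simp [recOf]) (by simp) hd' hr'
              (ha.finish hd hp ht1 (.inr ⟨fun h0 => hbad h0.2, rfl, rfl⟩))
        · simp [exploreStep, wp, popProg, finishProg, Expr.eval, Op.eval, hh.k_eq, hh.aoff, ht1,
            ht1 ▸ hp, hcnt]
          refine ⟨hfuel, hs.2 _ _, hs.2 _ _, b2, ?_⟩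
          exact .of_eq hh hpath (by simp) (by simp) (d := (dfsOf s).pop)
            (by simp [dfsOf, Dfs.pop, ht1]) (r := { recOf s with cnt := 0, bad := 0 })
            (by simp [recOf]) (by simp) hd' hr'
            (ha.finish hd hp ht1 (.inr ⟨fun h0 => hcnt h0.1, rfl, rfl⟩))
      · have ht2 : s.reg 14 - 1 ≠ 0 := by omega
        simp [exploreStep, wp, popProg, Expr.eval, Op.eval, hh.aoff, hp, ht, ht2]
        refine ⟨hfuel, hs.2 _ _, hs.2 _ _, htN, ?_⟩
        exact .of_eq hh hpath (by simp) (by simp) (d := (dfsOf s).pop)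
          (by simp [dfsOf, Dfs.pop, ht1]) (r := recOf s) (by simp [recOf]) (by simp) hd' hr'
          (ha.pop ht ht1)

end

end Shredder

/-! ### The exploration of all paths -/

namespace Shredder

open WordRAM Expr Prog

/-- Set up the exploration of path `reg 8`. -/
def startPath : Prog :=
  assign 9 (cell 2 (reg 8)) ;;
  assign 16 ((reg 16).add (const 1)) ;;
  assign 13 (reg 16) ;;
  assign 14 (const 0) ;;
  assign 17 (const 0) ;;
  assign 18 (const 0) ;;
  assign 19 (((const 4).mul (reg 3)).add (const 1)) ;;
  store 10 (const 0) (cell 3 (reg 9)) ;;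
  store 15 (cell 3 (reg 9)) (cell 0 (cell 3 (reg 9)))

/-- Explore until the budget is used up or the last vertex of the path is reached. -/
def exploreLoop : Prog :=
  loop ((reg 19).mul (((reg 9).add (const 1)).lt (cell 2 ((reg 8).add (const 1))))) exploreStep

/-- Note where the exploration has stopped, and turn to the next path. -/
def endPath : Prog :=
  store 14 (reg 8) (reg 9) ;;
  store 6 (reg 8) (cell 3 (reg 9)) ;;
  assign 8 ((reg 8).add (const 1))

/-- Explore all paths. -/
def explorePaths : Prog :=
  assign 8 (const 0) ;; loop ((reg 8).lt (reg 1)) (startPath ;; exploreLoop ;; endPath)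

/-- The state after the exploration of the first `i` paths. Array `14` holds the positions where the
explorations have stopped. -/
structure PathsInv (c : Input) (i : ℕ) (s : State) : Prop where
  holds : Holds c s
  path : s.reg 8 = i
  stamp_le : ∀ w, s.arr 9 w ≤ s.reg 16
  stamp_unmarked : ∀ w, s.arr 9 w ≠ 0 → w < c.n ∧ c.mP w = 0
  row_fresh : ∀ h, c.poff i < h → ∀ j < c.k, s.arr 11 (h * c.k + j) = 0
  att_fresh : ∀ b, s.reg 16 < b → ∀ j < c.k, s.arr 12 (b * c.k + j) = 0
  cand_lt : ∀ t < s.reg 20, s.arr 13 t < s.reg 16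
  cand_ok : ∀ t < s.reg 20, c.CandOK fun j => s.arr 12 (s.arr 13 t * c.k + j)
  bid_le : s.reg 16 ≤ i * (c.F + 1)
  cand_le : c.k * s.reg 20 ≤ i * c.F
  halted : ∀ l < i, c.poff l ≤ s.arr 14 l ∧ s.arr 14 l < c.poff (l + 1) ∧
    ∀ h, c.poff l < h → h ≤ s.arr 14 l → c.RowOK (s.arr 11) l h
  verts : ∀ l < i, s.arr 6 l = c.pdat (s.arr 14 l)
  fence : ∀ A σ, c.Fence A σ → ∀ l < i, σ l ≤ s.arr 14 l ∧
    ∀ j < c.k, s.arr 11 (σ l * c.k + j) ≤ σ j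
  found : ∀ Q σ, c.Bridge Q σ → ∀ l < i, c.poff l ≤ σ l → σ l < s.arr 14 l →
    (∃ u ∈ Q, c.Nb (c.pdat (σ l)) u) → Emitted c (recOf s) σ

theorem exploreStep_time (τ : ℕ) : exploreStep.time τ ≤ τ + 100 := by
  simp only [exploreStep, reachProg, attachProg, pushProg, popProg, finishProg, advanceProg,
    copyLoop, Prog.time, Expr.cost]
  omega

section

variable {c : Input} {i N : ℕ} {s : State} (hc : c.Marked) (hi : i < c.k) (hN : c.Small N)
  (hs : s.Bdd N)
include hc hi hN hs

theorem startPath_spec (h : PathsInv c i s) :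
    Tri 10 N startPath (startPath.time 0) s fun s' =>
      ExploreInv c i (s.arr 11) (Emitted c (recOf s)) s' ∧ s'.reg 19 = c.F := by
  have hk := hc.k_pos
  have h1 : (c.F + 1) ≤ c.k * (c.F + 1) := Nat.le_mul_of_pos_left _ hk
  have h2 : c.k * (c.F + 1) + 1 ≤ (c.k * (c.F + 1) + 1) * c.k := Nat.le_mul_of_pos_right _ hk
  have h3 := hN.bridge
  have h4 : (i + 1) * (c.F + 1) ≤ c.k * (c.F + 1) := Nat.mul_le_mul_right _ hi
  have h5 : (i + 1) * (c.F + 1) = i * (c.F + 1) + (c.F + 1) := Nat.succ_mul _ _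
  have hb := h.bid_le
  have hh := h.holds
  have hF := hh.F_eq
  refine Tri.of_wp hN.two_le (by decide) hs ?_
  simp [startPath, wp, Expr.eval, Op.eval, hh.aoff, hh.poff, hh.pdat, h.path, hF]
  refine ⟨hh.poff ▸ hs.2 2 i, by omega, by omega, hh.pdat ▸ hs.2 3 _,
    hh.aoff ▸ hs.2 0 _, ?_⟩
  have hroot : c.pdat (c.poff i) = c.x := hc.pdat_start i hi
  have hst : ∀ w, ¬ s.reg 16 + 1 ≤ s.arr 9 w := fun w => by
    have := h.stamp_le w
    omega
  have hlt := hc.poff_lt i hi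
  let d : Dfs := ⟨c.poff i, 0, s.reg 16 + 1, s.reg 16 + 1, c.F,
    Function.update (s.arr 10) 0 (c.pdat (c.poff i)),
    Function.update (s.arr 15) (c.pdat (c.poff i)) (c.aoff (c.pdat (c.poff i))), s.arr 9⟩
  let r : Rec := ⟨0, 0, s.reg 20, s.arr 12, s.arr 13⟩
  -- all stamps are from earlier paths, and nothing has been processed yet
  have hsc : ∀ u w, ¬ Scanned c i d u w := by
    rintro u w (⟨h6 | h6, ε, h7, h8, -⟩ | ⟨g', h6, h7, -⟩)
    · exact hst u h6
    · subst h6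
      simp only [d, Function.update_self] at h7 h8
      omega
    · exact absurd h7 (not_lt.mpr h6)
  refine .of_eq hh h.path (by simp) (by simp) (d := d) (by simp [dfsOf, d]) (r := r)
    (by simp [recOf, r]) (M := s.arr 11) (by simp) ?_ ?_ ?_
  · refine ⟨le_rfl, Nat.lt_of_succ_lt hlt, Nat.succ_pos _, le_rfl,
      fun w => (h.stamp_le w).trans (Nat.le_succ _), h.stamp_unmarked, ?_, fun t h6 h7 => ?_,
      fun t _ h6 h7 => ?_, fun u hu => ?_, fun u hu => absurd hu (hst u),
      fun u w h6 => absurd h6 (hsc u w), fun u w _ h6 => absurd h6 (hsc u w), ?_, ?_, ?_⟩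
    · simp [d]
    · exact absurd (Nat.le_zero.mp h7) h6
    · exact absurd (Nat.le_zero.mp h7) h6
    · rcases hu with hu | rfl
      · exact absurd hu (hst u)
      · simp only [d, Function.update_self]
        exact ⟨le_rfl, hc.aoff_le _ (hroot ▸ hc.x_lt)⟩
    · simp [d, Input.spent, hst]
    · simp [d]
    · simp only [d]
      omega
  · refine ⟨fun _ _ _ _ => rfl, fun u w h6 => absurd h6 (hsc u w),
      fun h' h6 j hj => h.row_fresh h' (Nat.lt_of_succ_lt h6) j hj,
      fun h' h6 h7 => absurd h7 (not_le.mpr h6), fun A σ _ => ⟨fun h' h6 _ _ j hj => ?_,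
      fun _ u hu => absurd hu (hst u)⟩⟩
    rw [h.row_fresh h' h6 j hj]
    exact Nat.zero_le _
  · have hrow : ∀ j < c.k, s.arr 12 ((s.reg 16 + 1) * c.k + j) = 0 :=
      h.att_fresh _ (Nat.lt_succ_self _)
    refine ⟨fun σ hσ => hσ, fun g' h6 h7 => absurd h7 (not_lt.mpr h6),
      fun _ => ⟨rfl, rfl, fun w => ?_⟩, fun _ u w _ h6 => absurd h6 (hsc u w),
      fun j hj hj0 => absurd (hrow j hj) hj0, ?_, fun b h6 => h.att_fresh b ?_,
      fun t ht => (h.cand_lt t ht).trans (Nat.lt_succ_self _), h.cand_ok, fun Q σ _ hex => ?_,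
      fun Q σ _ hex => ?_, ?_⟩
    · have := h.stamp_le w
      simp only [d]
      omega
    · refine (Finset.card_eq_zero.mpr (Finset.filter_eq_empty_iff.mpr fun j hj => ?_)).symm
      exact not_not.mpr (hrow j (Finset.mem_range.mp hj))
    · exact Nat.lt_of_succ_lt h6
    · obtain ⟨u, -, hu⟩ := hex
      exact absurd (ge_of_eq hu) (hst u)
    · obtain ⟨u, -, hu, -⟩ := hex
      exact absurd hu (hst u)
    · have := h.cand_le
      simp only [d, r]
      rw [Nat.succ_mul]
      omega

omit hs in
/-- Each step uses up one unit of the budget `c.F`. -/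
theorem exploreLoop_spec {M₀ : ℕ → ℕ} {E : (ℕ → ℕ) → Prop} {s' : State} (hs' : s'.Bdd N)
    (h : ExploreInv c i M₀ E s') (hf : s'.reg 19 = c.F) :
    Tri 10 N exploreLoop (c.F * (c.k * 22 + 120) + 12) s' fun s'' => ExploreInv c i M₀ E s'' ∧
      (s''.reg 19 = 0 ∨ s''.reg 9 + 1 = c.poff (i + 1)) := by
  have heval : ∀ s₁ : State, ExploreInv c i M₀ E s₁ → (eval s₁ ((reg 19).mul
      (((reg 9).add (const 1)).lt (cell 2 ((reg 8).add (const 1))))) ≠ 0 ↔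
      s₁.reg 19 ≠ 0 ∧ s₁.reg 9 + 1 < c.poff (i + 1)) := by
    intro s₁ h₁
    simp [Expr.eval, Op.eval, h₁.path, h₁.holds.poff, and_comm]
  have htime : c.F * (c.k * 22 + 104 + (1 + (1 + 1 + 1 + (1 + 1 + 1 + 1) + 1) + 1) + 1) ≤
      c.F * (c.k * 22 + 120) := Nat.mul_le_mul_left _ (by omega)
  refine (Tri.loop (D := 10) (N := N) (T := c.k * 22 + 104) hN.two_le (by decide)
    (fun m s₁ => ExploreInv c i M₀ E s₁ ∧ s₁.reg 19 = m) (fun m s₁ hb ⟨h₁, h₂⟩ he => ?_)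
    (fun m s₁ hb ⟨h₁, h₂⟩ he => ?_) c.F s' hs' ⟨h, hf⟩).mono
    (by simp only [Expr.cost]; omega) fun _ _ h => h
  · obtain ⟨h₃, h₄⟩ := (heval s₁ h₁).mp he
    refine ⟨m - 1, by omega, ?_⟩
    refine (exploreStep_spec hc hi hN hb h₁ h₃ h₄).mono
      ((exploreStep_time _).trans (by omega)) fun s₂ _ h₅ => ?_
    exact ⟨h₅.1, h₂ ▸ h₅.2⟩
  · refine ⟨h₁, ?_⟩
    have h₃ := (heval s₁ h₁).not.mp (not_not.mpr he)
    have h₄ : s₁.reg 9 < c.poff (i + 1) := h₁.dfs.g_lt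
    omega

omit hs in
/-- At the end of an exploration, a fence has been left behind or its boundary on the path has just
been reached, since within the fence neither the budget nor the path ends. -/
theorem endPath_spec {s' : State} (h : PathsInv c i s) (hs' : s'.Bdd N)
    (he : ExploreInv c i (s.arr 11) (Emitted c (recOf s)) s')
    (hhalt : s'.reg 19 = 0 ∨ s'.reg 9 + 1 = c.poff (i + 1)) (h14 : s'.arr 14 = s.arr 14)
    (h6 : s'.arr 6 = s.arr 6) : Tri 10 N endPath (endPath.time 0) s' (PathsInv c (i + 1)) := by
  refine Tri.of_wp hN.two_le (by decide) hs' ?_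
  obtain ⟨hh, hpath, hd, hr, ha⟩ := he
  simp [endPath, wp, Expr.eval, Op.eval, hpath, hh.pdat]
  have hk : c.k ≤ N := hh.k_eq ▸ hs'.1 1
  refine ⟨hs'.1 9, hh.pdat ▸ hs'.2 3 _, by omega, ?_⟩
  have hge : c.poff i ≤ s'.reg 9 := hd.g_ge
  have hlt : s'.reg 9 < c.poff (i + 1) := hd.g_lt
  have hold : ∀ l < i, ∀ h, h < c.poff (l + 1) → ∀ j < c.k,
      s'.arr 11 (h * c.k + j) = s.arr 11 (h * c.k + j) := fun l hl h hh' => by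
    have := hc.poff_mono (i := l + 1) (j := i) hl hi.le
    exact hr.old h (by omega)
  refine ⟨hh.of_eq (by simp) (by simp), by simp, by simpa [dfsOf] using hd.stamp_le,
    by simpa [dfsOf] using hd.stamp_unmarked, fun h' hh' j hj => ?_,
    by simpa [recOf, dfsOf] using ha.fresh, by simpa [recOf, dfsOf] using ha.cand_lt,
    by simpa [recOf] using ha.cand_ok, ?_, ?_, fun l hl => ?_, fun l hl => ?_,
    fun A σ hA l hl => ?_, fun Q σ hQ l hl h1 h2 hex => ?_⟩
  · simpa using hr.fresh h' (show s'.reg 9 + 1 < h' by omega) j hj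
  · have : s'.reg 16 + s'.reg 19 ≤ (i + 1) * (c.F + 1) := hd.bid_le
    simp
    omega
  · have : c.k * s'.reg 20 + s'.reg 17 + s'.reg 19 ≤ (i + 1) * c.F := ha.cand_le
    simp
    omega
  · simp only [State.arr_setReg, State.arr_setCell]
    by_cases e : l = i
    · subst e
      simpa using ⟨hge, hlt, hr.rows⟩
    · obtain ⟨h1, h2, h3⟩ := h.halted l (by omega)
      simp [h14, Function.update_of_ne e]
      exact ⟨h1, h2, fun h' h4 h5 =>
        (h3 h' h4 h5).congr (hold l (by omega) h' (by omega)) hc⟩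
  · by_cases e : l = i
    · subst e
      simp
    · simpa [h14, h6, Function.update_of_ne e] using h.verts l (by omega)
  · by_cases e : l = i
    · subst e
      obtain ⟨h1, h2⟩ := hr.fence A σ hA
      obtain ⟨h3, h4⟩ := hA.mid l hi
      have h5 : σ l ≤ s'.reg 9 := by
        by_contra h5
        have h6 : s'.reg 9 < σ l := by omega
        have h7 : s'.reg 19 ≠ 0 := hd.fuel_ne_zero hc hi hA h6 (h2 h6)
        omega
      simpa using ⟨h5, h1 (σ l) h3 (by have : (dfsOf s').g = s'.reg 9 := rfl; omega) le_rfl⟩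
    · obtain ⟨h1, h2⟩ := h.fence A σ hA l (by omega)
      have h3 := h.halted l (by omega)
      have h4 := hold l (by omega) (σ l) (by omega)
      simp [h14, Function.update_of_ne e]
      exact ⟨h1, fun j hj => h4 j hj ▸ h2 j hj⟩
  · suffices Emitted c (recOf s') σ by simpa [recOf] using this
    by_cases e : l = i
    · subst e
      -- the bridge was found from position `σ l`, which has been passed, so it is finished
      obtain ⟨u, hu, hn⟩ := hex
      simp at h2
      have hm := hQ.unmarked u hu
      exact ha.found Q σ hQ ⟨u, hu, hd.seen _ u (.inr ⟨σ l, h1, h2, rfl, hn⟩) hm,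
        ha.past (σ l) h1 h2 u hn hm⟩
    · simp [h14, Function.update_of_ne e] at h2
      exact ha.old σ (h.found Q σ hQ l (by omega) h1 h2 hex)

theorem explorePath_spec (h : PathsInv c i s) :
    Tri 10 N (startPath ;; exploreLoop ;; endPath) (c.F * (c.k * 22 + 120) + 70) s
      (PathsInv c (i + 1)) := by
  refine (((startPath_spec hc hi hN hs h).frame).seq fun s₁ hs₁ ⟨⟨h₁, hf⟩, _, ha₁⟩ =>
    (((exploreLoop_spec hc hi hN hs₁ h₁ hf).frame).seq fun s₂ hs₂ ⟨⟨h₂, hhalt⟩, _, ha₂⟩ =>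
      endPath_spec hc hi hN h hs₂ h₂ hhalt ?_ ?_)).mono ?_ fun _ _ h => h
  · exact (ha₂ 14 (by decide)).trans (ha₁ 14 (by decide))
  · exact (ha₂ 6 (by decide)).trans (ha₁ 6 (by decide))
  · simp only [startPath, endPath, Prog.time, Expr.cost]
    omega

end

theorem explorePaths_spec {c : Input} {N : ℕ} {s : State} (hc : c.Marked) (hN : c.Small N)
    (hs : s.Bdd N) (hh : Holds c s) (h0 : s.reg 16 = 0) (h0' : s.reg 20 = 0)
    (h9 : ∀ w, s.arr 9 w = 0) (h11 : ∀ z, s.arr 11 z = 0) (h12 : ∀ z, s.arr 12 z = 0) :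
    Tri 10 N explorePaths (c.k * (c.F * (c.k * 22 + 120) + 74) + 6) s (PathsInv c c.k) := by
  have hassign : Tri 10 N (assign 8 (const 0)) 2 s (PathsInv c 0) := by
    refine Tri.of_wp (τ := 0) hN.two_le (by decide) hs ?_
    simp [wp, Expr.eval]
    refine ⟨hh.of_eq (by simp) (by simp), by simp, by simp [h9], by simp [h9], by simp [h11],
      by simp [h12], by simp [h0'], by simp [h0'], by simp [h0], by simp [h0'], ?_, ?_, ?_, ?_⟩ <;>
    simp
  refine (hassign.seq (U := c.k * (c.F * (c.k * 22 + 120) + 74) + 4) fun s₁ hs₁ h₁ => ?_).mono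
    (by omega) fun _ _ h => h
  refine (Tri.loop (D := 10) (N := N) (T := c.F * (c.k * 22 + 120) + 70) hN.two_le (by decide)
    (fun m s₁ => ∃ i, i + m = c.k ∧ PathsInv c i s₁) (fun m s₁ hb ⟨i, him, h₂⟩ he => ?_)
    (fun m s₁ hb ⟨i, him, h₂⟩ he => ?_) c.k s₁ hs₁ ⟨0, by omega, h₁⟩).mono le_rfl fun _ _ h => h
  · have hi : i < c.k := by simpa [Expr.eval, Op.eval, h₂.path, h₂.holds.k_eq] using he
    refine ⟨m - 1, by omega, (explorePath_spec hc hi hN hb h₂).mono le_rfl fun s₂ _ h₃ =>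
      ⟨i + 1, by omega, h₃⟩⟩
  · have hi : ¬ i < c.k := by simpa [Expr.eval, Op.eval, h₂.path, h₂.holds.k_eq] using he
    obtain rfl : i = c.k := by omega
    exact h₂

end Shredder

/-! ### Marking the vertices on the paths -/

namespace Shredder

open WordRAM Expr Prog

namespace Input

/-- What every input satisfies, whether or not the paths are suitable: adjacency is symmetric, and
the paths are nonempty lists of vertices. Nothing is said about the marks. -/
structure Raw (c : Input) : Prop where
  k_pos : 1 ≤ c.k
  x_lt : c.x < c.n
  aoff_le : ∀ u < c.n, c.aoff u ≤ c.aoff (u + 1)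
  nb_symm : ∀ u w, c.Nb u w → c.Nb w u
  poff_zero : c.poff 0 = 0
  poff_last : c.poff c.k = c.tot
  poff_lt : ∀ i < c.k, c.poff i < c.poff (i + 1)
  pdat_lt : ∀ g < c.tot, c.pdat g < c.n

/-- The same data with other marks. -/
abbrev withMarks (c : Input) (mP mG : ℕ → ℕ) : Input := { c with mP := mP, mG := mG }

/-- Position `g` is neither the first nor the last position of path `i`. -/
def Mid (c : Input) (i g : ℕ) : Prop := c.poff i < g ∧ g + 1 < c.poff (i + 1)

/-- The last vertex of path `i`. -/
def last (c : Input) (i : ℕ) : ℕ := c.pdat (c.poff (i + 1) - 1)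

/-- The paths have at least one edge, start at `x` and are openly disjoint. -/
structure Good (c : Input) : Prop where
  start : ∀ i < c.k, c.pdat (c.poff i) = c.x
  last_ne : ∀ i < c.k, c.last i ≠ c.x
  mid_ne : ∀ i < c.k, ∀ g, c.Mid i g → c.pdat g ≠ c.x
  mid_ne_last : ∀ i < c.k, ∀ g, c.Mid i g → ∀ l < c.k, c.pdat g ≠ c.last l
  mid_inj : ∀ i < c.k, ∀ g, c.Mid i g → ∀ l < c.k, ∀ h, c.Mid l h → c.pdat g = c.pdat h → g = h

theorem Raw.poff_mono {c : Input} (hc : c.Raw) {i j : ℕ} (h : i ≤ j) (hj : j ≤ c.k) :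
    c.poff i ≤ c.poff j := by
  induction j, h using Nat.le_induction with
  | base => rfl
  | succ j hij ih => exact (ih (by omega)).trans (hc.poff_lt j (by omega)).le

theorem Raw.mid_index {c : Input} (hc : c.Raw) {i l g : ℕ} (hi : i < c.k) (hl : l < c.k)
    (h1 : c.poff i ≤ g) (h2 : g < c.poff (i + 1)) (h : c.Mid l g) : l = i := by
  rcases lt_trichotomy l i with h3 | h3 | h3
  · have := hc.poff_mono (i := l + 1) (j := i) h3 hi.le
    have := h.2
    omega
  · exact h3
  · have := hc.poff_mono (i := i + 1) (j := l) h3 hl.le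
    have := h.1
    omega

end Input

/-- The last vertices of the first `i` paths and the inner vertices at positions less than `g` have
been marked by `mP` and `mG`. If `rej ≠ 0`, then the paths have been found not to be `Good`. -/
structure MarkInv (c : Input) (i g rej : ℕ) (mP mG : ℕ → ℕ) : Prop where
  mark_x : mP c.x = 1 ∧ mG c.x = 0
  cases : ∀ v, mP v = 0 ∨ v = c.x ∨ (∃ l < c.k, ∃ h, c.Mid l h ∧ h < g ∧ v = c.pdat h) ∨
    ∃ l < i, v = c.last l ∧ mP v = 1 ∧ mG v = c.tot
  ends : rej = 0 → ∀ l < i, c.pdat (c.poff l) = c.x ∧ mP (c.last l) = 1 ∧ mG (c.last l) = c.tot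
  mids : rej = 0 → ∀ l < c.k, ∀ h, c.Mid l h → h < g →
    mP (c.pdat h) = l + 1 ∧ mG (c.pdat h) = h
  good : c.Good → rej = 0

namespace MarkInv

variable {c : Input} {i g rej rej' : ℕ} {mP mG : ℕ → ℕ}

/-- The last vertex of a path is marked already; this is in order if it is the last vertex of an
earlier path. -/
theorem end_old (hc : c.Raw) (hi : i < c.k) (h : MarkInv c i 0 rej mP mG) (hm : mP (c.last i) ≠ 0)
    (h0 : rej' = 0 ↔ rej = 0 ∧ c.pdat (c.poff i) = c.x ∧ mG (c.last i) = c.tot) :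
    MarkInv c (i + 1) 0 rej' mP mG := by
  have htot : 0 < c.tot := by
    have h1 := hc.poff_lt 0 hc.k_pos
    have h2 := hc.poff_mono (i := 0 + 1) hc.k_pos le_rfl
    rw [hc.poff_last] at h2
    omega
  have hcase : c.last i = c.x ∨ (mP (c.last i) = 1 ∧ mG (c.last i) = c.tot) := by
    rcases h.cases (c.last i) with h1 | h1 | ⟨l, -, g, -, h1, -⟩ | ⟨l, -, -, h1⟩
    · exact absurd h1 hm
    · exact .inl h1
    · omega
    · exact .inr h1
  refine ⟨h.mark_x, fun v => ?_, fun h1 l hl => ?_,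
    fun _ l _ h _ h1 => absurd h1 (Nat.not_lt_zero _),
    fun hg => h0.mpr ⟨h.good hg, hg.start i hi, ?_⟩⟩
  · rcases h.cases v with h1 | h1 | h1 | ⟨l, hl, h1⟩
    · exact .inl h1
    · exact .inr (.inl h1)
    · exact .inr (.inr (.inl h1))
    · exact .inr (.inr (.inr ⟨l, by omega, h1⟩))
  · obtain ⟨h2, h3, h4⟩ := h0.mp h1
    rcases Nat.lt_succ_iff_lt_or_eq.mp hl with hl | rfl
    · exact h.ends h2 l hl
    · refine ⟨h3, ?_, h4⟩
      rcases hcase with h5 | h5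
      · rw [h5, h.mark_x.2] at h4
        omega
      · exact h5.1
  · rcases hcase with h5 | h5
    · exact absurd h5 (hg.last_ne i hi)
    · exact h5.2

/-- The last vertex of a path receives its mark. -/
theorem end_new (hi : i < c.k) (h : MarkInv c i 0 rej mP mG) (hm : mP (c.last i) = 0)
    (h0 : rej' = 0 ↔ rej = 0 ∧ c.pdat (c.poff i) = c.x) :
    MarkInv c (i + 1) 0 rej' (Function.update mP (c.last i) 1)
      (Function.update mG (c.last i) c.tot) := by
  have hx : c.x ≠ c.last i := fun h1 => by
    rw [← h1, h.mark_x.1] at hm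
    omega
  refine ⟨?_, fun v => ?_, fun h1 l hl => ?_, fun _ l _ h _ h1 => absurd h1 (Nat.not_lt_zero _),
    fun hg => h0.mpr ⟨h.good hg, hg.start i hi⟩⟩
  · simpa [hx] using h.mark_x
  · by_cases hv : v = c.last i
    · exact .inr (.inr (.inr ⟨i, by omega, hv, by simp [hv], by simp [hv]⟩))
    · simp only [Function.update_of_ne hv]
      rcases h.cases v with h1 | h1 | h1 | ⟨l, hl, h1⟩
      · exact .inl h1
      · exact .inr (.inl h1)
      · exact .inr (.inr (.inl h1))
      · exact .inr (.inr (.inr ⟨l, by omega, h1⟩))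
  · obtain ⟨h2, h3⟩ := h0.mp h1
    rcases Nat.lt_succ_iff_lt_or_eq.mp hl with hl | rfl
    · obtain ⟨h4, h5⟩ := h.ends h2 l hl
      have : c.last l ≠ c.last i := fun h6 => by
        rw [h6] at h5
        omega
      exact ⟨h4, by simpa [this] using h5⟩
    · exact ⟨h3, by simp⟩

/-- A marked inner vertex shows that the paths are not openly disjoint. -/
theorem mid_old (hi : i < c.k) (h : MarkInv c c.k g rej mP mG) (hg : c.Mid i g)
    (hm : mP (c.pdat g) ≠ 0) : MarkInv c c.k (g + 1) 1 mP mG := by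
  refine ⟨h.mark_x, fun v => ?_, fun h1 => absurd h1 one_ne_zero, fun h1 => absurd h1 one_ne_zero,
    fun hgood => ?_⟩
  · rcases h.cases v with h1 | h1 | ⟨l, hl, g', h1, h2, h3⟩ | h1
    · exact .inl h1
    · exact .inr (.inl h1)
    · exact .inr (.inr (.inl ⟨l, hl, g', h1, by omega, h3⟩))
    · exact .inr (.inr (.inr h1))
  · rcases h.cases (c.pdat g) with h1 | h1 | ⟨l, hl, g', h1, h2, h3⟩ | ⟨l, hl, h1, -⟩
    · exact absurd h1 hm
    · exact absurd h1 (hgood.mid_ne i hi g hg)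
    · have := hgood.mid_inj i hi g hg l hl g' h1 h3
      omega
    · exact absurd h1 (hgood.mid_ne_last i hi g hg l hl)

/-- An inner vertex receives its mark. -/
theorem mid_new (hc : c.Raw) (hi : i < c.k) (h : MarkInv c c.k g rej mP mG) (hg : c.Mid i g)
    (hm : mP (c.pdat g) = 0) : MarkInv c c.k (g + 1) rej (Function.update mP (c.pdat g) (i + 1))
      (Function.update mG (c.pdat g) g) := by
  have hne : ∀ v, mP v ≠ 0 → v ≠ c.pdat g := fun v hv h1 => hv (h1 ▸ hm)
  have hx : c.x ≠ c.pdat g := hne _ (by rw [h.mark_x.1]; exact one_ne_zero)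
  refine ⟨?_, fun v => ?_, fun h1 l hl => ?_, fun h1 l hl g' h2 h3 => ?_, h.good⟩
  · simpa [hx] using h.mark_x
  · by_cases hv : v = c.pdat g
    · exact .inr (.inr (.inl ⟨i, hi, g, hg, by omega, hv⟩))
    · simp only [Function.update_of_ne hv]
      rcases h.cases v with h1 | h1 | ⟨l, hl, g', h1, h2, h3⟩ | h1
      · exact .inl h1
      · exact .inr (.inl h1)
      · exact .inr (.inr (.inl ⟨l, hl, g', h1, by omega, h3⟩))
      · exact .inr (.inr (.inr h1))
  · obtain ⟨h2, h3⟩ := h.ends h1 l hl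
    have := hne (c.last l) (by omega)
    exact ⟨h2, by simpa [this] using h3⟩
  · by_cases e : g' = g
    · subst e
      have := hc.mid_index hi hl hg.1.le ((Nat.le_succ _).trans_lt hg.2) h2
      simp [this]
    · obtain h4 := h.mids h1 l hl g' h2 (by omega)
      have := hne (c.pdat g') (by omega)
      simpa [this] using h4

/-- At the end of a path, its last position and the first one of the next path are passed over. -/
theorem skip (hc : c.Raw) (hi : i < c.k) (h : MarkInv c c.k g rej mP mG)
    (hg : c.poff (i + 1) ≤ g + 1) (hg' : g ≤ c.poff (i + 1)) :
    MarkInv c c.k (c.poff (i + 1) + 1) rej mP mG := by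
  refine ⟨h.mark_x, fun v => ?_, h.ends, fun h1 l hl g' h2 h3 => h.mids h1 l hl g' h2 ?_, h.good⟩
  · rcases h.cases v with h1 | h1 | ⟨l, hl, g', h1, h2, h3⟩ | h1
    · exact .inl h1
    · exact .inr (.inl h1)
    · exact .inr (.inr (.inl ⟨l, hl, g', h1, by omega, h3⟩))
    · exact .inr (.inr (.inr h1))
  · by_contra h4
    rcases Nat.lt_or_ge i l with h5 | h5
    · have := hc.poff_mono (i := i + 1) (j := l) h5 hl.le
      have := h2.1
      omega
    · have := hc.poff_mono (i := l + 1) (j := i + 1) (by omega) hi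
      have := h2.2
      omega

/-- If the paths have not been found unsuitable, then the marks make the input consistent. -/
theorem marked (hc : c.Raw) (h : MarkInv c c.k (c.tot + 1) 0 mP mG) :
    (c.withMarks mP mG).Marked where
  k_pos := hc.k_pos
  x_lt := hc.x_lt
  aoff_le := hc.aoff_le
  nb_symm := hc.nb_symm
  poff_zero := hc.poff_zero
  poff_last := hc.poff_last
  poff_lt i hi := by
    -- a path without edges would end in `x`, which has another mark
    by_contra h1
    have h2 := hc.poff_lt i hi
    simp only at hi h1
    have h3 : c.poff (i + 1) - 1 = c.poff i := by omega
    obtain ⟨h4, -, h5⟩ := h.ends rfl i hi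
    rw [Input.last, h3, h4, h.mark_x.2] at h5
    have := hc.poff_mono (i := i + 1) (j := c.k) hi le_rfl
    rw [hc.poff_last] at this
    omega
  pdat_lt := hc.pdat_lt
  pdat_start i hi := (h.ends rfl i hi).1
  mark_x := h.mark_x
  mark_mid i hi g h1 h2 := h.mids rfl i hi g ⟨h1, h2⟩ (by
    have := hc.poff_mono (i := i + 1) (j := c.k) hi le_rfl
    rw [hc.poff_last] at this
    simp only at h2
    omega)
  mark_end i hi := (h.ends rfl i hi).2
  mark_cases v := by
    rcases h.cases v with h1 | h1 | ⟨l, hl, g', h1, -, h3⟩ | ⟨l, hl, h1, -⟩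
    · exact .inl h1
    · exact .inr (.inl h1)
    · exact .inr (.inr (.inl ⟨l, hl, g', h1.1, h1.2, h3⟩))
    · exact .inr (.inr (.inr ⟨l, hl, h1⟩))

end MarkInv

/-- Mark the last vertex of path `reg 8`. -/
def markEnd : Prog :=
  ite ((cell 3 (cell 2 (reg 8))).eq (reg 2)) skip (assign 7 (const 1)) ;;
  assign 11 (cell 3 ((cell 2 ((reg 8).add (const 1))).sub (const 1))) ;;
  ite (cell 7 (reg 11))
    (ite ((cell 8 (reg 11)).eq (reg 10)) skip (assign 7 (const 1)))
    (store 7 (reg 11) (const 1) ;; store 8 (reg 11) (reg 10)) ;;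
  assign 8 ((reg 8).add (const 1))

/-- Mark the vertex at position `reg 9`, or turn to the next path. -/
def markMid : Prog :=
  ite (((reg 9).add (const 1)).lt (cell 2 ((reg 8).add (const 1))))
    (assign 11 (cell 3 (reg 9)) ;;
      ite (cell 7 (reg 11)) (assign 7 (const 1))
        (store 7 (reg 11) ((reg 8).add (const 1)) ;; store 8 (reg 11) (reg 9)) ;;
      assign 9 ((reg 9).add (const 1)))
    (assign 8 ((reg 8).add (const 1)) ;; assign 9 ((cell 2 (reg 8)).add (const 1)))

/-- Mark `x` and the vertices on the paths; set register `7` if the paths are not suitable. -/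
def markPaths : Prog :=
  store 7 (reg 2) (const 1) ;;
  assign 8 (const 0) ;;
  loop ((reg 8).lt (reg 1)) markEnd ;;
  assign 8 (const 0) ;;
  assign 9 (const 1) ;;
  loop ((reg 8).lt (reg 1)) markMid

/-- The part of the state that marking the paths does not change. -/
structure HoldsPaths (c : Input) (s : State) : Prop where
  k_eq : s.reg 1 = c.k
  x_eq : s.reg 2 = c.x
  tot_eq : s.reg 10 = c.tot
  poff : s.arr 2 = c.poff
  pdat : s.arr 3 = c.pdat

theorem HoldsPaths.of_eq {c : Input} {s s' : State} (h : HoldsPaths c s)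
    (hr : ∀ r ∈ [1, 2, 10], s'.reg r = s.reg r) (ha : ∀ a ∈ [2, 3], s'.arr a = s.arr a) :
    HoldsPaths c s' where
  k_eq := (hr 1 (by decide)).trans h.k_eq
  x_eq := (hr 2 (by decide)).trans h.x_eq
  tot_eq := (hr 10 (by decide)).trans h.tot_eq
  poff := (ha 2 (by decide)).trans h.poff
  pdat := (ha 3 (by decide)).trans h.pdat

section

variable {c : Input} {i N : ℕ} {s : State} (hc : c.Raw) (hN : 2 ≤ N) (htN : c.tot + 1 ≤ N)
  (hkN : c.k ≤ N) (hs : s.Bdd N)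
include hc hN hs

theorem markEnd_spec (hkN : c.k ≤ N) (hh : HoldsPaths c s) (hi : i < c.k) (hr : s.reg 8 = i)
    (h : MarkInv c i 0 (s.reg 7) (s.arr 7) (s.arr 8)) :
    Tri 10 N markEnd (markEnd.time 0) s fun s' => HoldsPaths c s' ∧ s'.reg 8 = i + 1 ∧
      MarkInv c (i + 1) 0 (s'.reg 7) (s'.arr 7) (s'.arr 8) := by
  refine Tri.of_wp hN (by decide) hs ?_
  have e : c.pdat (c.poff (i + 1) - 1) = c.last i := rfl
  have hp : c.last i ≤ N := e ▸ hh.pdat ▸ hs.2 3 _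
  have ht : c.tot ≤ N := hh.tot_eq ▸ hs.1 10
  have h1 : 1 ≤ N := by omega
  have h2 : i + 1 ≤ N := by omega
  by_cases h3 : c.pdat (c.poff i) = c.x <;> by_cases h4 : s.arr 7 (c.last i) = 0
  · simp [markEnd, wp, Expr.eval, Op.eval, hh.poff, hh.pdat, hh.x_eq, hh.tot_eq, hr, e, h3, h4]
    exact ⟨hp, h1, ht, h2, hh.of_eq (by simp) (by simp), h.end_new hi h4 (by simp [h3])⟩
  · by_cases h5 : s.arr 8 (c.last i) = c.tot
    · simp [markEnd, wp, Expr.eval, Op.eval, hh.poff, hh.pdat, hh.x_eq, hh.tot_eq, hr, e, h3, h4,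
        h5]
      exact ⟨hp, h2, hh.of_eq (by simp) (by simp), h.end_old hc hi h4 (by simp [h3, h5])⟩
    · simp [markEnd, wp, Expr.eval, Op.eval, hh.poff, hh.pdat, hh.x_eq, hh.tot_eq, hr, e, h3, h4,
        h5]
      exact ⟨hp, h1, h2, hh.of_eq (by simp) (by simp), h.end_old hc hi h4 (by simp [h5])⟩
  · simp [markEnd, wp, Expr.eval, Op.eval, hh.poff, hh.pdat, hh.x_eq, hh.tot_eq, hr, e, h3, h4]
    exact ⟨h1, hp, h1, ht, h2, hh.of_eq (by simp) (by simp), h.end_new hi h4 (by simp [h3])⟩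
  · by_cases h5 : s.arr 8 (c.last i) = c.tot
    · simp [markEnd, wp, Expr.eval, Op.eval, hh.poff, hh.pdat, hh.x_eq, hh.tot_eq, hr, e, h3, h4,
        h5]
      exact ⟨h1, hp, h2, hh.of_eq (by simp) (by simp), h.end_old hc hi h4 (by simp [h3])⟩
    · simp [markEnd, wp, Expr.eval, Op.eval, hh.poff, hh.pdat, hh.x_eq, hh.tot_eq, hr, e, h3, h4,
        h5]
      exact ⟨h1, hp, h1, h2, hh.of_eq (by simp) (by simp), h.end_old hc hi h4 (by simp [h5])⟩

theorem markMid_spec (hkN : c.k ≤ N) (htN : c.tot + 1 ≤ N) (hh : HoldsPaths c s) (hi : i < c.k)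
    (hr : s.reg 8 = i) (h9 : c.poff i < s.reg 9) (h9' : s.reg 9 ≤ c.poff (i + 1))
    (h : MarkInv c c.k (s.reg 9) (s.reg 7) (s.arr 7) (s.arr 8)) :
    Tri 10 N markMid (markMid.time 0) s fun s' => HoldsPaths c s' ∧ s.reg 9 + 1 ≤ s'.reg 9 ∧
      ((s'.reg 8 = i ∧ s'.reg 9 ≤ c.poff (i + 1)) ∨
        (s'.reg 8 = i + 1 ∧ s'.reg 9 = c.poff (i + 1) + 1)) ∧
      MarkInv c c.k (s'.reg 9) (s'.reg 7) (s'.arr 7) (s'.arr 8) := by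
  refine Tri.of_wp hN (by decide) hs ?_
  have hp : c.pdat (s.reg 9) ≤ N := hh.pdat ▸ hs.2 3 _
  have h1 : 1 ≤ N := by omega
  have h2 : i + 1 ≤ N := by omega
  have h3 := hc.poff_mono (i := i + 1) (j := c.k) hi le_rfl
  rw [hc.poff_last] at h3
  have h10 : s.reg 9 + 1 ≤ N := by omega
  by_cases h4 : s.reg 9 + 1 < c.poff (i + 1)
  · have hm : c.Mid i (s.reg 9) := ⟨h9, h4⟩
    by_cases h5 : s.arr 7 (c.pdat (s.reg 9)) = 0
    · simp [markMid, wp, Expr.eval, Op.eval, hh.poff, hh.pdat, hr, h4, h5]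
      exact ⟨hp, h2, hs.1 9, h10, hh.of_eq (by simp) (by simp), h4.le, h.mid_new hc hi hm h5⟩
    · simp [markMid, wp, Expr.eval, Op.eval, hh.poff, hh.pdat, hr, h4, h5]
      exact ⟨hp, h1, h10, hh.of_eq (by simp) (by simp), h4.le, h.mid_old hi hm h5⟩
  · simp [markMid, wp, Expr.eval, Op.eval, hh.poff, hh.pdat, hr, h4]
    exact ⟨h2, by omega, hh.of_eq (by simp) (by simp), h9', h.skip hc hi (by omega) h9'⟩

theorem markPaths_spec (hkN : c.k ≤ N) (htN : c.tot + 1 ≤ N) (hh : HoldsPaths c s)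
    (h7 : s.reg 7 = 0) (h7' : ∀ v, s.arr 7 v = 0) (h8' : s.arr 8 c.x = 0) :
    Tri 10 N markPaths (c.k * 50 + c.tot * 40 + 20) s fun s' =>
      MarkInv c c.k (c.tot + 1) (s'.reg 7) (s'.arr 7) (s'.arr 8) := by
  have h1 : Tri 10 N (store 7 (reg 2) (const 1)) 3 s fun s' => HoldsPaths c s' ∧
      MarkInv c 0 0 (s'.reg 7) (s'.arr 7) (s'.arr 8) := by
    refine Tri.of_wp (τ := 0) hN (by decide) hs ?_
    simp [wp, Expr.eval, hh.x_eq, h7]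
    refine ⟨by omega, hh.of_eq (by simp) (by simp), ⟨by simp, h8'⟩, fun v => ?_, by simp, by simp,
      by simp⟩
    by_cases e : v = c.x
    · exact .inr (.inl e)
    · exact .inl (by simp [e, h7'])
  have h2 : ∀ i s, s.Bdd N → HoldsPaths c s → MarkInv c i 0 (s.reg 7) (s.arr 7) (s.arr 8) →
      Tri 10 N (assign 8 (const 0)) 2 s fun s' => HoldsPaths c s' ∧ s'.reg 8 = 0 ∧
        MarkInv c i 0 (s'.reg 7) (s'.arr 7) (s'.arr 8) := fun i s hs h2 h3 => by
    refine Tri.of_wp (τ := 0) hN (by decide) hs ?_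
    simp [wp, Expr.eval]
    exact ⟨h2.of_eq (by simp) (by simp), h3⟩
  have h3 : ∀ s, s.Bdd N → HoldsPaths c s → s.reg 8 = 0 →
      MarkInv c 0 0 (s.reg 7) (s.arr 7) (s.arr 8) →
      Tri 10 N (loop ((reg 8).lt (reg 1)) markEnd) (c.k * 50 + 4) s fun s' => HoldsPaths c s' ∧
        MarkInv c c.k 0 (s'.reg 7) (s'.arr 7) (s'.arr 8) := fun s hs h2 h3 h4 => by
    refine (Tri.loop (D := 10) (N := N) (T := 46) hN (by decide)
      (fun m s' => ∃ i, i + m = c.k ∧ HoldsPaths c s' ∧ s'.reg 8 = i ∧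
        MarkInv c i 0 (s'.reg 7) (s'.arr 7) (s'.arr 8))
      (fun m s' hb ⟨i, hm, h5, h6, h7⟩ he => ?_) (fun m s' hb ⟨i, hm, h5, h6, h7⟩ he => ?_)
      c.k s hs ⟨0, by omega, h2, h3, h4⟩).mono le_rfl fun _ _ h => h
    · have hi : i < c.k := by simpa [Expr.eval, Op.eval, h6, h5.k_eq] using he
      exact ⟨m - 1, by omega, (markEnd_spec hc hN hb hkN h5 hi h6 h7).mono (by decide)
        fun s'' _ h => ⟨i + 1, by omega, h⟩⟩
    · have hi : ¬ i < c.k := by simpa [Expr.eval, Op.eval, h6, h5.k_eq] using he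
      obtain rfl : i = c.k := by omega
      exact ⟨h5, h7⟩
  have h4 : ∀ s, s.Bdd N → HoldsPaths c s → s.reg 8 = 0 →
      MarkInv c c.k 0 (s.reg 7) (s.arr 7) (s.arr 8) →
      Tri 10 N (assign 9 (const 1)) 2 s fun s' => HoldsPaths c s' ∧ s'.reg 8 = 0 ∧ s'.reg 9 = 1 ∧
        MarkInv c c.k 1 (s'.reg 7) (s'.arr 7) (s'.arr 8) := fun s hs h2 h8 h3 => by
    refine Tri.of_wp (τ := 0) hN (by decide) hs ?_
    simp [wp, Expr.eval, h8]
    refine ⟨by omega, h2.of_eq (by simp) (by simp), h3.mark_x, fun v => ?_, h3.ends,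
      fun h4 l hl h h5 h6 => h3.mids h4 l hl h h5 ?_, h3.good⟩
    · rcases h3.cases v with h1 | h1 | ⟨l, hl, g', h1, h2, h3⟩ | h1
      · exact .inl h1
      · exact .inr (.inl h1)
      · omega
      · exact .inr (.inr (.inr h1))
    · have := h5.1
      omega
  have h5 : ∀ s, s.Bdd N → HoldsPaths c s → s.reg 8 = 0 → s.reg 9 = 1 →
      MarkInv c c.k 1 (s.reg 7) (s.arr 7) (s.arr 8) →
      Tri 10 N (loop ((reg 8).lt (reg 1)) markMid) (c.tot * 40 + 4) s fun s' =>
        MarkInv c c.k (c.tot + 1) (s'.reg 7) (s'.arr 7) (s'.arr 8) := fun s hs h2 h3 h4 h5 => by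
    have h6 := hc.poff_lt 0 hc.k_pos
    have h7 := hc.poff_zero
    refine (Tri.loop (D := 10) (N := N) (T := 36) hN (by decide)
      (fun m s' => ∃ i, HoldsPaths c s' ∧ s'.reg 8 = i ∧ c.tot + 1 ≤ s'.reg 9 + m ∧
        ((i < c.k ∧ c.poff i < s'.reg 9 ∧ s'.reg 9 ≤ c.poff (i + 1)) ∨
          i = c.k ∧ s'.reg 9 = c.tot + 1) ∧
        MarkInv c c.k (s'.reg 9) (s'.reg 7) (s'.arr 7) (s'.arr 8))
      (fun m s' hb ⟨i, h5, h6, hm, hi, h7⟩ he => ?_) (fun m s' hb ⟨i, h5, h6, hm, hi, h7⟩ he => ?_)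
      c.tot s hs ⟨0, h2, h3, by omega, .inl ⟨hc.k_pos, by omega, by omega⟩, h4 ▸ h5⟩).mono le_rfl
      fun _ _ h => h
    · have hi' : i < c.k := by simpa [Expr.eval, Op.eval, h6, h5.k_eq] using he
      obtain ⟨-, h8, h9⟩ := hi.resolve_right fun h => by omega
      have h10 := hc.poff_mono (i := i + 1) (j := c.k) hi' le_rfl
      rw [hc.poff_last] at h10
      refine ⟨m - 1, by omega, (markMid_spec hc hN hb hkN htN h5 hi' h6 h8 h9 h7).mono (by decide)
        fun s'' _ ⟨h, h11, h12, h13⟩ => ?_⟩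
      rcases h12 with ⟨h12, h14⟩ | ⟨h12, h14⟩
      · exact ⟨i, h, h12, by omega, .inl ⟨hi', by omega, h14⟩, h13⟩
      · refine ⟨i + 1, h, h12, by omega, ?_, h13⟩
        by_cases h15 : i + 1 < c.k
        · have := hc.poff_lt (i + 1) h15
          exact .inl ⟨h15, by omega, by omega⟩
        · obtain h16 : i + 1 = c.k := by omega
          exact .inr ⟨h16, by rw [h14, h16, hc.poff_last]⟩
    · have hi' : ¬ i < c.k := by simpa [Expr.eval, Op.eval, h6, h5.k_eq] using he
      obtain ⟨-, h8⟩ := hi.resolve_left fun h => hi' h.1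
      exact h8 ▸ h7
  exact (h1.seq fun s₁ b₁ q₁ => (h2 0 s₁ b₁ q₁.1 q₁.2).seq fun s₂ b₂ q₂ =>
    (h3 s₂ b₂ q₂.1 q₂.2.1 q₂.2.2).seq fun s₃ b₃ q₃ => (h2 c.k s₃ b₃ q₃.1 q₃.2).seq fun s₄ b₄ q₄ =>
    (h4 s₄ b₄ q₄.1 q₄.2.1 q₄.2.2).seq fun s₅ b₅ q₅ =>
    h5 s₅ b₅ q₅.1 q₅.2.1 q₅.2.2.1 q₅.2.2.2).mono (by omega) fun _ _ h => h

end

end Shredder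

/-! ### Checking the candidates -/

namespace Shredder

open WordRAM Expr Prog

/-- Clear register `16` unless the row of position `reg 12` is bounded by the current candidate. -/
def checkRow : Prog :=
  loop ((reg 22).lt (reg 1))
    (ite ((cell 12 ((reg 13).add (reg 22))).lt (cell 11 (((reg 12).mul (reg 1)).add (reg 22))))
        (assign 16 (const 0)) skip ;;
      assign 22 ((reg 22).add (const 1)))

/-- Check the position of the current candidate on path `reg 11`, and write the vertex there. -/
def checkPos : Prog :=
  assign 12 (cell 12 ((reg 13).add (reg 11))) ;;
  ite ((cell 14 (reg 11)).lt (reg 12)) (assign 16 (const 0)) skip ;;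
  store 5 ((reg 14).add (reg 11)) (cell 3 (reg 12)) ;;
  assign 22 (const 0) ;;
  checkRow ;;
  assign 11 ((reg 11).add (const 1))

/-- Check candidate `reg 8`, and keep what has been written if it passes. -/
def checkCand : Prog :=
  assign 13 ((cell 13 (reg 8)).mul (reg 1)) ;;
  assign 14 ((reg 5).mul (reg 1)) ;;
  assign 16 (const 1) ;;
  assign 11 (const 0) ;;
  loop ((reg 11).lt (reg 1)) checkPos ;;
  ite (reg 16) (assign 5 ((reg 5).add (const 1)) ;; store 4 (reg 5) ((reg 5).mul (reg 1))) skip ;;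
  assign 8 ((reg 8).add (const 1))

/-- List the candidates that pass the check, and finish the output. -/
def checkCands : Prog :=
  assign 8 (const 0) ;;
  loop ((reg 8).lt (reg 20)) checkCand ;;
  assign 6 (reg 1)

/-- The results of the exploration. -/
structure Table where
  (k ncand : ℕ)
  (M att cand T pdat : ℕ → ℕ)

/-- The position on path `j` of candidate number `t`. -/
def Table.pos (r : Table) (t j : ℕ) : ℕ := r.att (r.cand t * r.k + j)

/-- Candidate `t` passes the check at its position on path `i`. -/
def Table.PosOK (r : Table) (t i : ℕ) : Prop :=
  r.pos t i ≤ r.T i ∧ ∀ j < r.k, r.M (r.pos t i * r.k + j) ≤ r.pos t j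

/-- The state `s` holds the results `r`. -/
structure HoldsTable (r : Table) (s : State) : Prop where
  k_eq : s.reg 1 = r.k
  ncand : s.reg 20 = r.ncand
  M : s.arr 11 = r.M
  att : s.arr 12 = r.att
  cand : s.arr 13 = r.cand
  T : s.arr 14 = r.T
  pdat : s.arr 3 = r.pdat

theorem HoldsTable.of_eq {r : Table} {s s' : State} (h : HoldsTable r s)
    (hr : ∀ r ∈ [1, 20], s'.reg r = s.reg r)
    (ha : ∀ a ∈ [3, 11, 12, 13, 14], s'.arr a = s.arr a) : HoldsTable r s' where
  k_eq := (hr 1 (by decide)).trans h.k_eq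
  ncand := (hr 20 (by decide)).trans h.ncand
  M := (ha 11 (by decide)).trans h.M
  att := (ha 12 (by decide)).trans h.att
  cand := (ha 13 (by decide)).trans h.cand
  T := (ha 14 (by decide)).trans h.T
  pdat := (ha 3 (by decide)).trans h.pdat

section

variable {r : Table} {N t : ℕ} {s : State} (hN : 2 ≤ N) (hkN : r.k ≤ N) (hs : s.Bdd N)
  (h : HoldsTable r s) (h13 : s.reg 13 = r.cand t * r.k)
include hN hkN hs h h13

theorem checkRow_spec {i : ℕ} (h12 : s.reg 12 = r.pos t i) (h22 : s.reg 22 = 0) :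
    Tri 10 N checkRow (r.k * 30 + 4) s fun s' => s'.reg 16 ≠ 0 ↔
      s.reg 16 ≠ 0 ∧ ∀ j < r.k, r.M (r.pos t i * r.k + j) ≤ r.pos t j := by
  refine (Tri.loop (D := 10) (N := N) (T := 26) hN (by decide)
    (fun m s' => ∃ l, l + m = r.k ∧ HoldsTable r s' ∧ s'.reg 13 = r.cand t * r.k ∧
      s'.reg 12 = r.pos t i ∧ s'.reg 22 = l ∧ (s'.reg 16 ≠ 0 ↔
      s.reg 16 ≠ 0 ∧ ∀ j < l, r.M (r.pos t i * r.k + j) ≤ r.pos t j))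
    (fun m s' hb ⟨l, hm, h1, h2, h3, h4, h5⟩ he => ?_)
    (fun m s' hb ⟨l, hm, h1, h2, h3, h4, h5⟩ he => ?_)
    r.k s hs ⟨0, by omega, h, h13, h12, h22, by simp⟩).mono le_rfl fun _ _ h => h
  · have hl : l < r.k := by simpa [Expr.eval, Op.eval, h4, h1.k_eq] using he
    refine ⟨m - 1, by omega, (Tri.of_wp hN (τ := 0) (by decide) hb ?_).mono (by decide)
      fun _ _ h => h⟩
    have hlN : l < N := by omega
    by_cases h6 : r.att (r.cand t * r.k + l) < r.M (r.pos t i * r.k + l)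
    · simp [wp, Expr.eval, Op.eval, h1.k_eq, h1.M, h1.att, h2, h3, h4, h6]
      exact ⟨hlN, by omega, h1.of_eq (by simp) (by simp), fun _ => ⟨l, le_rfl, h6⟩⟩
    · simp [wp, Expr.eval, Op.eval, h1.k_eq, h1.M, h1.att, h2, h3, h4, h6]
      refine ⟨hlN, by omega, h1.of_eq (by simp) (by simp), ?_⟩
      rw [← ne_eq, h5]
      refine and_congr_right fun _ => ⟨fun h7 j hj => ?_, fun h7 j hj => h7 j (by omega)⟩
      rcases hj.lt_or_eq with hj | rfl
      · exact h7 j hj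
      · exact not_lt.mp h6
  · have hl : ¬ l < r.k := by simpa [Expr.eval, Op.eval, h4, h1.k_eq] using he
    obtain rfl : l = r.k := by omega
    exact h5

theorem checkPos_spec {i base : ℕ} (hi : i < r.k) (h11 : s.reg 11 = i) (h14 : s.reg 14 = base) :
    Tri 10 N checkPos (r.k * 30 + 40) s fun s' => HoldsTable r s' ∧
      s'.reg 13 = r.cand t * r.k ∧ s'.reg 14 = base ∧ s'.reg 11 = i + 1 ∧
      (s'.reg 16 ≠ 0 ↔ s.reg 16 ≠ 0 ∧ r.PosOK t i) ∧
      s'.arr 5 = Function.update (s.arr 5) (base + i) (r.pdat (r.pos t i)) := by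
  refine (Tri.of_wp (τ := r.k * 30 + 4) hN (by decide) hs ?_).mono (by
    simp only [checkPos, checkRow, Prog.time, Expr.cost]; omega) fun _ _ h => h
  have e : r.att (r.cand t * r.k + i) = r.pos t i := rfl
  have hpN : r.pos t i ≤ N := e ▸ h.att ▸ hs.2 12 _
  have hpd : r.pdat (r.pos t i) ≤ N := h.pdat ▸ hs.2 3 _
  have hiN : i + 1 ≤ N := by omega
  have key : ∀ s₁ : State, s₁.Bdd N → HoldsTable r s₁ → s₁.reg 13 = r.cand t * r.k →
      s₁.reg 12 = r.pos t i → s₁.reg 22 = 0 → s₁.reg 11 = i → s₁.reg 14 = base →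
      s₁.arr 5 = Function.update (s.arr 5) (base + i) (r.pdat (r.pos t i)) →
      (s₁.reg 16 ≠ 0 ↔ s.reg 16 ≠ 0 ∧ r.pos t i ≤ r.T i) →
      Tri 10 N checkRow (r.k * 30 + 4) s₁ fun s' => s'.reg 11 + 1 ≤ N ∧
        HoldsTable r (s'.setReg 11 (s'.reg 11 + 1)) ∧ s'.reg 13 = r.cand t * r.k ∧
        s'.reg 14 = base ∧ s'.reg 11 = i ∧ (s'.reg 16 ≠ 0 ↔ s.reg 16 ≠ 0 ∧ r.PosOK t i) ∧
        s'.arr 5 = Function.update (s.arr 5) (base + i) (r.pdat (r.pos t i)) := by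
    intro s₁ hb h1 h2 h3 h4 h5 h6 h7 h8
    refine (checkRow_spec hN hkN hb h1 h2 h3 h4).frame.mono le_rfl fun s' _ ⟨h9, h10, h11⟩ => ?_
    have e1 : ∀ r, r ≠ 16 → r ≠ 22 → s'.reg r = s₁.reg r :=
      fun r h1 h2 => h10 r (by simp [checkRow, Prog.regs, h1, h2])
    have e2 : ∀ a, s'.arr a = s₁.arr a := fun a => h11 a (by simp [checkRow, Prog.arrs])
    refine ⟨by rw [e1 11 (by decide) (by decide), h5]; exact hiN,
      h1.of_eq (by simp [e1]) (by simp [e2]), by simp [e1, h2], by simp [e1, h6],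
      by simp [e1, h5], ?_, by rw [e2, h7]⟩
    rw [h9, h8, Table.PosOK, and_assoc]
  by_cases h6 : r.T i < r.pos t i
  · simp [checkPos, checkRow, wp, Expr.eval, Op.eval, h.att, h.T, h.pdat, h13, h11, h14, e,
      h6]
    refine ⟨hpN, hpd, fun hb => (key _ hb (h.of_eq (by simp) (by simp)) (by simp [h13]) (by simp)
      (by simp) (by simp [h11]) (by simp [h14]) (by simp) (by simp [h6])).mono le_rfl
      fun s' _ h => ?_⟩
    simpa using h
  · simp [checkPos, checkRow, wp, Expr.eval, Op.eval, h.att, h.T, h.pdat, h13, h11, h14, e,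
      h6]
    refine ⟨hpN, hpd, fun hb => (key _ hb (h.of_eq (by simp) (by simp)) (by simp [h13]) (by simp)
      (by simp) (by simp [h11]) (by simp [h14]) (by simp) (by simp [not_lt.mp h6])).mono le_rfl
      fun s' _ h => ?_⟩
    simpa using h

/-- The check of a candidate at all its positions. Its vertices are written into array `5` behind
the sets listed so far, where they are overwritten if the check fails. -/
theorem checkPoss_spec {base : ℕ} (h11 : s.reg 11 = 0) (h14 : s.reg 14 = base)
    (h16 : s.reg 16 = 1) :
    Tri 10 N (loop ((reg 11).lt (reg 1)) checkPos) (r.k * (r.k * 30 + 44) + 4) s fun s' =>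
      (s'.reg 16 ≠ 0 ↔ ∀ i < r.k, r.PosOK t i) ∧
      (∀ j < r.k, s'.arr 5 (base + j) = r.pdat (r.pos t j)) ∧
      ∀ z < base, s'.arr 5 z = s.arr 5 z := by
  refine (Tri.loop (D := 10) (N := N) (T := r.k * 30 + 40) hN (by decide)
    (fun m s' => ∃ l, l + m = r.k ∧ HoldsTable r s' ∧ s'.reg 13 = r.cand t * r.k ∧
      s'.reg 14 = base ∧ s'.reg 11 = l ∧ (s'.reg 16 ≠ 0 ↔ ∀ i < l, r.PosOK t i) ∧
      (∀ j < l, s'.arr 5 (base + j) = r.pdat (r.pos t j)) ∧ ∀ z < base, s'.arr 5 z = s.arr 5 z)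
    (fun m s' hb ⟨l, hm, h1, h2, h3, h4, h5, h6, h7⟩ he => ?_)
    (fun m s' hb ⟨l, hm, h1, h2, h3, h4, h5, h6, h7⟩ he => ?_)
    r.k s hs ⟨0, by omega, h, h13, h14, h11, by simp [h16], by simp, by simp⟩).mono le_rfl
      fun _ _ h => h
  · have hl : l < r.k := by simpa [Expr.eval, Op.eval, h4, h1.k_eq] using he
    refine ⟨m - 1, by omega, (checkPos_spec hN hkN hb h1 h2 hl h4 h3).mono (by omega)
      fun s₁ _ ⟨g1, g2, g3, g4, g5, g6⟩ => ⟨l + 1, by omega, g1, g2, g3, g4, ?_, ?_, ?_⟩⟩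
    · rw [g5, h5]
      refine ⟨fun ⟨h8, h9⟩ i hi => ?_, fun h8 => ⟨fun i hi => h8 i (by omega), h8 l (by omega)⟩⟩
      rcases Nat.lt_succ_iff_lt_or_eq.mp hi with hi | rfl
      · exact h8 i hi
      · exact h9
    · intro j hj
      rw [g6]
      rcases Nat.lt_succ_iff_lt_or_eq.mp hj with hj | rfl
      · rw [Function.update_of_ne (by omega), h6 j hj]
      · simp
    · intro z hz
      rw [g6, Function.update_of_ne (by omega), h7 z hz]
  · have hl : ¬ l < r.k := by simpa [Expr.eval, Op.eval, h4, h1.k_eq] using he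
    obtain rfl : l = r.k := by omega
    exact ⟨h5, h6, h7⟩

end

/-- The first `t` candidates have been checked; the list `l` consists of those that have passed. -/
structure CheckInv (r : Table) (t : ℕ) (l : List ℕ) (s : State) : Prop where
  holds : HoldsTable r s
  next : s.reg 8 = t
  length_le : l.length ≤ t
  length_eq : s.reg 5 = l.length
  mem : ∀ t', t' ∈ l ↔ t' < t ∧ ∀ i < r.k, r.PosOK t' i
  off : ∀ m ≤ l.length, s.arr 4 m = m * r.k
  dat : ∀ m (hm : m < l.length), ∀ j < r.k, s.arr 5 (m * r.k + j) = r.pdat (r.pos l[m] j)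

section

variable {r : Table} {N t : ℕ} {s : State} (hN : 2 ≤ N) (hkN : r.k ≤ N)
  (hcN : ∀ t < r.ncand, r.cand t * r.k ≤ N) (hnN : r.ncand * r.k ≤ N) (hnN' : r.ncand ≤ N)
  (hs : s.Bdd N)
include hN hkN hcN hnN hnN' hs

theorem checkCand_spec {l : List ℕ} (ht : t < r.ncand) (h : CheckInv r t l s) :
    Tri 10 N checkCand (r.k * (r.k * 30 + 44) + 44) s fun s' => ∃ l, CheckInv r (t + 1) l s' := by
  refine (Tri.of_wp (τ := r.k * (r.k * 30 + 44) + 4) hN (by decide) hs ?_).mono (by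
    simp only [checkCand, Prog.time, Expr.cost]; omega) fun _ _ h => h
  obtain ⟨hh, h8, hlt, h5, hmem, hoff, hdat⟩ := h
  have h1 := hcN t ht
  have h2 : l.length * r.k ≤ N := le_trans (Nat.mul_le_mul_right _ (by omega)) hnN
  have h3 : (l.length + 1) * r.k ≤ N := le_trans (Nat.mul_le_mul_right _ (by omega)) hnN
  simp [checkCand, wp, Expr.eval, Op.eval, hh.k_eq, hh.cand, h8, h5]
  refine ⟨h1, h2, by omega, fun hb => (checkPoss_spec (base := l.length * r.k) hN hkN hb
    (hh.of_eq (by simp) (by simp)) (t := t) (by simp) (by simp) (by simp) (by simp)).frame.mono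
    le_rfl fun s' _ ⟨⟨g1, g2, g3⟩, g4, g5⟩ => ?_⟩
  have e1 : ∀ r, r ∉ [11, 12, 16, 22] → s'.reg r = _ := fun r hr =>
    g4 r (by simp [Prog.regs, checkPos, checkRow] at hr ⊢; omega)
  have e2 : ∀ a, a ≠ 5 → s'.arr a = _ := fun a ha =>
    g5 a (by simpa [Prog.arrs, checkPos, checkRow] using ha)
  simp at g3
  have e5 : s'.reg 5 = l.length := by simp [e1, h5]
  have e8 : s'.reg 8 = t := by simp [e1, h8]
  have ek : s'.reg 1 = r.k := by simp [e1, hh.k_eq]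
  have hdat' : ∀ m (hm : m < l.length), ∀ j < r.k,
      s'.arr 5 (m * r.k + j) = r.pdat (r.pos l[m] j) := fun m hm j hj => by
    have : (m + 1) * r.k ≤ l.length * r.k := Nat.mul_le_mul_right _ hm
    rw [add_mul, one_mul] at this
    rw [g3 _ (by omega), hdat m hm j hj]
  refine ⟨fun h0 => ?_, fun h0 => ?_⟩
  · have hok := g1.mp h0
    simp only [e5, e8, ek]
    refine ⟨by omega, h3, by omega, l ++ [t], hh.of_eq (by simp [e1]) (by simp [e2]), by simp,
      by simpa using hlt, by simp, fun t' => ?_, fun m hm => ?_, fun m hm j hj => ?_⟩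
    · simp only [List.mem_append, hmem, List.mem_singleton]
      constructor
      · rintro (h | rfl)
        · exact ⟨by omega, h.2⟩
        · exact ⟨by omega, hok⟩
      · rintro ⟨h4, h6⟩
        by_cases e : t' = t
        · exact .inr e
        · exact .inl ⟨by omega, h6⟩
    · simp at hm
      simp [e2, Function.update_apply]
      split_ifs with e
      · rw [e]
      · exact hoff m (by omega)
    · simp at hm
      simp only [State.arr_setReg, State.arr_setCell, reduceIte, Nat.reduceEqDiff]
      by_cases e : m = l.length
      · subst e
        simpa using g2 j hj
      · rw [hdat' m (by omega) j hj, List.getElem_append_left]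
  · have hok := fun h => g1.mpr h h0
    simp only [e8]
    refine ⟨by omega, l, hh.of_eq (by simp [e1]) (by simp [e2]), by simp, by omega, by simp [e5],
      fun t' => ?_, fun m hm => ?_, fun m hm j hj => ?_⟩
    · rw [hmem]
      refine ⟨fun h => ⟨by omega, h.2⟩, fun ⟨h4, h6⟩ => ⟨?_, h6⟩⟩
      rcases Nat.lt_succ_iff_lt_or_eq.mp h4 with h4 | rfl
      · exact h4
      · exact absurd h6 hok
    · simpa [e2] using hoff m hm
    · simpa using hdat' m hm j hj

theorem checkCands_spec (h : HoldsTable r s) (h5 : s.reg 5 = 0) (h4 : s.arr 4 0 = 0) :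
    Tri 10 N checkCands (r.ncand * (r.k * (r.k * 30 + 44) + 48) + 8) s fun s' => ∃ l : List ℕ,
      (∀ t, t ∈ l ↔ t < r.ncand ∧ ∀ i < r.k, r.PosOK t i) ∧
      readLists (s'.reg 5) (s'.arr 4) (s'.arr 5) =
        l.map (fun t => (List.range r.k).map fun j => r.pdat (r.pos t j)) ∧ s'.reg 6 = r.k := by
  have h1 : Tri 10 N (assign 8 (const 0)) 2 s (CheckInv r 0 []) := by
    refine Tri.of_wp (τ := 0) hN (by decide) hs ?_
    simp [wp, Expr.eval]
    exact ⟨h.of_eq (by simp) (by simp), by simp, by simp, by simp [h5], by simp,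
      by simp [h4], by simp⟩
  have h2 : ∀ s, s.Bdd N → CheckInv r 0 [] s → Tri 10 N (loop ((reg 8).lt (reg 20)) checkCand)
      (r.ncand * (r.k * (r.k * 30 + 44) + 48) + 4) s
      fun s' => ∃ l, CheckInv r r.ncand l s' := fun s hs h => by
    refine (Tri.loop (D := 10) (N := N) (T := r.k * (r.k * 30 + 44) + 44) hN (by decide)
      (fun m s' => ∃ t, t + m = r.ncand ∧ ∃ l, CheckInv r t l s')
      (fun m s' hb ⟨t, hm, l, h1⟩ he => ?_) (fun m s' hb ⟨t, hm, l, h1⟩ he => ?_)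
      r.ncand s hs ⟨0, by omega, [], h⟩).mono le_rfl fun _ _ h => h
    · have ht : t < r.ncand := by simpa [Expr.eval, Op.eval, h1.next, h1.holds.ncand] using he
      exact ⟨m - 1, by omega, (checkCand_spec hN hkN hcN hnN hnN' hb ht h1).mono le_rfl
        fun s'' _ h => ⟨t + 1, by omega, h⟩⟩
    · have ht : ¬ t < r.ncand := by simpa [Expr.eval, Op.eval, h1.next, h1.holds.ncand] using he
      obtain rfl : t = r.ncand := by omega
      exact ⟨l, h1⟩
  refine (h1.seq fun s₁ b₁ q₁ => (h2 s₁ b₁ q₁).seq fun s₂ b₂ ⟨l, q₂⟩ =>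
    Tri.of_wp (τ := 0) hN (by decide) b₂ ?_).mono (by simp only [Prog.time, Expr.cost]; omega)
    fun _ _ h => h
  simp only [wp, Expr.eval, State.arr_setReg, State.reg_setReg]
  refine ⟨b₂.1 1, l, q₂.mem, ?_, by simp [q₂.holds.k_eq]⟩
  refine List.ext_getElem (by simp [readLists, q₂.length_eq]) fun m hm hm' => ?_
  have hm : m < l.length := by simpa using hm'
  have e : s₂.arr 4 (m + 1) - s₂.arr 4 m = r.k := by
    rw [q₂.off _ hm, q₂.off m hm.le, Nat.succ_mul, Nat.add_sub_cancel_left]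
  simp only [readLists, List.getElem_map, List.getElem_range, e]
  refine List.map_congr_left fun j hj => ?_
  rw [q₂.off m hm.le, q₂.dat m hm j (List.mem_range.mp hj)]

end

end Shredder

/-! ### The algorithm -/

namespace WordRAM

theorem Tri.skip {D N : ℕ} {s : State} {Q : State → Prop} (hs : s.Bdd N) (h : Q s) :
    Tri D N .skip 1 s Q :=
  ⟨1, s, .skip s, le_rfl, hs, h⟩

theorem Tri.ite {D N T : ℕ} {e : Expr} {p q : Prog} {s : State} {Q : State → Prop} (hN : 2 ≤ N)
    (he : e.deg ≤ D) (hs : s.Bdd N) (hp : e.eval s ≠ 0 → Tri D N p T s Q)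
    (hq : e.eval s = 0 → Tri D N q T s Q) : Tri D N (.ite e p q) (e.cost + 1 + T) s Q := by
  have hf := e.fits hN hs he
  by_cases h : e.eval s = 0
  · obtain ⟨t, s', hr, ht, hb, h'⟩ := hq h
    exact ⟨_, s', .ite_false _ _ _ _ _ _ hf h hr, by omega, hb, h'⟩
  · obtain ⟨t, s', hr, ht, hb, h'⟩ := hp h
    exact ⟨_, s', .ite_true _ _ _ _ _ _ hf h hr, by omega, hb, h'⟩

end WordRAM

namespace Shredder

open WordRAM Expr Prog

/-- The algorithm. It ends with empty output if there are not exactly `k` paths, if they are too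
long, or if they are not openly disjoint paths from `x`. -/
def localShredders : Prog :=
  ite ((reg 4).eq (reg 1))
    (assign 10 (cell 2 (reg 1)) ;;
      ite (((((reg 1).mul (reg 1)).mul (reg 3)).add (reg 1)).lt (reg 10)) skip
        (markPaths ;; ite (reg 7) skip (explorePaths ;; checkCands)))
    skip

/-- The table that the exploration leaves behind. -/
def tableOf (c : Input) (s : State) : Table where
  k := c.k
  ncand := s.reg 20
  M := s.arr 11
  att := s.arr 12
  cand := s.arr 13
  T := s.arr 14
  pdat := c.pdat

/-- The state at the start, apart from the number of paths. -/
structure Starts (c : Input) (s : State) : Prop where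
  k_eq : s.reg 1 = c.k
  x_eq : s.reg 2 = c.x
  F_eq : 4 * s.reg 3 + 1 = c.F
  tot_eq : s.arr 2 (s.reg 1) = c.tot
  aoff : s.arr 0 = c.aoff
  adat : s.arr 1 = c.adat
  poff : s.arr 2 = c.poff
  pdat : s.arr 3 = c.pdat
  reg_zero : ∀ r, 5 ≤ r → s.reg r = 0
  arr_zero : ∀ a, 4 ≤ a → ∀ z, s.arr a z = 0

/-- The output, described by the state `s₁` after the exploration. -/
structure Listed (c : Input) (s₁ s : State) : Prop where
  paths : PathsInv c c.k s₁
  list : ∃ l : List ℕ,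
    (∀ t, t ∈ l ↔ t < s₁.reg 20 ∧ ∀ i < c.k, (tableOf c s₁).PosOK t i) ∧
    readLists (s.reg 5) (s.arr 4) (s.arr 5) =
      l.map fun t => (List.range c.k).map fun j => c.pdat ((tableOf c s₁).pos t j)
  length : s.reg 6 = c.k
  last : s.arr 6 = s₁.arr 6

/-- Marking either finds the paths unsuitable, and the output is empty, or makes the input
consistent. -/
def Outcome (c : Input) (s : State) : Prop :=
  (¬ c.Good ∧ s.reg 5 = 0 ∧ s.reg 6 = 0) ∨
    ∃ mP mG s₁, (c.withMarks mP mG).Marked ∧ Listed (c.withMarks mP mG) s₁ s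

theorem explore_check_spec {c : Input} {N : ℕ} {s : State} (hc : c.Marked) (hN : c.Small N)
    (hkN : c.k ≤ N) (hs : s.Bdd N) (hh : Holds c s) (h5 : s.reg 5 = 0) (h16 : s.reg 16 = 0)
    (h20 : s.reg 20 = 0) (h4 : s.arr 4 0 = 0) (h9 : ∀ w, s.arr 9 w = 0)
    (h11 : ∀ z, s.arr 11 z = 0) (h12 : ∀ z, s.arr 12 z = 0) :
    Tri 10 N (explorePaths ;; checkCands) (c.k * (c.F * (c.k * 22 + 120) + 74) + 6 +
      (c.F * (c.k * (c.k * 30 + 44) + 48) + 8)) s fun s' => ∃ s₁, Listed c s₁ s' := by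
  refine (explorePaths_spec hc hN hs hh h16 h20 h9 h11 h12).frame.seq fun s₁ b₁ ⟨q, e1, e2⟩ => ?_
  have hk := hc.k_pos
  have h1 : s₁.reg 20 ≤ c.F := Nat.le_of_mul_le_mul_left q.cand_le hk
  have h2 : (c.F + 1) ≤ c.k * (c.F + 1) := Nat.le_mul_of_pos_left _ hk
  have h3 : c.k * (c.F + 1) + 1 ≤ (c.k * (c.F + 1) + 1) * c.k := Nat.le_mul_of_pos_right _ hk
  have h4' := hN.bridge
  have h5' : ∀ b ≤ c.k * (c.F + 1) + 1, b * c.k ≤ N := fun b hb =>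
    (Nat.mul_le_mul_right _ hb).trans h4'
  have htable : HoldsTable (tableOf c s₁) s₁ :=
    ⟨q.holds.k_eq, rfl, rfl, rfl, rfl, rfl, q.holds.pdat⟩
  refine (checkCands_spec (r := tableOf c s₁) hN.two_le hkN (fun t ht => h5' _ ?_) (h5' _ ?_) ?_ b₁
    htable ((e1 5 (by decide)).trans h5)
    (congrFun (e2 4 (by decide)) 0 |>.trans h4)).frame.mono ?_
    fun s' _ ⟨⟨l, h6, h7, h8⟩, e3, e4⟩ => ⟨s₁, q, ⟨l, h6, h7⟩, h8, e4 6 (by decide)⟩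
  · have h6 : s₁.arr 13 t < s₁.reg 16 := q.cand_lt t ht
    have h7 := q.bid_le
    simp only [tableOf]
    omega
  · simp only [tableOf]
    omega
  · simp only [tableOf]
    omega
  · have := Nat.mul_le_mul_right (c.k * (c.k * 30 + 44) + 48) h1
    simp only [tableOf]
    omega

/-- The number of steps of the algorithm is at most a constant times `k ^ 2 * ν`. -/
theorem time_le {k ν tot : ℕ} (hk : 1 ≤ k) (hν : 1 ≤ ν) (ht : tot ≤ k * k * ν + k) :
    k * 50 + tot * 40 + 20 + (k * ((4 * ν + 1) * (k * 22 + 120) + 74) + 6 +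
      ((4 * ν + 1) * (k * (k * 30 + 44) + 48) + 8)) + 52 ≤ 2000 * (k * k * ν) := by
  have h1 : k ≤ k * k * ν := by nlinarith [Nat.mul_le_mul hk hν]
  have h2 : k * ν ≤ k * k * ν := by nlinarith
  have h3 : k * k ≤ k * k * ν := by nlinarith
  have h4 : ν ≤ k * k * ν := by nlinarith
  have h5 : k * ((4 * ν + 1) * (k * 22 + 120) + 74) =
    88 * (k * k * ν) + 480 * (k * ν) + 22 * (k * k) + 194 * k := by ring
  have h6 : (4 * ν + 1) * (k * (k * 30 + 44) + 48) = 120 * (k * k * ν) + 176 * (k * ν) + 192 * ν +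
    30 * (k * k) + 44 * k + 48 := by ring
  omega

section

variable {c : Input} {N : ℕ} {s : State} (hs : s.Bdd N) (hst : Starts c s)
include hs hst

/-- The algorithm after its two arithmetical tests. -/
theorem markedPart_spec (hN : c.Small N) (hc : c.Raw) (hkN : c.k ≤ N) (htN : c.tot + 1 ≤ N) :
    Tri 10 N (markPaths ;; ite (reg 7) skip (explorePaths ;; checkCands))
      (c.k * 50 + c.tot * 40 + 20 + (2 + (c.k * (c.F * (c.k * 22 + 120) + 74) + 6 +
        (c.F * (c.k * (c.k * 30 + 44) + 48) + 8)))) (s.setReg 10 c.tot) (Outcome c) := by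
  have hs' : (s.setReg 10 c.tot).Bdd N := hs.setReg (by omega)
  refine (markPaths_spec hc hN.two_le hs' hkN htN
    ⟨by simp [hst.k_eq], by simp [hst.x_eq], by simp, by simp [hst.poff], by simp [hst.pdat]⟩
    (by simp [hst.reg_zero]) (by simp [hst.arr_zero]) (by simp [hst.arr_zero])).frame.seq
    fun s₁ b₁ ⟨q, e1, e2⟩ => ?_
  have e1 : ∀ r, r ∉ [7, 8, 9, 11] → s₁.reg r = (s.setReg 10 c.tot).reg r := fun r hr =>
    e1 r (by simp [markPaths, markEnd, markMid, Prog.regs] at hr ⊢; omega)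
  have e2 : ∀ a, a ∉ [7, 8] → s₁.arr a = s.arr a := fun a ha =>
    e2 a (by simp [markPaths, markEnd, markMid, Prog.arrs] at ha ⊢; omega)
  refine Tri.ite hN.two_le (by decide) b₁ (fun h => ?_) (fun h => ?_)
  · refine (Tri.skip b₁ (.inl ⟨fun hg => h (q.good hg), ?_, ?_⟩)).mono (by omega) fun _ _ h => h
    · simp [e1, hst.reg_zero]
    · simp [e1, hst.reg_zero]
  · have h7 : s₁.reg 7 = 0 := h
    rw [h7] at q
    refine (explore_check_spec (c := c.withMarks (s₁.arr 7) (s₁.arr 8)) (q.marked hc)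
      ⟨hN.two_le, hN.bridge, hN.row⟩ hkN b₁ ?_ ?_ ?_ ?_ ?_ ?_ ?_ ?_).mono le_rfl
      fun s₂ _ ⟨s₃, h⟩ => .inr ⟨_, _, s₃, q.marked hc, h⟩
    · constructor <;> simp [e1, e2, hst.k_eq, hst.F_eq, hst.aoff, hst.adat, hst.poff, hst.pdat]
    all_goals simp [e1, e2, hst.reg_zero, hst.arr_zero]

/-- The two arithmetical tests: either the number or the total length of the paths is wrong, and the
output remains empty, or the main part of the algorithm is executed. -/
theorem localShredders_reject_or (hN : 2 ≤ N) (htN : c.tot ≤ N) {T : ℕ}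
    {Q : State → Prop} (hT : 10 ≤ T) (hQ : s.reg 4 ≠ c.k ∨ c.k * c.k * s.reg 3 + c.k < c.tot →
      ∀ s' : State, s'.reg 5 = 0 → s'.reg 6 = 0 → Q s')
    (h : s.reg 4 = c.k → c.tot ≤ c.k * c.k * s.reg 3 + c.k →
      Tri 10 N (markPaths ;; ite (reg 7) skip (explorePaths ;; checkCands)) T
        (s.setReg 10 c.tot) Q) :
    Tri 10 N localShredders (T + 50) s Q := by
  refine (Tri.ite (T := T + 30) hN (by decide) hs (fun h1 => ?_) (fun h1 => ?_)).mono
    (by simp only [Expr.cost]; omega) fun _ _ h => h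
  · have h4 : s.reg 4 = c.k := by simpa [Expr.eval, Op.eval, hst.k_eq] using h1
    have h2 : Tri 10 N (assign 10 (cell 2 (reg 1))) 3 s fun s' => s' = s.setReg 10 c.tot := by
      refine Tri.of_wp (τ := 0) hN (by decide) hs ?_
      simp [wp, Expr.eval, hst.tot_eq, htN]
    refine (h2.seq (U := 11 + T) fun s' b' e => ?_).mono (by omega) fun _ _ h => h
    subst e
    refine (Tri.ite (T := T) hN (by decide) b' (fun h5 => ?_) (fun h5 => ?_)).mono
      (by simp only [Expr.cost]; omega) fun _ _ h => h
    · have h6 : c.k * c.k * s.reg 3 + c.k < c.tot := by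
        simpa [Expr.eval, Op.eval, hst.k_eq] using h5
      exact (Tri.skip b' (hQ (.inr h6) _ (by simp [hst.reg_zero]) (by simp [hst.reg_zero]))).mono
        (by omega) fun _ _ h => h
    · exact h h4 (by simpa [Expr.eval, Op.eval, hst.k_eq] using h5)
  · have h4 : s.reg 4 ≠ c.k := by simpa [Expr.eval, Op.eval, hst.k_eq] using h1
    exact (Tri.skip hs (hQ (.inl h4) _ (by simp [hst.reg_zero]) (by simp [hst.reg_zero]))).mono
      (by omega) fun _ _ h => h

/-- The specification of the algorithm. -/
theorem localShredders_spec (hN : c.Small N) (h3 : 1 ≤ s.reg 3) (hk : 1 ≤ c.k)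
    (hc : s.reg 4 = c.k → c.Raw) :
    Tri 10 N localShredders (2000 * (c.k * c.k * s.reg 3)) s fun s' =>
      ((s.reg 4 ≠ c.k ∨ c.k * c.k * s.reg 3 + c.k < c.tot) ∧ s'.reg 5 = 0 ∧ s'.reg 6 = 0) ∨
        s.reg 4 = c.k ∧ Outcome c s' := by
  have hkN : c.k ≤ N := hst.k_eq ▸ hs.1 1
  have htN : c.tot + 1 ≤ N := (Nat.le_mul_of_pos_right _ hk).trans hN.row
  have h0 : 1 ≤ c.k * c.k * s.reg 3 := Nat.mul_pos (Nat.mul_pos hk hk) h3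
  refine (localShredders_reject_or (T := 2000 * (c.k * c.k * s.reg 3) - 50) hs hst hN.two_le
    (by omega) (by omega) (fun h s' h5 h6 => .inl ⟨h, h5, h6⟩) fun h4 htot => ?_).mono (by omega)
    fun _ _ h => h
  have htime := time_le (k := c.k) (ν := s.reg 3) hk h3 htot
  rw [hst.F_eq] at htime
  exact (markedPart_spec hs hst hN (hc h4) hkN htN).mono (by omega) fun s' _ h => .inr ⟨h4, h⟩

end

end Shredder

/-! ### The input in memory -/

namespace WordRAM

theorem offsets_succ {l : List (List ℕ)} {i : ℕ} (h : i < l.length) :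
    offsets l (i + 1) = offsets l i + l[i].length := by
  rw [offsets, offsets, if_pos h.le, if_pos (Nat.succ_le_of_lt h),
    List.take_succ_eq_append_getElem h, List.flatten_append, List.length_append]
  simp

theorem contents_offsets {l : List (List ℕ)} {i p : ℕ} (h : i < l.length) (hp : p < l[i].length) :
    contents l (offsets l i + p) = l[i][p] := by
  have h1 : l.flatten = (l.take i).flatten ++ (l[i] ++ (l.drop (i + 1)).flatten) := by
    have h0 : l = l.take i ++ l[i] :: l.drop (i + 1) := by
      rw [← List.drop_eq_getElem_cons h, List.take_append_drop]
    simpa only [List.flatten_append, List.flatten_cons] using congrArg List.flatten h0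
  rw [contents, h1, offsets, if_pos h.le, List.getD_eq_getElem?_getD,
    List.getElem?_append_right (Nat.le_add_right _ _), Nat.add_sub_cancel_left,
    List.getElem?_append_left hp]
  simp [hp]

theorem offsets_le {l : List (List ℕ)} (i : ℕ) : offsets l i ≤ l.flatten.length := by
  unfold offsets
  split_ifs
  · exact (List.Sublist.flatten (List.take_sublist i l)).length_le
  · exact Nat.zero_le _

theorem flatten_length_le {l : List (List ℕ)} {m : ℕ} (h : ∀ a ∈ l, a.length ≤ m) :
    l.flatten.length ≤ l.length * m := by
  rw [List.length_flatten, ← smul_eq_mul, ← List.length_map (as := l) List.length]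
  exact List.sum_le_card_nsmul _ _ (by simpa using h)

theorem contents_le {l : List (List ℕ)} {m : ℕ} (h : ∀ a ∈ l, ∀ v ∈ a, v ≤ m) (i : ℕ) :
    contents l i ≤ m := by
  rw [contents, List.getD_eq_getElem?_getD]
  by_cases hi : i < l.flatten.length
  · obtain ⟨a, ha, hv⟩ := List.mem_flatten.mp (List.getElem_mem hi)
    rw [List.getElem?_eq_getElem hi]
    exact h a ha _ hv
  · simp [List.getElem?_eq_none (not_lt.mp hi)]

end WordRAM

namespace Shredder

open WordRAM

variable {n : ℕ} {G : SimpleGraph (Fin n)}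

/-- The data on which the algorithm runs; nothing is marked. -/
def inputOf (adj : Fin n → List (Fin n)) (k : ℕ) (x : Fin n) (ν : ℕ) (paths : List (VPath G)) :
    Input where
  n := n
  k := k
  F := 4 * ν + 1
  tot := offsets (paths.map fun p => p.verts.map Fin.val) k
  x := x
  aoff := offsets (List.ofFn fun v => (adj v).map Fin.val)
  adat := contents (List.ofFn fun v => (adj v).map Fin.val)
  poff := offsets (paths.map fun p => p.verts.map Fin.val)
  pdat := contents (paths.map fun p => p.verts.map Fin.val)
  mP := fun _ => 0
  mG := fun _ => 0

theorem starts_initState (adj : Fin n → List (Fin n)) (k : ℕ) (x : Fin n) (ν : ℕ)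
    (paths : List (VPath G)) : Starts (inputOf adj k x ν paths) (initState adj k x ν paths) where
  k_eq := rfl
  x_eq := rfl
  F_eq := rfl
  tot_eq := rfl
  aoff := rfl
  adat := rfl
  poff := rfl
  pdat := rfl
  reg_zero r hr := by
    obtain ⟨r, rfl⟩ := Nat.exists_eq_add_of_le hr
    rw [Nat.add_comm]
    rfl
  arr_zero a ha z := by
    obtain ⟨a, rfl⟩ := Nat.exists_eq_add_of_le ha
    rw [Nat.add_comm]
    rfl

theorem VPath.length_verts (p : VPath G) : p.verts.length = p.length + 1 :=
  p.walk.length_support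

section

variable {adj : Fin n → List (Fin n)} {k ν : ℕ} {x : Fin n} {paths : List (VPath G)}

theorem aoff_succ (u : Fin n) : (inputOf adj k x ν paths).aoff (u + 1) =
    (inputOf adj k x ν paths).aoff u + (adj u).length := by
  have := offsets_succ (l := List.ofFn fun v => (adj v).map Fin.val) (i := u) (by simp)
  simpa [inputOf] using this

theorem adat_aoff (u : Fin n) {p : ℕ} (hp : p < (adj u).length) :
    (inputOf adj k x ν paths).adat ((inputOf adj k x ν paths).aoff u + p) = (adj u)[p] := by
  have := contents_offsets (l := List.ofFn fun v => (adj v).map Fin.val) (i := u) (p := p) (by simp)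
    (by simpa using hp)
  simpa [inputOf] using this

theorem poff_succ {i : ℕ} (hi : i < paths.length) : (inputOf adj k x ν paths).poff (i + 1) =
    (inputOf adj k x ν paths).poff i + paths[i].verts.length := by
  have := offsets_succ (l := paths.map fun p => p.verts.map Fin.val) (i := i) (by simpa using hi)
  simpa [inputOf] using this

theorem pdat_poff {i p : ℕ} (hi : i < paths.length) (hp : p < paths[i].verts.length) :
    (inputOf adj k x ν paths).pdat ((inputOf adj k x ν paths).poff i + p) =
      paths[i].verts[p] := by
  have := contents_offsets (l := paths.map fun p => p.verts.map Fin.val) (i := i) (p := p)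
    (by simpa using hi) (by simpa using hp)
  simpa [inputOf] using this

theorem nb_inputOf (hadj : IsAdjList G adj) (u w : ℕ) : (inputOf adj k x ν paths).Nb u w ↔
    ∃ (hu : u < n) (hw : w < n), G.Adj ⟨u, hu⟩ ⟨w, hw⟩ := by
  constructor
  · rintro ⟨hu, ε, h1, h2, rfl⟩
    have hu : u < n := hu
    obtain ⟨p, rfl⟩ := Nat.exists_eq_add_of_le h1
    have h3 : p < (adj ⟨u, hu⟩).length := by
      have := aoff_succ (k := k) (x := x) (ν := ν) (paths := paths) (adj := adj) ⟨u, hu⟩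
      simp only at this
      omega
    have h4 := adat_aoff (k := k) (x := x) (ν := ν) (paths := paths) (adj := adj) ⟨u, hu⟩ h3
    simp only at h4
    rw [h4]
    exact ⟨hu, Fin.isLt _, ((hadj ⟨u, hu⟩).2 _).mp (List.getElem_mem h3)⟩
  · rintro ⟨hu, hw, h⟩
    obtain ⟨p, hp, e⟩ := List.mem_iff_getElem.mp (((hadj ⟨u, hu⟩).2 _).mpr h)
    have h1 := aoff_succ (k := k) (x := x) (ν := ν) (paths := paths) (adj := adj) ⟨u, hu⟩
    have h2 := adat_aoff (k := k) (x := x) (ν := ν) (paths := paths) (adj := adj) ⟨u, hu⟩ hp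
    simp only [e] at h1 h2
    exact ⟨hu, _, Nat.le_add_right _ p, by omega, h2⟩

theorem deg_inputOf (u : Fin n) : (inputOf adj k x ν paths).deg u = (adj u).length := by
  rw [Input.deg, aoff_succ, Nat.add_sub_cancel_left]

theorem raw_inputOf (hk : 1 ≤ k) (hadj : IsAdjList G adj) (hlen : paths.length = k) :
    (inputOf adj k x ν paths).Raw where
  k_pos := hk
  x_lt := x.isLt
  aoff_le u hu := by
    have := aoff_succ (k := k) (x := x) (ν := ν) (paths := paths) (adj := adj) ⟨u, hu⟩
    simp only at this
    omega
  nb_symm u w h := by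
    rw [nb_inputOf hadj] at h ⊢
    obtain ⟨hu, hw, h⟩ := h
    exact ⟨hw, hu, h.symm⟩
  poff_zero := by simp [inputOf, offsets]
  poff_last := rfl
  poff_lt i hi := by
    have hi : i < paths.length := hlen ▸ hi
    rw [poff_succ hi, VPath.length_verts]
    omega
  pdat_lt g hg := by
    have h1 : ∀ i ≤ k, ∀ g < (inputOf adj k x ν paths).poff i,
        (inputOf adj k x ν paths).pdat g < n := by
      intro i
      induction i with
      | zero => simp [inputOf, offsets]
      | succ i ih =>
        intro hi g hg
        have hi' : i < paths.length := by omega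
        by_cases h : g < (inputOf adj k x ν paths).poff i
        · exact ih (by omega) g h
        · obtain ⟨p, rfl⟩ := Nat.exists_eq_add_of_le (not_lt.mp h)
          rw [poff_succ hi'] at hg
          rw [pdat_poff hi' (by omega)]
          exact Fin.isLt _
    exact h1 k le_rfl g hg

/-- The number of vertices on the paths. -/
theorem tot_inputOf (hlen : paths.length = k) :
    (inputOf adj k x ν paths).tot = (paths.map VPath.length).sum + k := by
  have h : (inputOf adj k x ν paths).tot =
      (paths.map fun p => p.length + 1).sum := by
    have e : (paths.map fun p => p.verts.map Fin.val).take k =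
        paths.map fun p => p.verts.map Fin.val := List.take_of_length_le (by simp [hlen])
    simp only [inputOf]
    rw [offsets, if_pos (by simp [hlen]), e, List.length_flatten, List.map_map]
    congr 1
    exact List.map_congr_left fun p _ => by simp [VPath.length_verts]
  rw [h, List.sum_map_add]
  simp [hlen]

theorem length_verts_le (p : VPath G) : p.verts.length ≤ n :=
  p.isPath.support_nodup.length_le_card.trans (Fintype.card_fin n).le

theorem bdd_initState {N : ℕ} (hadj : IsAdjList G adj) (hkN : k ≤ N) (hνN : ν ≤ N) (hn : n * n ≤ N)
    (hpN : paths.length * n ≤ N) (hn1 : 1 ≤ n) : (initState adj k x ν paths).Bdd N := by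
  have h1 : n ≤ N := (Nat.le_mul_of_pos_left n hn1).trans hn
  have h2 : paths.length ≤ N := (Nat.le_mul_of_pos_right _ hn1).trans hpN
  constructor
  · intro r
    match r with
    | 0 => exact h1
    | 1 => exact hkN
    | 2 => exact x.isLt.le.trans h1
    | 3 => exact hνN
    | 4 => exact h2
    | _ + 5 => exact Nat.zero_le _
  · intro a z
    match a with
    | 0 =>
      refine (offsets_le z).trans
        ((flatten_length_le (m := n) fun a ha => ?_).trans (by simpa using hn))
      obtain ⟨v, rfl⟩ := List.mem_ofFn.mp ha
      simpa using (hadj v).1.length_le_card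
    | 1 =>
      refine contents_le (fun a ha v hv => ?_) z
      obtain ⟨u, rfl⟩ := List.mem_ofFn.mp ha
      obtain ⟨w, -, rfl⟩ := List.mem_map.mp hv
      exact w.isLt.le.trans h1
    | 2 =>
      refine (offsets_le z).trans
        ((flatten_length_le (m := n) fun a ha => ?_).trans (by simpa using hpN))
      obtain ⟨p, -, rfl⟩ := List.mem_map.mp ha
      simpa using length_verts_le p
    | 3 =>
      refine contents_le (fun a ha v hv => ?_) z
      obtain ⟨p, -, rfl⟩ := List.mem_map.mp ha
      obtain ⟨w, -, rfl⟩ := List.mem_map.mp hv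
      exact w.isLt.le.trans h1
    | _ + 4 => exact Nat.zero_le _

/-- Consecutive vertices of a path are adjacent. -/
theorem nb_pdat (hadj : IsAdjList G adj) {i g : ℕ} (hi : i < paths.length)
    (h1 : (inputOf adj k x ν paths).poff i ≤ g)
    (h2 : g + 1 < (inputOf adj k x ν paths).poff (i + 1)) :
    (inputOf adj k x ν paths).Nb ((inputOf adj k x ν paths).pdat g)
      ((inputOf adj k x ν paths).pdat (g + 1)) := by
  obtain ⟨p, rfl⟩ := Nat.exists_eq_add_of_le h1
  rw [poff_succ hi] at h2
  rw [nb_inputOf hadj, pdat_poff hi (by omega), add_assoc, pdat_poff hi (by omega)]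
  refine ⟨Fin.isLt _, Fin.isLt _, ?_⟩
  have := paths[i].walk.isChain_adj_support
  rw [List.isChain_iff_getElem] at this
  exact this p (by simp only [VPath.verts] at h2; omega)

theorem pdat_src {i : ℕ} (hi : i < paths.length) :
    (inputOf adj k x ν paths).pdat ((inputOf adj k x ν paths).poff i) = paths[i].src := by
  have := pdat_poff (adj := adj) (k := k) (x := x) (ν := ν) hi (p := 0)
    (by simp [VPath.length_verts])
  simpa [VPath.verts] using this

theorem last_inputOf {i : ℕ} (hi : i < paths.length) :
    (inputOf adj k x ν paths).last i = paths[i].dst := by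
  have := pdat_poff (adj := adj) (k := k) (x := x) (ν := ν) hi (p := paths[i].length)
    (by simp [VPath.length_verts])
  rw [Input.last, poff_succ hi, VPath.length_verts, ← add_assoc, Nat.add_sub_cancel, this]
  congr 1
  exact SimpleGraph.Walk.support_getElem_length _

theorem mid_inputOf {i g : ℕ} (hi : i < paths.length) (h : (inputOf adj k x ν paths).Mid i g) :
    ∃ v ∈ paths[i].verts, (inputOf adj k x ν paths).pdat g = v ∧ v ≠ paths[i].src ∧
      v ≠ paths[i].dst := by
  obtain ⟨h1, h2⟩ := h
  obtain ⟨p, rfl⟩ := Nat.exists_eq_add_of_le h1.le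
  rw [poff_succ hi] at h2
  have hp : p < paths[i].verts.length := by omega
  have hl := paths[i].length_verts
  have hnd : paths[i].verts.Nodup := paths[i].isPath.support_nodup
  refine ⟨paths[i].verts[p], List.getElem_mem hp, pdat_poff hi hp, fun h => ?_, fun h => ?_⟩
  · have h3 : paths[i].verts[0] = paths[i].src := by simp [VPath.verts]
    have := (hnd.getElem_inj_iff).mp (h.trans h3.symm)
    omega
  · have h3 : paths[i].verts[paths[i].length] = paths[i].dst :=
      SimpleGraph.Walk.support_getElem_length _
    have := (hnd.getElem_inj_iff).mp (h.trans h3.symm)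
    omega

theorem good_inputOf (hlen : paths.length = k) (hnd : paths.Nodup)
    (hsrc : ∀ p ∈ paths, p.src = x) (hdst : ∀ p ∈ paths, p.dst ≠ x)
    (hdisj : ∀ p ∈ paths, ∀ q ∈ paths, p ≠ q → OpenlyDisjoint p q) :
    (inputOf adj k x ν paths).Good := by
  have hk : ∀ i < (inputOf adj k x ν paths).k, i < paths.length := fun i hi => hlen ▸ hi
  have hx : (inputOf adj k x ν paths).x = x := rfl
  have hmem : ∀ i (hi : i < paths.length), paths[i] ∈ paths := fun i hi => List.getElem_mem hi
  have key : ∀ i (hi : i < paths.length) l (hl : l < paths.length), ∀ v ∈ paths[i].verts,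
      v ∈ paths[l].verts → v ≠ paths[i].src → v ≠ paths[i].dst → i = l := by
    intro i hi l hl v h1 h2 h3 h4
    by_contra hne
    have h5 : paths[i] ≠ paths[l] := fun h5 => hne (hnd.getElem_inj_iff.mp h5)
    rcases (hdisj _ (hmem i hi) _ (hmem l hl) h5 v h1 h2).1 with h | h
    · exact h3 h
    · exact h4 h
  refine ⟨fun i hi => ?_, fun i hi => ?_, fun i hi g hg => ?_, fun i hi g hg l hl h => ?_,
    fun i hi g hg l hl h hh e => ?_⟩
  · rw [pdat_src (hk i hi), hx, hsrc _ (hmem i (hk i hi))]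
  · rw [last_inputOf (hk i hi), hx]
    exact fun h => hdst _ (hmem i (hk i hi)) (Fin.ext h)
  · obtain ⟨v, -, h1, h2, -⟩ := mid_inputOf (hk i hi) hg
    rw [h1, hx]
    exact fun h => h2 ((Fin.ext h).trans (hsrc _ (hmem i (hk i hi))).symm)
  · obtain ⟨v, h0, h1, h2, h3⟩ := mid_inputOf (hk i hi) hg
    rw [h1, last_inputOf (hk l hl)] at h
    have h4 : v = (paths[l]'(hk l hl)).dst := Fin.ext h
    have := key i (hk i hi) l (hk l hl) v h0
      (h4 ▸ SimpleGraph.Walk.end_mem_support _) h2 h3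
    subst this
    exact h3 h4
  · obtain ⟨v, h0, h1, h2, h3⟩ := mid_inputOf (hk i hi) hg
    obtain ⟨w, h0', h1', -⟩ := mid_inputOf (hk l hl) hh
    obtain rfl : v = w := Fin.ext (h1.symm.trans (e.trans h1'))
    obtain rfl := key i (hk i hi) l (hk l hl) v h0 h0' h2 h3
    obtain ⟨p, rfl⟩ := Nat.exists_eq_add_of_le hg.1.le
    obtain ⟨q, rfl⟩ := Nat.exists_eq_add_of_le hh.1.le
    have h4 := hg.2
    have h5 := hh.2
    rw [poff_succ (hk i hi)] at h4 h5
    rw [pdat_poff (hk i hi) (by omega), pdat_poff (hk i hi) (by omega)] at e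
    have hnd' : (paths[i]'(hk i hi)).verts.Nodup := (paths[i]'(hk i hi)).isPath.support_nodup
    rw [hnd'.getElem_inj_iff.mp (Fin.ext e)]

end

end Shredder

/-! ### Components and separators -/

namespace Shredder

section

variable {V : Type*} {G : SimpleGraph V} {S : Finset V}

theorem Component.mem_verts {D : Component G S} {v : V} :
    v ∈ D.verts ↔ ∃ h : v ∉ S, (G.induce ((S : Set V)ᶜ)).connectedComponentMk ⟨v, h⟩ = D := by
  constructor
  · rintro ⟨⟨v, h⟩, h1, rfl⟩
    exact ⟨h, h1⟩
  · rintro ⟨h, h1⟩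
    exact ⟨⟨v, h⟩, h1, rfl⟩

theorem Component.not_mem {D : Component G S} {v : V} (h : v ∈ D.verts) : v ∉ S :=
  (Component.mem_verts.mp h).1

theorem Component.eq_of_mem {D E : Component G S} {v : V} (h : v ∈ D.verts) (h' : v ∈ E.verts) :
    D = E := by
  obtain ⟨h1, rfl⟩ := Component.mem_verts.mp h
  obtain ⟨h2, rfl⟩ := Component.mem_verts.mp h'
  rfl

theorem Component.nonempty (D : Component G S) : D.verts.Nonempty := by
  obtain ⟨v, hv⟩ := D.nonempty_supp
  exact ⟨v, v, hv, rfl⟩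

theorem Component.mem_of_adj {D : Component G S} {u w : V} (hu : u ∈ D.verts) (h : G.Adj u w)
    (hw : w ∉ S) : w ∈ D.verts := by
  obtain ⟨hu', rfl⟩ := Component.mem_verts.mp hu
  refine Component.mem_verts.mpr ⟨hw, SimpleGraph.ConnectedComponent.eq.mpr ?_⟩
  exact SimpleGraph.Adj.reachable (G := G.induce ((S : Set V)ᶜ)) (u := ⟨w, hw⟩) (v := ⟨u, hu'⟩)
    h.symm

/-- What is reachable outside `S` from a set `Y` that is closed under adjacency outside `S` is
in `Y`. -/
theorem mem_of_reachable {Y : Set V} (hY : ∀ u ∈ Y, ∀ w, G.Adj u w → w ∉ S → w ∈ Y)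
    {u w : ((S : Set V)ᶜ : Set V)} (h : (G.induce ((S : Set V)ᶜ)).Reachable u w)
    (hu : u.1 ∈ Y) : w.1 ∈ Y := by
  obtain ⟨p⟩ := h
  induction p with
  | nil => exact hu
  | @cons a b _ hadj _ ih => exact ih (hY _ hu _ hadj b.2)

theorem Component.subset {D : Component G S} {Y : Set V}
    (hY : ∀ u ∈ Y, ∀ w, G.Adj u w → w ∉ S → w ∈ Y) {u : V} (hu : u ∈ D.verts) (hu' : u ∈ Y) :
    D.verts ⊆ Y := by
  intro w hw
  obtain ⟨h1, rfl⟩ := Component.mem_verts.mp hu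
  obtain ⟨h2, h3⟩ := Component.mem_verts.mp hw
  exact mem_of_reachable hY (SimpleGraph.ConnectedComponent.eq.mp h3).symm hu'

/-- Two disjoint sets that are closed under adjacency outside `S`, and a further vertex, show that
there are at least three components. -/
theorem three_le_card_component {A B : Set V}
    (hA : ∀ u ∈ A, ∀ w, G.Adj u w → w ∉ S → w ∈ A) (hB : ∀ u ∈ B, ∀ w, G.Adj u w → w ∉ S → w ∈ B)
    (hAB : Disjoint A B) {a b z : V} (ha : a ∈ A) (hb : b ∈ B) (haS : a ∉ S) (hbS : b ∉ S)
    (hzS : z ∉ S) (hzA : z ∉ A) (hzB : z ∉ B) : 3 ≤ ENat.card (Component G S) := by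
  let f : Fin 3 → Component G S :=
    ![(G.induce _).connectedComponentMk ⟨a, haS⟩, (G.induce _).connectedComponentMk ⟨b, hbS⟩,
      (G.induce _).connectedComponentMk ⟨z, hzS⟩]
  have h1 : f 0 ≠ f 1 := fun h => Set.disjoint_left.mp hAB
    (mem_of_reachable hA (SimpleGraph.ConnectedComponent.eq.mp h) ha) hb
  have h2 : f 0 ≠ f 2 := fun h => hzA
    (mem_of_reachable hA (SimpleGraph.ConnectedComponent.eq.mp h) ha)
  have h3 : f 1 ≠ f 2 := fun h => hzB
    (mem_of_reachable hB (SimpleGraph.ConnectedComponent.eq.mp h) hb)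
  have hf : Function.Injective f := by
    intro i j h
    fin_cases i <;> fin_cases j <;> simp_all
  simpa using ENat.card_le_card_of_injective hf

theorem exists_third_component (h : 3 ≤ ENat.card (Component G S)) (C D : Component G S) :
    ∃ E : Component G S, E ≠ C ∧ E ≠ D := by
  by_contra! hE
  have h1 : (Set.univ : Set (Component G S)) ⊆ {C, D} := fun E _ => by
    by_cases h : E = C
    · exact .inl h
    · exact .inr (hE E h)
  have h2 := (Set.encard_le_encard h1).trans (Set.encard_insert_le {D} C)
  rw [Set.encard_univ, Set.encard_singleton] at h2
  exact absurd (h.trans h2) (by decide)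

variable [Fintype V]

theorem vertexConnectivity_le_card (h : IsSeparator G S) : vertexConnectivity G ≤ S.card :=
  Nat.sInf_le (.inl ⟨S, h, rfl⟩)

theorem vertexConnectivity_lt (G : SimpleGraph V) : vertexConnectivity G ≤ Fintype.card V - 1 :=
  Nat.sInf_le (.inr rfl)

/-- A vertex without neighbours would make the empty set a separator. -/
theorem exists_adj_of_vertexConnectivity (h : 1 ≤ vertexConnectivity G) (v : V) :
    ∃ w, G.Adj v w := by
  have hcard : 1 < Fintype.card V := by
    have := vertexConnectivity_lt G
    omega
  obtain ⟨w, hw⟩ := Fintype.exists_ne_of_one_lt_card hcard v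
  have hpre : (G.induce (((∅ : Finset V) : Set V)ᶜ)).Preconnected := by
    by_contra h1
    have := vertexConnectivity_le_card h1
    simp at this
    omega
  by_contra! hv
  refine hw.symm (mem_of_reachable (S := ∅) (Y := {v}) ?_ (hpre ⟨v, by simp⟩ ⟨w, by simp⟩) rfl).symm
  rintro u rfl w h -
  exact absurd h (hv w)

/-- Each vertex of a smallest separator has a neighbour in each component. -/
theorem exists_adj_of_mem_separator (hS : vertexConnectivity G = S.card) {D E : Component G S}
    (hDE : D ≠ E) {v : V} (hv : v ∈ S) : ∃ u ∈ D.verts, G.Adj u v := by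
  classical
  by_contra! h
  obtain ⟨d, hd⟩ := D.nonempty
  obtain ⟨e, he⟩ := E.nonempty
  have hsep : IsSeparator G (S.erase v) := fun hpre => by
    refine hDE (Component.eq_of_mem (mem_of_reachable (S := S.erase v) (Y := D.verts)
      (fun u hu w hw hw' => Component.mem_of_adj hu hw fun h1 => hw' ?_)
      (hpre ⟨d, fun h1 => Component.not_mem hd (Finset.mem_of_mem_erase h1)⟩
        ⟨e, fun h1 => Component.not_mem he (Finset.mem_of_mem_erase h1)⟩) hd) he)
    refine Finset.mem_erase.mpr ⟨?_, h1⟩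
    rintro rfl
    exact h u hu hw
  have h1 := vertexConnectivity_le_card hsep
  have h2 := Finset.card_erase_lt_of_mem hv
  omega

/-- Without isolated vertices, there are at most `4 vol A` vertices and ends of edges in `A`. -/
theorem sum_degree_le [DecidableRel G.Adj] (hG : ∀ v, ∃ w, G.Adj v w) (A : Finset V) :
    ∑ u ∈ A, (G.degree u + 1) ≤ 4 * vol G A := by
  classical
  have h1 : ∑ u ∈ A, (G.degree u + 1) ≤ 2 * ∑ u ∈ A, G.degree u := by
    rw [Finset.mul_sum]
    refine Finset.sum_le_sum fun u _ => ?_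
    have : 0 < G.degree u := (G.degree_pos_iff_exists_adj u).mpr (hG u)
    omega
  let F : Finset (Sym2 V) := {e ∈ G.edgeFinset | ∃ u ∈ A, u ∈ e}
  have h2 : vol G A = F.card := by
    rw [vol, ← Set.ncard_coe_finset]
    congr 1
    ext e
    simp [F]
  have h3 : ∑ u ∈ A, G.degree u ≤ 2 * F.card := by
    have h4 : ∀ u ∈ A, G.degree u = (F.bipartiteAbove (fun (u : V) e => u ∈ e) u).card := by
      intro u hu
      rw [← G.card_incidenceFinset_eq_degree]
      congr 1
      ext e
      simp only [SimpleGraph.mem_incidenceFinset, Finset.mem_bipartiteAbove, F, Finset.mem_filter,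
        SimpleGraph.mem_edgeFinset, SimpleGraph.incidenceSet, Set.mem_sep_iff]
      exact ⟨fun h => ⟨⟨h.1, u, hu, h.2⟩, h.2⟩, fun h => ⟨h.1.1, h.2⟩⟩
    rw [Finset.sum_congr rfl h4, Finset.sum_card_bipartiteAbove_eq_sum_card_bipartiteBelow,
      mul_comm, ← smul_eq_mul]
    refine Finset.sum_le_card_nsmul _ _ _ fun e _ => ?_
    refine (Finset.card_le_card (t := e.toFinset) fun u hu => ?_).trans ?_
    · simpa using ((Finset.mem_bipartiteBelow _).mp hu).2
    · rw [Sym2.card_toFinset]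
      split_ifs <;> omega
  omega

end

end Shredder

/-! ### Listed sets are shredders -/

namespace Shredder

variable {n : ℕ} {G : SimpleGraph (Fin n)} {c : Input}

/-- The adjacency lists of `c` are those of `G`. -/
structure Input.Represents (c : Input) (G : SimpleGraph (Fin n)) : Prop where
  n_eq : c.n = n
  nb : ∀ u w, c.Nb u w ↔ ∃ (hu : u < n) (hw : w < n), G.Adj ⟨u, hu⟩ ⟨w, hw⟩

theorem Input.Represents.nb_coe (hG : c.Represents G) {u w : Fin n} :
    c.Nb u w ↔ G.Adj u w := by
  rw [hG.nb]
  exact ⟨fun ⟨_, _, h⟩ => h, fun h => ⟨u.isLt, w.isLt, h⟩⟩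

/-- A vertex whose mark is neither that of `x` nor that of the last vertices is an inner vertex. -/
theorem Input.Marked.eq_pdat (hc : c.Marked) {w j : ℕ} (hw : c.mP w = j + 1) (h0 : c.mG w ≠ 0)
    (ht : c.mG w < c.tot) :
    j < c.k ∧ w = c.pdat (c.mG w) ∧ c.poff j < c.mG w ∧ c.mG w + 1 < c.poff (j + 1) := by
  rcases hc.mark_cases w with h | rfl | ⟨i, hi, g, h1, h2, rfl⟩ | ⟨i, hi, rfl⟩
  · omega
  · exact absurd hc.mark_x.2 h0
  · obtain ⟨h3, h4⟩ := hc.mark_mid i hi g h1 h2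
    obtain rfl : i = j := by omega
    rw [h4]
    exact ⟨hi, rfl, h1, h2⟩
  · have := (hc.mark_end i hi).2
    omega

/-- A candidate that passes the check is a shredder. The three components needed are found in the
bridge, among the vertices that precede the candidate on the paths, and at the vertex that follows
it on the first path. -/
theorem isShredder_of_candOK (hc : c.Marked) (hG : c.Represents G) {a M : ℕ → ℕ}
    (ha : c.CandOK a) (hlt : ∀ i < c.k, a i < c.poff (i + 1))
    (hrow : ∀ i < c.k, c.poff i < a i → c.RowOK M i (a i))
    (hM : ∀ i < c.k, ∀ j < c.k, M (a i * c.k + j) ≤ a j) {S : Finset (Fin n)}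
    (hS : ∀ v, v ∈ S ↔ ∃ j < c.k, v.val = c.pdat (a j)) : IsShredder G c.k S := by
  obtain ⟨Q, ⟨q, hq⟩, hQ, hpos⟩ := ha
  have hk := hc.k_pos
  have htot : ∀ j < c.k, a j < c.tot := fun j hj => (hlt j hj).trans_le (hc.poff_succ_le hj)
  have hmid : ∀ j < c.k, c.poff j < a j ∧ a j + 1 < c.poff (j + 1) := fun j hj => by
    obtain ⟨h0, w, h1, h2⟩ := hpos j hj
    have h3 := htot j hj
    rw [← h2] at h0 h3 ⊢
    exact (hc.eq_pdat h1 h0 h3).2.2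
  have hmark : ∀ j < c.k, c.mP (c.pdat (a j)) = j + 1 ∧ c.mG (c.pdat (a j)) = a j :=
    fun j hj => hc.mark_mid j hj _ (hmid j hj).1 (hmid j hj).2
  have hltn : ∀ g < c.tot, c.pdat g < n := fun g hg => hG.n_eq ▸ hc.pdat_lt g hg
  have hSm : ∀ v : Fin n, c.mP v ≠ 0 → c.mG v ≠ 0 → a (c.mP v - 1) = c.mG v → v ∈ S := by
    intro v h1 h2 h3
    have h4 : c.mP v - 1 < c.k := hc.mP_sub_lt v
    have h5 := hc.eq_pdat (w := v) (j := c.mP v - 1) (by omega) h2 (h3 ▸ htot _ h4)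
    exact (hS v).mpr ⟨_, h4, h3 ▸ h5.2.1⟩
  have hSmark : ∀ v ∈ S, c.mP v ≠ 0 ∧ c.mG v ≠ 0 ∧ a (c.mP v - 1) = c.mG v := by
    intro v hv
    obtain ⟨j, hj, e⟩ := (hS v).mp hv
    obtain ⟨h1, h2⟩ := hmark j hj
    rw [e, h1, h2]
    exact ⟨Nat.succ_ne_zero j, (Nat.zero_le _).trans_lt (hmid j hj).1 |>.ne', rfl⟩
  -- vertices before the candidate, and what follows it on the first path, are not in `S`
  have hbefore : ∀ i < c.k, ∀ g, c.poff i ≤ g → g < a i →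
      c.mP (c.pdat g) ≠ 0 ∧ ¬ (c.mG (c.pdat g) ≠ 0 ∧ a (c.mP (c.pdat g) - 1) = c.mG (c.pdat g)) ∧
      c.pdat g ≠ c.pdat (a 0 + 1) := by
    intro i hi g h1 h2
    have h3 := (hmid i hi).2
    have h0 := hmid 0 hk
    have h4 := hc.poff_succ_le hk
    rcases hc.mark_pdat hi h1 (h2.trans (hlt i hi)) with ⟨-, e1, e2⟩ | ⟨h5, h6, e1, e2⟩ | ⟨h5, -⟩
    · refine ⟨by omega, fun h => h.1 e2, fun e => ?_⟩
      rcases hc.mark_pdat hk (g := a 0 + 1) (by omega) h0.2 with h | ⟨-, -, -, h⟩ | ⟨-, -, h⟩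
      · omega
      all_goals
        rw [← e] at h
        omega
    · refine ⟨by omega, fun h => ?_, fun e => ?_⟩
      · rw [e1, e2, Nat.add_sub_cancel] at h
        omega
      · rcases hc.mark_pdat hk (g := a 0 + 1) (by omega) h0.2 with h | ⟨-, -, h⟩ | ⟨-, -, h⟩
        · omega
        · rw [← e, e1, e2] at h
          obtain rfl : i = 0 := by omega
          omega
        · have := hc.poff_succ_le hi
          rw [← e, e2] at h
          omega
    · omega
  choose Z hZ hZ' using fun i (hi : i < c.k) => hrow i hi (hmid i hi).1
  -- the part before the candidate; a set `Z` may contain the bridge, which has to be left out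
  let X : Set (Fin n) := {v | (∃ i < c.k, ∃ g, c.poff i ≤ g ∧ g < a i ∧ v.val = c.pdat g) ∨
    (v.val ∉ Q ∧ ∃ i, ∃ hi : i < c.k, v.val ∈ Z i hi)}
  have hX : ∀ u ∈ X, ∀ w, G.Adj u w → w ∉ S → w ∈ X := by
    intro u hu w huw hwS
    have hnb : c.Nb u w := hG.nb_coe.mpr huw
    have hnQ : c.mP w = 0 → w.val ∉ Q := fun h0 hwQ => by
      obtain ⟨h1, h2⟩ := (hQ w hwQ).2.2 u (hc.nb_symm _ _ hnb)
      rcases hu with ⟨i, hi, g, h3, h4, e⟩ | ⟨h3, i, hi, h4⟩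
      · obtain ⟨h5, h6, -⟩ := hbefore i hi g h3 h4
        rw [e] at h2
        exact h6 (h2 h5)
      · exact h3 (h1 (hZ i hi _ h4).2)
    obtain ⟨i, hi, hui⟩ : ∃ i, ∃ hi : i < c.k,
        u.val ∈ Z i hi ∨ ∃ g, c.poff i ≤ g ∧ g < a i ∧ u.val = c.pdat g := by
      rcases hu with ⟨i, hi, h⟩ | ⟨-, i, hi, h⟩
      exacts [⟨i, hi, .inr h⟩, ⟨i, hi, .inl h⟩]
    obtain ⟨h1, h2⟩ := hZ' i hi u hui w hnb
    by_cases hw : c.mP w = 0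
    · exact .inr ⟨hnQ hw, i, hi, h1 hw⟩
    · have h3 := (h2 hw).trans (hM i hi _ (hc.mP_sub_lt w))
      rcases hc.mark_cases w with h | h | ⟨l, hl, g, h4, h5, h6⟩ | ⟨l, hl, h6⟩
      · exact absurd h hw
      · exact .inl ⟨0, hk, c.poff 0, le_rfl, (hmid 0 hk).1, h.trans (hc.pdat_start 0 hk).symm⟩
      · obtain ⟨h7, h8⟩ := hc.mark_mid l hl g h4 h5
        rw [h6, h7, h8, Nat.add_sub_cancel] at h3
        rcases h3.lt_or_eq with h9 | h9
        · exact .inl ⟨l, hl, g, h4.le, h9, h6⟩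
        · exact absurd ((hS w).mpr ⟨l, hl, h9 ▸ h6⟩) hwS
      · obtain ⟨h7, h8⟩ := hc.mark_end l hl
        rw [h6, h7, h8] at h3
        exact absurd h3 (not_le.mpr (htot 0 hk))
  have hQ' : ∀ u ∈ {v : Fin n | v.val ∈ Q}, ∀ w, G.Adj u w → w ∉ S →
      w ∈ {v : Fin n | v.val ∈ Q} := by
    intro u hu w huw hwS
    obtain ⟨h1, h2⟩ := (hQ u hu).2.2 w (hG.nb_coe.mpr huw)
    by_cases hw : c.mP w = 0
    · exact h1 hw
    · exact absurd (hSm w hw (h2 hw).1 (h2 hw).2) hwS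
  have hqn : q < n := hG.n_eq ▸ (hQ q hq).1
  have hxn : c.x < n := hG.n_eq ▸ hc.x_lt
  have h0 := hmid 0 hk
  have hzt : a 0 + 1 < c.tot := h0.2.trans_le (hc.poff_succ_le hk)
  have hzP := hc.mP_pdat hk (g := a 0 + 1) (by omega) h0.2
  refine ⟨?_, three_le_card_component (a := ⟨q, hqn⟩) (b := ⟨c.x, hxn⟩)
    (z := ⟨c.pdat (a 0 + 1), hltn _ hzt⟩) hQ' hX (Set.disjoint_left.mpr fun v hv hv' => ?_) hq
    (.inl ⟨0, hk, c.poff 0, le_rfl, h0.1, (hc.pdat_start 0 hk).symm⟩)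
    (fun h => (hSmark _ h).1 (hQ q hq).2.1) (fun h => (hSmark _ h).2.1 hc.mark_x.2)
    (fun h => ?_) (fun h => hzP (hQ _ h).2.1) fun h => ?_⟩
  · have e : S = (Finset.range c.k).attach.image fun j =>
        ⟨c.pdat (a j.1), hltn _ (htot _ (Finset.mem_range.mp j.2))⟩ := by
      ext v
      simp [hS, Fin.ext_iff, eq_comm]
    rw [e, Finset.card_image_of_injective, Finset.card_attach, Finset.card_range]
    intro i j h
    have h1 := (hmark _ (Finset.mem_range.mp i.2)).1
    rw [Fin.mk.inj h, (hmark _ (Finset.mem_range.mp j.2)).1] at h1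
    exact Subtype.ext (by omega)
  · rcases hv' with ⟨i, hi, g, h1, h2, e⟩ | ⟨h1, -⟩
    · exact (hbefore i hi g h1 h2).1 (e ▸ (hQ _ hv).2.1)
    · exact h1 hv
  · obtain ⟨h1, h2, h3⟩ := hSmark _ h
    simp only at h1 h2 h3
    rcases hc.mark_pdat hk (g := a 0 + 1) (by omega) h0.2 with h | ⟨-, -, h4, h5⟩ | ⟨-, h4, h5⟩
    · omega
    · rw [h4, h5] at h3
      simp at h3
    · rw [h4, h5] at h3
      simp at h3
      have := htot 0 hk
      omega
  · rcases h with ⟨i, hi, g, h1, h2, e⟩ | ⟨-, i, hi, h1⟩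
    · exact (hbefore i hi g h1 h2).2.2 e.symm
    · exact hzP (hZ i hi _ h1).2

end Shredder

/-! ### Captured shredders are found -/

namespace Shredder

/-- On each of `k` paths from a set `D` to a set `C`, the `k`-element set `S` that separates `D`
from `C` has exactly one vertex, at position `σ i` on path `i`. -/
structure Cut (c : Input) (S D C : Set ℕ) (σ : ℕ → ℕ) : Prop where
  mid : ∀ i < c.k, c.poff i < σ i ∧ σ i + 1 < c.poff (i + 1)
  mem : ∀ v, v ∈ S ↔ ∃ j < c.k, v = c.pdat (σ j)
  before : ∀ i < c.k, ∀ g, c.poff i ≤ g → g < σ i → c.pdat g ∈ D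
  after : ∀ i < c.k, ∀ g, σ i < g → g < c.poff (i + 1) → c.pdat g ∈ C

/-- Each of the `k` paths meets `S` in an inner vertex, and different paths do so in different
vertices, so that nothing of `S` is left for a second meeting. -/
theorem exists_cut {c : Input} {S D C : Set ℕ} (hc : c.Marked) (hS : S.ncard = c.k) (hx : c.x ∈ D)
    (hlast : ∀ i < c.k, c.last i ∈ C) (hD : ∀ u ∈ D, ∀ w, c.Nb u w → w ∈ D ∨ w ∈ S)
    (hC : ∀ u ∈ C, ∀ w, c.Nb u w → w ∈ C ∨ w ∈ S) (hCS : Disjoint C S)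
    (hDC : Disjoint D C) (hpath : ∀ i < c.k, ∀ g, c.poff i ≤ g → g + 1 < c.poff (i + 1) →
      c.Nb (c.pdat g) (c.pdat (g + 1))) : ∃ σ, Cut c S D C σ := by
  have hlt := hc.poff_lt
  have hmeet : ∀ i < c.k, ∃ g, (c.poff i < g ∧ g + 1 < c.poff (i + 1)) ∧ c.pdat g ∈ S := by
    intro i hi
    by_contra! h
    have h1 : ∀ p, c.poff i + p < c.poff (i + 1) → c.pdat (c.poff i + p) ∈ D := by
      intro p
      induction p with
      | zero => exact fun _ => hc.pdat_start i hi ▸ hx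
      | succ p ih =>
        intro hp
        rcases hD _ (ih (by omega)) _ (hpath i hi _ (Nat.le_add_right _ p) hp) with h2 | h2
        · exact h2
        · by_cases h3 : c.poff i + p + 1 + 1 < c.poff (i + 1)
          · exact absurd h2 (h _ ⟨by omega, h3⟩)
          · have e : c.pdat (c.poff i + p + 1) = c.last i :=
              congrArg c.pdat (show _ = c.poff (i + 1) - 1 by omega)
            exact absurd h2 (Set.disjoint_left.mp hCS (e ▸ hlast i hi))
    have h2 := h1 (c.poff (i + 1) - 1 - c.poff i) (by have := hlt i hi; omega)
    have e : c.poff i + (c.poff (i + 1) - 1 - c.poff i) = c.poff (i + 1) - 1 := by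
      have := hlt i hi
      omega
    rw [e] at h2
    exact Set.disjoint_left.mp hDC h2 (hlast i hi)
  choose! σ hσ hσS using hmeet
  have hmark : ∀ i < c.k, c.mP (c.pdat (σ i)) = i + 1 ∧ c.mG (c.pdat (σ i)) = σ i :=
    fun i hi => hc.mark_mid i hi _ (hσ i hi).1 (hσ i hi).2
  have hmem : ∀ v, v ∈ S ↔ ∃ j < c.k, v = c.pdat (σ j) := by
    have hfin : S.Finite := Set.finite_of_ncard_pos (by have := hc.k_pos; omega)
    have hsub : (fun j => c.pdat (σ j)) '' (Finset.range c.k : Set ℕ) ⊆ S := by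
      rintro _ ⟨j, hj, rfl⟩
      exact hσS j (by simpa using hj)
    have hinj : Set.InjOn (fun j => c.pdat (σ j)) (Finset.range c.k : Set ℕ) := by
      intro i hi j hj h
      have h1 := (hmark i (by simpa using hi)).1
      simp only at h
      rw [h, (hmark j (by simpa using hj)).1] at h1
      omega
    have := Set.eq_of_subset_of_ncard_le hsub
      (by rw [hinj.ncard_image, Set.ncard_coe_finset, Finset.card_range, hS]) hfin
    intro v
    rw [← this]
    simp [eq_comm]
  have huniq : ∀ i < c.k, ∀ g, c.poff i ≤ g → g < c.poff (i + 1) → c.pdat g ∈ S → g = σ i := by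
    intro i hi g h1 h2 h3
    obtain ⟨j, hj, e⟩ := (hmem _).mp h3
    obtain ⟨h4, h5⟩ := hmark j hj
    have h6 := hσ j hj
    have h7 := hc.poff_succ_le hj
    rcases hc.mark_pdat hi h1 h2 with ⟨-, -, h⟩ | ⟨-, -, h, h'⟩ | ⟨-, -, h⟩
    · rw [e] at h
      omega
    · rw [e] at h h'
      obtain rfl : i = j := by omega
      omega
    · rw [e] at h
      omega
  refine ⟨σ, hσ, hmem, fun i hi g h1 h2 => ?_, fun i hi g h1 h2 => ?_⟩
  · obtain ⟨p, rfl⟩ := Nat.exists_eq_add_of_le h1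
    have h3 := (hσ i hi).2
    induction p with
    | zero => exact hc.pdat_start i hi ▸ hx
    | succ p ih =>
      have h4 := hpath i hi _ (Nat.le_add_right _ p) (by omega)
      rcases hD _ (ih (by omega) (by omega)) _ h4 with h5 | h5
      · exact h5
      · have := huniq i hi _ (by omega) (by omega) h5
        omega
  · obtain ⟨p, hp⟩ := Nat.exists_eq_add_of_le (Nat.le_sub_one_of_lt h2)
    have h3 := (hσ i hi).1
    induction p generalizing g with
    | zero =>
      have e : c.pdat g = c.last i := congrArg c.pdat (show g = c.poff (i + 1) - 1 by omega)
      exact e ▸ hlast i hi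
    | succ p ih =>
      have h4 := hc.nb_symm _ _ (hpath i hi g (by omega) (by omega))
      rcases hC _ (ih (g + 1) (by omega) (by omega) (by omega)) _ h4 with h5 | h5
      · exact h5
      · have := huniq i hi _ (by omega) (by omega) h5
        omega

section

variable {n : ℕ} {G : SimpleGraph (Fin n)} {c : Input} {S : Finset (Fin n)} {C D E : Component G S}
  {σ : ℕ → ℕ}

/-- The vertices of a component, as numbers. -/
def Component.nums (D : Component G S) : Set ℕ := Fin.val '' D.verts

theorem Component.nums_nb (hG : c.Represents G) (D : Component G S) :
    ∀ u ∈ D.nums, ∀ w, c.Nb u w → w ∈ D.nums ∨ w ∈ Fin.val '' (S : Set (Fin n)) := by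
  rintro _ ⟨u, hu, rfl⟩ w hw
  obtain ⟨_, h, hadj⟩ := (hG.nb _ _).mp hw
  by_cases hwS : (⟨w, h⟩ : Fin n) ∈ S
  · exact .inr ⟨_, hwS, rfl⟩
  · exact .inl ⟨_, Component.mem_of_adj hu hadj hwS, rfl⟩

theorem Component.nums_disjoint (D : Component G S) :
    Disjoint D.nums (Fin.val '' (S : Set (Fin n))) := by
  rw [Set.disjoint_left]
  rintro _ ⟨u, hu, rfl⟩ ⟨w, hw, e⟩
  exact Component.not_mem hu (Fin.ext e ▸ hw)

theorem Component.nums_disjoint_nums (h : D ≠ C) : Disjoint D.nums C.nums := by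
  rw [Set.disjoint_left]
  rintro _ ⟨u, hu, rfl⟩ ⟨w, hw, e⟩
  exact h (Component.eq_of_mem hu (Fin.ext e ▸ hw))

variable (hc : c.Marked) (hG : c.Represents G)
  (hcut : Cut c (Fin.val '' (S : Set (Fin n))) D.nums C.nums σ)
include hc hG hcut

/-- The component of `x` is enclosed by the shredder. -/
theorem fence_of_cut (hDC : D ≠ C) (A : Finset ℕ) (hA : ∀ u, u ∈ A ↔ u ∈ D.nums)
    (hsum : ∑ u ∈ A, (c.deg u + 1) < c.F) : c.Fence A σ := by
  have hk := hc.k_pos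
  refine ⟨hcut.mid, fun u hu => ?_, fun i hi g h1 h2 => (hA _).mpr (hcut.before i hi g h1 h2),
    fun u hu w huw => ?_, hsum⟩
  · obtain ⟨v, -, rfl⟩ := (hA u).mp hu
    exact hG.n_eq.symm ▸ v.isLt
  · have hw := D.nums_nb hG u ((hA u).mp hu) w huw
    rw [hcut.mem] at hw
    refine ⟨fun h => ?_, fun h => ?_⟩
    · rcases hw with hw | ⟨j, hj, rfl⟩
      · exact (hA w).mpr hw
      · have := (hc.mark_mid j hj _ (hcut.mid j hj).1 (hcut.mid j hj).2).1
        omega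
    · rcases hc.mark_cases w with h1 | rfl | ⟨i, hi, g, h1, h2, rfl⟩ | ⟨i, hi, rfl⟩
      · exact absurd h1 h
      · rw [hc.mark_x.2]
        exact Nat.zero_le _
      · obtain ⟨h3, h4⟩ := hc.mark_mid i hi g h1 h2
        rw [h3, h4, Nat.add_sub_cancel]
        by_contra h5
        have h6 := hcut.after i hi g (not_le.mp h5) (by omega)
        rcases hw with hw | ⟨j, hj, e⟩
        · exact Set.disjoint_left.mp (Component.nums_disjoint_nums hDC) hw h6
        · exact Set.disjoint_left.mp C.nums_disjoint h6 ((hcut.mem _).mpr ⟨j, hj, e⟩)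
      · have h1 := hcut.mid i hi
        have h6 := hcut.after i hi (c.poff (i + 1) - 1) (by omega) (by omega)
        rcases hw with hw | ⟨j, hj, e⟩
        · exact absurd h6 (Set.disjoint_left.mp (Component.nums_disjoint_nums hDC) hw)
        · exact absurd ((hcut.mem _).mpr ⟨j, hj, e⟩) (Set.disjoint_left.mp C.nums_disjoint h6)

/-- A component that contains neither `x` nor the last vertices of the paths is a bridge. -/
theorem bridge_of_cut (hED : E ≠ D) (hEC : E ≠ C) (hS : ∀ v ∈ S, ∃ u ∈ E.verts, G.Adj u v) :
    c.Bridge E.nums σ := by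
  have hk := hc.k_pos
  have hmark : ∀ i < c.k, c.mP (c.pdat (σ i)) = i + 1 ∧ c.mG (c.pdat (σ i)) = σ i :=
    fun i hi => hc.mark_mid i hi _ (hcut.mid i hi).1 (hcut.mid i hi).2
  have hpath : ∀ i < c.k, ∀ g, c.poff i ≤ g → g < c.poff (i + 1) → c.pdat g ∉ E.nums := by
    intro i hi g h1 h2 h3
    rcases lt_trichotomy g (σ i) with h | rfl | h
    · exact Set.disjoint_left.mp (Component.nums_disjoint_nums hED) h3 (hcut.before i hi g h1 h)
    · exact Set.disjoint_left.mp E.nums_disjoint h3 ((hcut.mem _).mpr ⟨i, hi, rfl⟩)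
    · exact Set.disjoint_left.mp (Component.nums_disjoint_nums hEC) h3 (hcut.after i hi g h h2)
  have hun : ∀ u ∈ E.nums, c.mP u = 0 := by
    intro u hu
    rcases hc.mark_cases u with h | rfl | ⟨i, hi, g, h1, h2, rfl⟩ | ⟨i, hi, rfl⟩
    · exact h
    · have := hcut.mid 0 hk
      exact absurd (hc.pdat_start 0 hk ▸ hu) (hpath 0 hk (c.poff 0) le_rfl (by omega))
    · exact absurd hu (hpath i hi g h1.le (by omega))
    · have := hcut.mid i hi
      exact absurd hu (hpath i hi _ (by omega) (by omega))
  have hatt : ∀ u ∈ E.nums, ∀ w, c.Nb u w → c.mP w ≠ 0 → ∃ j < c.k, w = c.pdat (σ j) := by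
    intro u hu w huw hw
    rcases E.nums_nb hG u hu w huw with h | h
    · exact absurd (hun w h) hw
    · exact (hcut.mem w).mp h
  refine ⟨hun, fun u hu w huw => ⟨fun h => ?_, fun h => ?_⟩, fun Y hY u hu huY => ?_,
    fun j hj => ?_⟩
  · rcases E.nums_nb hG u hu w huw with hw | hw
    · exact hw
    · obtain ⟨j, hj, rfl⟩ := (hcut.mem w).mp hw
      have := (hmark j hj).1
      omega
  · obtain ⟨j, hj, rfl⟩ := hatt u hu w huw h
    obtain ⟨h1, h2⟩ := hmark j hj
    rw [h1, h2]
    exact ⟨((Nat.zero_le _).trans_lt (hcut.mid j hj).1).ne', rfl⟩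
  · obtain ⟨v, hv, rfl⟩ := hu
    have : E.verts ⊆ {w | w.val ∈ Y ∧ w ∈ E.verts} := Component.subset
      (fun u hu w huw hwS => by
        have hw := Component.mem_of_adj hu.2 huw hwS
        exact ⟨hY u hu.1 w (hG.nb_coe.mpr huw) (hun w ⟨w, hw, rfl⟩), hw⟩) hv ⟨huY, hv⟩
    rintro _ ⟨w, hw, rfl⟩
    exact (this hw).1
  · obtain ⟨v, hv, e⟩ := (hcut.mem _).mpr ⟨j, hj, rfl⟩
    obtain ⟨u, hu, huv⟩ := hS v hv
    exact ⟨u, ⟨u, hu, rfl⟩, v, hG.nb_coe.mpr huv, e ▸ (hmark j hj).1⟩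

end

/-- If the exploration has gone past a position of the shredder on some path, then the bridge has
been recorded and passes the check. Otherwise it ends at these positions on all paths. -/
theorem found_or_stopped {c : Input} (hc : c.Marked) {s : WordRAM.State} (h : PathsInv c c.k s)
    {A : Finset ℕ} {Q : Set ℕ} {σ : ℕ → ℕ} (hA : c.Fence A σ) (hQ : c.Bridge Q σ) :
    (∃ t < s.reg 20, (∀ i < c.k, (tableOf c s).PosOK t i) ∧
      ∀ j < c.k, (tableOf c s).pos t j = σ j) ∨
    ∀ l < c.k, s.arr 6 l = c.pdat (σ l) := by
  by_cases hl : ∃ l < c.k, σ l < s.arr 14 l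
  · obtain ⟨l, hl, hlt⟩ := hl
    obtain ⟨u, hu, w, huw, hw⟩ := hQ.all l hl
    obtain ⟨h0, h1⟩ := (hQ.nb u hu w huw).2 (by omega)
    rw [hw, Nat.add_sub_cancel] at h1
    have hlt' := (hA.mid l hl)
    have htot := hc.poff_succ_le hl
    obtain ⟨-, h3, -⟩ := hc.eq_pdat hw h0 (by omega)
    rw [← h1] at h3
    obtain ⟨t, ht, h4⟩ := h.found Q σ hQ l hl hlt'.1.le hlt ⟨u, hu, h3 ▸ hc.nb_symm _ _ huw⟩
    have h5 : ∀ j < c.k, (tableOf c s).pos t j = σ j := h4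
    refine .inl ⟨t, ht, fun i hi => ?_, h5⟩
    obtain ⟨h6, h7⟩ := h.fence A σ hA i hi
    refine ⟨by rw [h5 i hi]; exact h6, fun j hj => ?_⟩
    rw [h5 i hi, h5 j hj]
    exact h7 j hj
  · push Not at hl
    refine .inr fun l hl' => ?_
    rw [h.verts l hl', le_antisymm (hl l hl') (h.fence A σ hA l hl').1]

end Shredder

/-! ### The output -/

namespace Shredder

open WordRAM

variable {n : ℕ} {G : SimpleGraph (Fin n)} {adj : Fin n → List (Fin n)} {k ν : ℕ} {x : Fin n}
  {P : Finset (VPath G)} {paths : List (VPath G)} {S : Finset (Fin n)}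

open Classical in
/-- The set of the vertices `f 0, …, f (k - 1)`. -/
def vertsOf (n k : ℕ) (f : ℕ → ℕ) : Finset (Fin n) := {v | ∃ j < k, v.val = f j}

theorem mem_vertsOf {f : ℕ → ℕ} {v : Fin n} : v ∈ vertsOf n k f ↔ ∃ j < k, v.val = f j := by
  simp [vertsOf]

theorem toFinset_map_range {f : ℕ → ℕ} (h : ∀ j < k, f j < n) :
    ((List.range k).map f).toFinset = (vertsOf n k f).image Fin.val := by
  ext u
  simp only [List.mem_toFinset, List.mem_map, List.mem_range, Finset.mem_image, mem_vertsOf]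
  constructor
  · rintro ⟨j, hj, rfl⟩
    exact ⟨⟨f j, h j hj⟩, ⟨j, hj, rfl⟩, rfl⟩
  · rintro ⟨v, ⟨j, hj, h⟩, rfl⟩
    exact ⟨j, hj, h.symm⟩

theorem hasOutput_empty {s : State} (h5 : s.reg 5 = 0) (h6 : s.reg 6 = 0) :
    HasOutput s ([] : List (Finset (Fin n))) ∅ := by
  simp [HasOutput, readLists, h5, h6]

theorem represents_inputOf (hadj : IsAdjList G adj) (mP mG : ℕ → ℕ) :
    ((inputOf adj k x ν paths).withMarks mP mG).Represents G :=
  ⟨rfl, nb_inputOf (k := k) (x := x) (ν := ν) (paths := paths) hadj⟩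

theorem length_eq_card (hnd : paths.Nodup) (hmem : ∀ p, p ∈ paths ↔ p ∈ P) :
    paths.length = P.card := by
  classical
  rw [← List.toFinset_card_of_nodup hnd]
  congr 1
  ext p
  simp [hmem]

/-- If something is captured, the input passes the first tests. -/
theorem Captures.accepted (h : Captures G k x ν P S) (hnd : paths.Nodup)
    (hmem : ∀ p, p ∈ paths ↔ p ∈ P) : paths.length = k ∧
      (inputOf adj k x ν paths).tot ≤ k * k * ν + k ∧ (inputOf adj k x ν paths).Good := by
  classical
  obtain ⟨-, C, -, -, hx, -, -, hcard, hends, hdisj, hsum⟩ := h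
  have hlen : paths.length = k := (length_eq_card hnd hmem).trans hcard
  have hP : P = paths.toFinset := by
    ext p
    simp [hmem]
  refine ⟨hlen, ?_, good_inputOf hlen hnd (fun p hp => (hends p ((hmem p).mp hp)).1)
    (fun p hp hpx => ?_)
    fun p hp q hq => hdisj p ((hmem p).mp hp) q ((hmem q).mp hq)⟩
  · rw [hP, List.sum_toFinset _ hnd, sq] at hsum
    have h1 : (paths.map VPath.length).sum ≤ k * k * ν := hsum
    rw [tot_inputOf hlen]
    omega
  · simp only [rest, Set.mem_iUnion] at hx
    obtain ⟨D, hD, hxD⟩ := hx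
    exact hD (Component.eq_of_mem hxD (hpx ▸ (hends p ((hmem p).mp hp)).2))

theorem vol_mono {A B : Set (Fin n)} (h : A ⊆ B) : vol G A ≤ vol G B :=
  Set.ncard_le_ncard (fun _ he => ⟨he.1, he.2.imp fun _ hu => ⟨h hu.1, hu.2⟩⟩) (Set.toFinite _)

/-- Captured shredders are among those that are listed, or the last set. -/
theorem Captures.found {mP mG : ℕ → ℕ} {s : State} (hk : 1 ≤ k) (hconn : vertexConnectivity G = k)
    (hadj : IsAdjList G adj) (hlen : paths.length = k) (hmem : ∀ p, p ∈ paths ↔ p ∈ P)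
    (hc : ((inputOf adj k x ν paths).withMarks mP mG).Marked)
    (hs : PathsInv ((inputOf adj k x ν paths).withMarks mP mG) k s)
    (h : Captures G k x ν P S) :
    (∃ t < s.reg 20,
      (∀ i < k, (tableOf ((inputOf adj k x ν paths).withMarks mP mG) s).PosOK t i) ∧
      S = vertsOf n k fun j => (inputOf adj k x ν paths).pdat
        ((tableOf ((inputOf adj k x ν paths).withMarks mP mG) s).pos t j)) ∨
    S = vertsOf n k (s.arr 6) := by
  classical
  obtain ⟨⟨hS, hthree⟩, C, -, -, hx, -, hvol, -, hends, -, -⟩ := h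
  simp only [rest, Set.mem_iUnion] at hx
  obtain ⟨D, hDC, hxD⟩ := hx
  obtain ⟨E, hEC, hED⟩ := exists_third_component hthree C D
  have hG := represents_inputOf (k := k) (x := x) (ν := ν) (paths := paths) hadj mP mG
  have hi : ∀ i < k, i < paths.length := fun i h => hlen ▸ h
  obtain ⟨σ, hcut⟩ := exists_cut (S := Fin.val '' (S : Set (Fin n))) (D := D.nums) (C := C.nums) hc
    (by rw [Set.ncard_image_of_injective _ Fin.val_injective, Set.ncard_coe_finset]; exact hS)
    ⟨x, hxD, rfl⟩
    (fun i h => ⟨_, (hends _ ((hmem _).mp (List.getElem_mem (hi i h)))).2,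
      (last_inputOf (adj := adj) (k := k) (x := x) (ν := ν) (hi i h)).symm⟩)
    (D.nums_nb hG) (C.nums_nb hG) C.nums_disjoint (Component.nums_disjoint_nums hDC)
    (fun i h g h1 h2 => nb_pdat (k := k) (x := x) (ν := ν) hadj (hi i h) h1 h2)
  have hdeg : ∀ v, (adj v).length = G.degree v := fun v => by
    rw [← G.card_neighborFinset_eq_degree, ← List.toFinset_card_of_nodup (hadj v).1]
    congr 1
    ext w
    simp [(hadj v).2]
  have hfence := fence_of_cut hc hG hcut hDC (D.verts.toFinset.image Fin.val)
    (fun u => by simp [Component.nums]) (by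
      rw [Finset.sum_image fun _ _ _ _ h => Fin.ext h]
      have h1 := sum_degree_le (fun v => exists_adj_of_vertexConnectivity (G := G) (by omega) v)
        D.verts.toFinset
      rw [Set.coe_toFinset] at h1
      have h2 : vol G D.verts ≤ vol G (rest C) := vol_mono (Set.subset_biUnion_of_mem hDC)
      refine Nat.lt_succ_of_le (le_trans (le_of_eq ?_)
        (h1.trans (show 4 * vol G D.verts ≤ 4 * ν by omega)))
      refine Finset.sum_congr rfl fun v _ => ?_
      rw [← hdeg]
      exact congrArg (· + 1) (deg_inputOf (k := k) (x := x) (ν := ν) (paths := paths) v))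
  have hbridge := bridge_of_cut hc hG hcut hED hEC fun v hv =>
    exists_adj_of_mem_separator (hconn.trans hS.symm) hEC hv
  have hSσ : ∀ f : ℕ → ℕ, (∀ j < k, f j = (inputOf adj k x ν paths).pdat (σ j)) →
      S = vertsOf n k f := fun f hf => by
    ext v
    rw [mem_vertsOf]
    have h1 := hcut.mem v
    rw [Function.Injective.mem_set_image Fin.val_injective] at h1
    rw [← Finset.mem_coe, h1]
    exact exists_congr fun j => and_congr_right fun hj => by rw [hf j hj]
  rcases found_or_stopped hc hs hfence hbridge with ⟨t, ht, h1, h2⟩ | h1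
  · exact .inl ⟨t, ht, h1, hSσ _ fun j hj => by rw [h2 j hj]⟩
  · exact .inr (hSσ _ h1)

/-- The output is correct if marking has succeeded. -/
theorem output_correct {mP mG : ℕ → ℕ} {s s₁ : State} (hk : 1 ≤ k)
    (hconn : vertexConnectivity G = k) (hadj : IsAdjList G adj) (hlen : paths.length = k)
    (hmem : ∀ p, p ∈ paths ↔ p ∈ P)
    (hc : ((inputOf adj k x ν paths).withMarks mP mG).Marked)
    (hs : Listed ((inputOf adj k x ν paths).withMarks mP mG) s₁ s) :
    ∃ (L : List (Finset (Fin n))) (U : Finset (Fin n)), HasOutput s L U ∧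
      (∀ S ∈ L, IsShredder G k S) ∧ ∀ S, Captures G k x ν P S → S ∈ L ∨ S = U := by
  obtain ⟨hp, ⟨l, hl, hread⟩, h6, harr⟩ := hs
  have hG := represents_inputOf (k := k) (x := x) (ν := ν) (paths := paths) hadj mP mG
  have hhalt := hp.halted
  have hltT : ∀ i < k, ∀ g ≤ s₁.arr 14 i, (inputOf adj k x ν paths).pdat g < n :=
    fun i hi g hg => hc.pdat_lt g ((hg.trans_lt (hhalt i hi).2.1).trans_le (hc.poff_succ_le hi))
  refine ⟨l.map fun t => vertsOf n k fun j => (inputOf adj k x ν paths).pdat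
      ((tableOf ((inputOf adj k x ν paths).withMarks mP mG) s₁).pos t j),
    vertsOf n k (s₁.arr 6), ⟨?_, ?_⟩, fun S hS => ?_, fun S hS => ?_⟩
  · rw [hread, List.map_map, List.map_map]
    refine List.map_congr_left fun t ht => ?_
    exact toFinset_map_range fun j hj => hltT j hj _ (((hl t).mp ht).2 j hj).1
  · rw [h6, harr]
    refine toFinset_map_range fun j hj => ?_
    rw [hp.verts j hj]
    exact hltT j hj _ le_rfl
  · obtain ⟨t, ht, rfl⟩ := List.mem_map.mp hS
    obtain ⟨ht, hok⟩ := (hl t).mp ht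
    exact isShredder_of_candOK hc hG (hp.cand_ok t ht)
      (fun i hi => (hok i hi).1.trans_lt (hhalt i hi).2.1)
      (fun i hi h => (hhalt i hi).2.2 _ h (hok i hi).1) (fun i hi => (hok i hi).2)
      fun v => mem_vertsOf
  · rcases hS.found hk hconn hadj hlen hmem hc hp with ⟨t, ht, h1, h2⟩ | h
    · exact .inl (List.mem_map.mpr ⟨t, (hl t).mpr ⟨ht, h1⟩, h2.symm⟩)
    · exact .inr h

/-- All words that are stored fit into the bound `(n + ν + |P|) ^ 5`. -/
theorem small_inputOf {m : ℕ} (hm : m = n + ν + paths.length) (hk : 1 ≤ k) (hkn : k < n)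
    (hν : 1 ≤ ν) (hadj : IsAdjList G adj) : (inputOf adj k x ν paths).Small (m ^ 5) ∧
      (initState adj k x ν paths).Bdd (m ^ 5) := by
  have h3 : 3 ≤ m := by omega
  have h9 : 9 ≤ m * m := Nat.mul_le_mul h3 h3
  have hmm : m ≤ m * m := Nat.le_mul_of_pos_left m (by omega)
  have h5 : 9 * (m * m * m) ≤ m ^ 5 := by
    calc 9 * (m * m * m) ≤ m * m * (m * m * m) := Nat.mul_le_mul_right _ h9
      _ = m ^ 5 := by ring
  have h4 : m * m ≤ m * m * m := Nat.le_mul_of_pos_right _ (by omega)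
  have hnn : n * n ≤ m * m := Nat.mul_le_mul (by omega) (by omega)
  have hpn : paths.length * n ≤ m * m := Nat.mul_le_mul (by omega) (by omega)
  have htot : (inputOf adj k x ν paths).tot ≤ m * m := by
    refine ((offsets_le k).trans (flatten_length_le (m := n) fun a ha => ?_)).trans
      (by simpa using hpn)
    obtain ⟨p, -, rfl⟩ := List.mem_map.mp ha
    simpa using length_verts_le p
  refine ⟨⟨by omega, ?_, ?_⟩, bdd_initState hadj (by omega) (by omega) (by omega) (by omega)
    (by omega)⟩
  · have h6 : k * (4 * ν + 1 + 1) + 1 ≤ 7 * (m * m) := by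
      have : k * (4 * ν + 1 + 1) ≤ m * (4 * m + 2) := Nat.mul_le_mul (by omega) (by omega)
      have e : m * (4 * m + 2) = 4 * (m * m) + 2 * m := by ring
      omega
    calc (k * (4 * ν + 1 + 1) + 1) * k ≤ 7 * (m * m) * m := Nat.mul_le_mul h6 (by omega)
      _ = 7 * (m * m * m) := by ring
      _ ≤ m ^ 5 := by omega
  · calc ((inputOf adj k x ν paths).tot + 1) * k ≤ 2 * (m * m) * m :=
        Nat.mul_le_mul (by omega) (by omega)
      _ = 2 * (m * m * m) := by ring
      _ ≤ m ^ 5 := by omega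

end Shredder

theorem mainTheorem3 :
    ∃ (prog : WordRAM.Prog) (c d : ℕ),
      ∀ (n k ν : ℕ) (G : SimpleGraph (Fin n)) (adj : Fin n → List (Fin n)) (x : Fin n)
        (P : Finset (Shredder.VPath G)) (paths : List (Shredder.VPath G)),
        1 ≤ k → Shredder.vertexConnectivity G = k → 1 ≤ ν →
        Shredder.IsAdjList G adj →
        paths.Nodup → (∀ p, p ∈ paths ↔ p ∈ P) →
        ∃ (t : ℕ) (s : WordRAM.State) (L : List (Finset (Fin n))) (U : Finset (Fin n)),
          WordRAM.Runs ((n + ν + P.card) ^ d) prog (Shredder.initState adj k x ν paths) t s ∧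
          Shredder.HasOutput s L U ∧
          (∀ S ∈ L, Shredder.IsShredder G k S) ∧
          (∀ S, Shredder.Captures G k x ν P S → S ∈ L ∨ S = U) ∧
          (t : ℝ) ≤ c * ((k : ℝ) ^ 2 * ν * Real.log (ν + 1)) := by
  -- The program takes at most `2000 * k ^ 2 * ν` steps, and `log (ν + 1) ≥ 1 / 2`. Its state is
  -- bounded by `(n + ν + |P|) ^ 5`, and its expressions have degree at most `10` in the state.
  refine ⟨Shredder.localShredders, 4000, 50,
    fun n k ν G adj x P paths hk hconn hν hadj hnd hmem => ?_⟩
  have hlen := Shredder.length_eq_card hnd hmem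
  have hkn : k < n := by
    have h1 := Shredder.vertexConnectivity_lt G
    rw [hconn, Fintype.card_fin] at h1
    omega
  obtain ⟨hsmall, hbdd⟩ := Shredder.small_inputOf (x := x) (paths := paths) (m := n + ν + P.card)
    (by rw [hlen]) hk hkn hν hadj
  obtain ⟨t, s, hrun, ht, -, hpost⟩ := Shredder.localShredders_spec hbdd
    (Shredder.starts_initState adj k x ν paths) hsmall hν hk
    fun h => Shredder.raw_inputOf hk hadj h
  have hout : ∃ (L : List (Finset (Fin n))) (U : Finset (Fin n)), Shredder.HasOutput s L U ∧
      (∀ S ∈ L, Shredder.IsShredder G k S) ∧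
      ∀ S, Shredder.Captures G k x ν P S → S ∈ L ∨ S = U := by
    rcases hpost with ⟨hrej, h5, h6⟩ | ⟨h4, ⟨hgood, h5, h6⟩ | ⟨mP, mG, s₁, hc, hs⟩⟩
    · refine ⟨[], ∅, Shredder.hasOutput_empty h5 h6, by simp, fun S hS => ?_⟩
      obtain ⟨h1, h2, -⟩ := hS.accepted (adj := adj) hnd hmem
      rcases hrej with h | h
      · exact absurd h1 h
      · exact absurd h2 (not_le.mpr h)
    · refine ⟨[], ∅, Shredder.hasOutput_empty h5 h6, by simp, fun S hS => ?_⟩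
      exact absurd (hS.accepted (adj := adj) hnd hmem).2.2 hgood
    · exact Shredder.output_correct hk hconn hadj h4 hmem hc hs
  obtain ⟨L, U, h1, h2, h3⟩ := hout
  refine ⟨t, s, L, U, ?_, h1, h2, h3, ?_⟩
  · rw [← pow_mul] at hrun
    exact hrun
  · have h4 : (t : ℝ) ≤ 2000 * ((k : ℝ) * k * ν) := by exact_mod_cast ht
    have h5 : (1 : ℝ) / 2 ≤ Real.log (ν + 1) := by
      have h6 : Real.log 2 ≤ Real.log (ν + 1) := by
        refine Real.log_le_log (by norm_num) ?_
        have : (1 : ℝ) ≤ ν := by exact_mod_cast hν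
        linarith
      have := Real.log_two_gt_d9
      linarith
    have h6 : (k : ℝ) ^ 2 * ν * (1 / 2) ≤ (k : ℝ) ^ 2 * ν * Real.log (ν + 1) :=
      mul_le_mul_of_nonneg_left h5 (by positivity)
    push_cast
    nlinarith
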